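/- Let $p$ be a prime and let $G$ be a finite group with a split $BN$-pair of characteristic $p$ satisfying the commutator relations. That is: $G=\langle B,N\rangle$ with $T=B\cap N$ normal in $N$; the Weyl group $W=N/T$ is generated by a set $S$ of involutions with $sBw\subseteq BwB\cup BswB$ and $sBs^{-1}\ne B$ for $s\in S$, $w\in W$; $B=U\rtimes T$ with $U$ a normal $p$-subgroup of $B$ and $T$ an abelian $p'$-group; $\bigcap_{n\in N}nBn^{-1}=T$; and, for all roots $\alpha,\beta$ of $W$ with $\beta\neq\pm\alpha$, the root subgroups satisfy $[X_\alpha,X_\beta]\subseteq\langle X_\gamma \mid \gamma=a\alpha+b\beta \text{ a root},\ a,b>0\rangle$ (where $a,b$ are real, $X_{\alpha_s}=U\cap (sw_0)U(sw_0)^{-1}$ for $s\in S$ with $w_0$ the longest element of $W$, and $X_{w\alpha_s}=wX_{\alpha_s}w^{-1}$). For $J\subseteq S$ let $N_J$ be the preimage of $W_J=\langle J\rangle$ in $N$, and let $P_J=BN_JB$ be the standard parabolic subgroup, with unipotent radical $U_J=\bigcap_{n\in N_J}nUn^{-1}=O_p(P_J)$ and standard Levi subgroup $L_J=\langle T,X_\alpha\mid\alpha\in\Phi_J\rangle$,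 where $\Phi_J=\{w\alpha_s\mid w\in W_J,\ s\in J\}$. Let $P$ be a parabolic subgroup of $G$ with unipotent radical $Q$ and Levi complement $L$, i.e. $(P,Q,L)=(nP_Jn^{-1},nU_Jn^{-1},nL_Jn^{-1})$ for some $n\in N$ and $J\subseteq S$; so $P=Q\rtimes L$. Let $K$ be a field with $\operatorname{char}K\neq p$, and let $M$ be an irreducible $KG$-module which is imprimitive with block stabilizer $P$; that is, there is a decomposition $M=\bigoplus_{i=1}^{m}M_i$ into $m=[G:P]>1$ subspaces which are transitively permuted by $G$, such that $P$ is the stabilizer of $M_1$. Then: 1. $M$ is Harish-Chandra induced from $L$: there is a $KL$-module $X$ such that $M\cong R_L^G(X)=\operatorname{Ind}_P^G(\tilde X)$, where $\tilde X$ is the inflation of $X$ to $P$ (the extension of $X$ to $P$ on which $Q$ acts trivially). 2. For every decomposition of $M$ as above, $Q$ acts trivially on the block $M_1$ with stabilizer $P$. Equivalently, $Q$ acts trivially on every $KP$-module $Y$ with $M\cong\operatorname{Ind}_P^G(Y)$. -/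

import Mathlib

/-- A `BN`-pair in a group `G`: subgroups `B`, `N` generating `G` such that `T = B ∩ N` is normal
in `N`, and a set `S` of involutions generating the Weyl group `W = N / T`, with
`s B w ⊆ B w B ∪ B s w B` and `s B s⁻¹ ≠ B` for `s ∈ S`, `w ∈ W`. -/
structure BNPair (G : Type*) [Group G] where
  B : Subgroup G
  N : Subgroup G
  sup_eq_top : B ⊔ N = ⊤
  [normal_T : ((B ⊓ N).subgroupOf N).Normal]
  /-- The distinguished generators of the Weyl group `W = N / (B ∩ N)`. -/
  S : Set (N ⧸ (B ⊓ N).subgroupOf N)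
  orderOf_S : ∀ s ∈ S, orderOf s = 2
  closure_S : Subgroup.closure S = ⊤
  mul_cell : ∀ n m : N, (n : N ⧸ (B ⊓ N).subgroupOf N) ∈ S → ∀ b ∈ B,
    (n * b * m : G) ∈ DoubleCoset.doubleCoset (m : G) B B ∪
      DoubleCoset.doubleCoset (n * m : G) B B
  conj_ne : ∀ n : N, (n : N ⧸ (B ⊓ N).subgroupOf N) ∈ S →
    B.map (MulAut.conj (n : G)).toMonoidHom ≠ B

namespace BNPair

variable {G : Type*} [Group G] (D : BNPair G)

/-- The torus `T = B ∩ N`. -/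
def T : Subgroup G := D.B ⊓ D.N

/-- The Weyl group `W = N / T`. -/
abbrev W : Type _ := D.N ⧸ (D.B ⊓ D.N).subgroupOf D.N

instance : ((D.B ⊓ D.N).subgroupOf D.N).Normal := D.normal_T

/-- The length of `w ∈ W` with respect to the generating set `S`. -/
noncomputable def length (w : D.W) : ℕ :=
  sInf {k | ∃ l : List D.W, (∀ s ∈ l, s ∈ D.S) ∧ l.length = k ∧ l.prod = w}

/-- `n ∈ N` represents an element of maximal length of `W` (for finite `W`, the longest element
`w₀`). -/
def IsLongest (n : D.N) : Prop := ∀ w : D.W, D.length w ≤ D.length (n : D.W)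

/-- The root `w α_s` of `W`, identified with the set of all `v ∈ W` for which it is positive on the
chamber `v C₀`, i.e. for which `v⁻¹ w α_s` is a positive root, i.e. `ℓ(s w⁻¹ v) > ℓ(w⁻¹ v)`.
A root is determined by this half-space, its negative is the complementary half-space,
it is positive if and only if `1` belongs to the half-space, and `W` acts by left translation. -/
def root (w s : D.W) : Set D.W := {v | D.length (w⁻¹ * v) < D.length (s * (w⁻¹ * v))}

/-- The roots of `W`. -/
def IsRoot (α : Set D.W) : Prop := ∃ w s, s ∈ D.S ∧ α = D.root w s

/-- `γ` lies strictly between the roots `α` and `β ≠ ±α` of a finite Weyl group. As an inequality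
between linear forms on a real reflection space follows from two others exactly if the form is a
non-negative combination of these two, this says that the root vector of `γ` is `aα + bβ` with real
`a, b > 0`. -/
def StrictlyBetween (α β γ : Set D.W) : Prop :=
  D.IsRoot γ ∧ γ ≠ α ∧ γ ≠ β ∧ α ∩ β ⊆ γ ∧ αᶜ ∩ βᶜ ⊆ γᶜ

/-- For `J ⊆ S`, the full preimage `N_J` in `N` of the standard parabolic subgroup `W_J = ⟨J⟩` of
the Weyl group, as a subgroup of `G`. -/
def NJ (J : Set D.W) : Subgroup G :=
  ((Subgroup.closure J).comap (QuotientGroup.mk' ((D.B ⊓ D.N).subgroupOf D.N))).map D.N.subtype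

/-- The standard parabolic subgroup `P_J = B N_J B = ⟨B, N_J⟩`. -/
def stdParabolic (J : Set D.W) : Subgroup G := D.B ⊔ D.NJ J

/-- For a subgroup `U`, the simple root subgroup `X_s = U ∩ ᵐU`, with `m ∈ N` any representative
of `s w₀`. (All `m` give the same group `ᵐU` if `T` normalizes `U`, and
`α_s` is the only positive root that becomes negative under `(s w₀)⁻¹ w₀ = s`.) -/
def simpleRootSubgroup (U : Subgroup G) (s : D.W) : Subgroup G :=
  U ⊓ ⨅ (m : D.N) (n : D.N) (_ : (m : D.W) = s) (_ : D.IsLongest n),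
    U.map (MulAut.conj ((m * n : D.N) : G)).toMonoidHom

/-- The root subgroup `ⁿX_s`, which belongs to the root `w α_s`, `w = nT`. -/
def rootSubgroup (U : Subgroup G) (n : D.N) (s : D.W) : Subgroup G :=
  (D.simpleRootSubgroup U s).map (MulAut.conj (n : G)).toMonoidHom

end BNPair

/-- A split `BN`-pair of characteristic `p` satisfying the commutator relations: a saturated
`BN`-pair with `B = U ⋊ T`, where `U` is a normal `p`-subgroup of `B` and `T` an abelian
`p'`-group, such that `[X_α, X_β] ⊆ ⟨X_γ : γ = aα + bβ a root, a, b > 0⟩` for all roots `α, β` with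
`β ≠ ±α`. -/
structure SplitBNPair (p : ℕ) (G : Type*) [Group G] extends BNPair G where
  U : Subgroup G
  U_le : U ≤ B
  U_normal : (U.subgroupOf B).Normal
  U_pGroup : IsPGroup p U
  sup_T : U ⊔ toBNPair.T = B
  inf_T : U ⊓ toBNPair.T = ⊥
  T_comm : ∀ x ∈ toBNPair.T, ∀ y ∈ toBNPair.T, x * y = y * x
  T_card : (Nat.card toBNPair.T).Coprime p
  saturated : ⨅ n : N, B.map (MulAut.conj (n : G)).toMonoidHom = toBNPair.T
  commutator_rel : ∀ (n m : N) (s t : toBNPair.W), s ∈ S → t ∈ S →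
    toBNPair.root m t ≠ toBNPair.root n s → toBNPair.root m t ≠ (toBNPair.root n s)ᶜ →
    ⁅toBNPair.rootSubgroup U n s, toBNPair.rootSubgroup U m t⁆ ≤
      ⨆ (k : N) (r : toBNPair.W) (_ : r ∈ S)
        (_ : toBNPair.StrictlyBetween (toBNPair.root n s) (toBNPair.root m t)
          (toBNPair.root k r)),
        toBNPair.rootSubgroup U k r

namespace SplitBNPair

variable {p : ℕ} {G : Type*} [Group G] (D : SplitBNPair p G)

/-- The standard Levi subgroup `L_J = ⟨T, X_α : α ∈ Φ_J⟩`, where `Φ_J = W_J {α_s : s ∈ J}`. -/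
def stdLevi (J : Set D.W) : Subgroup G :=
  D.T ⊔ ⨆ (n : D.N) (s : D.W) (_ : (n : G) ∈ D.NJ J) (_ : s ∈ J), D.rootSubgroup D.U n s

/-- The unipotent radical `U_J = O_p(P_J)` of `P_J`, as the intersection of the `N_J`-conjugates of
`U` (which is the product of the `X_α` with `α` positive and not in `Φ_J`). -/
def stdUnipotentRadical (J : Set D.W) : Subgroup G :=
  ⨅ (n : D.N) (_ : (n : G) ∈ D.NJ J), D.U.map (MulAut.conj (n : G)).toMonoidHom

/-- `P` is a parabolic subgroup of `G` with unipotent radical `Q` and Levi complement `L`: the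
triple is an `N`-conjugate of a standard one. -/
def IsParabolic (P Q L : Subgroup G) : Prop :=
  ∃ (n : D.N) (J : Set D.W), J ⊆ D.S ∧
    P = (D.stdParabolic J).map (MulAut.conj (n : G)).toMonoidHom ∧
    Q = (D.stdUnipotentRadical J).map (MulAut.conj (n : G)).toMonoidHom ∧
    L = (D.stdLevi J).map (MulAut.conj (n : G)).toMonoidHom

end SplitBNPair

namespace Representation

variable {K G M : Type*} [Field K] [Group G] [AddCommGroup M] [Module K M]

/-- `M = ⨁ V i` is a decomposition into `[G : H] > 1` subspaces that are transitively permuted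
by `G`, and `H` is the stabilizer of the block `V i₀`. -/
structure IsBlockSystem (ρ : Representation K G M) (H : Subgroup G)
    (V : Fin H.index → Submodule K M) (i₀ : Fin H.index) : Prop where
  one_lt_index : 1 < H.index
  isInternal : DirectSum.IsInternal V
  permutes : ∀ g i, ∃ j, (V i).map (ρ g) = V j
  transitive : ∀ i j, ∃ g, (V i).map (ρ g) = V j
  stabilizer : ∀ g, g ∈ H ↔ (V i₀).map (ρ g) = V i₀

/-- `M` is imprimitive with block stabilizer `H`. -/
def IsImprimitive (ρ : Representation K G M) (H : Subgroup G) : Prop :=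
  ∃ V i₀, ρ.IsBlockSystem H V i₀

/-- For a group `P = Q ⋊ L`, the module `M` is isomorphic to the module
obtained from the `KL`-module `(X, τ)` by inflation to `P` (the `KP`-module `(X, σ)` that extends
`τ` and on which `Q` acts trivially), followed by induction from `P` to `G`. If `P` is a parabolic
subgroup with unipotent radical `Q` and Levi complement `L` this is Harish-Chandra induction
`R_L^G`. -/
def IsHarishChandraInduced (ρ : Representation K G M) (P Q L : Subgroup G) {X : Type*}
    [AddCommGroup X] [Module K X] (τ : Representation K L X) : Prop :=
  ∃ σ : Representation K P X,
    (∀ (x : P) (hx : (x : G) ∈ L), σ x = τ ⟨x, hx⟩) ∧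
    (∀ x : P, (x : G) ∈ Q → σ x = 1) ∧
    Nonempty (ρ.Equiv (ind P.subtype σ))

end Representation

/-! Let `M` be induced from a representation `σ` of `P` on `Y`, and let `P' = Q'L` be the parabolic
subgroup opposite to `P`. Summing over `Q'` turns the embedding `Y → M` into a map that is
equivariant for the inflation of `σ|L` to `P'`. It is injective because `Q' ∩ P = 1`, its translates
span `M` by irreducibility, and `|P'| = |P|` makes the dimensions match, so `M` is induced from this
inflation (`IsInducedFrom.opposite`). The same step from `P'` back to `P` shows that `M` is also
induced from the inflation `τ` of `σ|L` to `P`.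

It remains to compare `σ` with `τ` (`IsInducedFrom.eq_one_of_mem`). In the spirit of Mackey, a
`Q`-fixed vector of `M` is given by one vector of `Y` for each double coset `QrP`, fixed by `P ∩
r⁻¹Qr`. If `x = q₁l` lies in this intersection, then so does its Levi component `l` (for suitable
`r`). A vector fixed under `σ` is therefore fixed by `l`, and hence by `x` under `τ`. So the fixed
points for `σ` embed coordinatewise into those for `τ`; both spaces are the `Q`-fixed points of `M`,
so the embedding is onto. At the double coset `P`, all of `Y` is fixed under `τ`, hence also under
`σ`.

The group theory needed is collected in `IsOppositePair` and derived from the axioms. Elements of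
`W` are viewed as chambers, with `wB` as stabilizer of the chamber `w`. An element that fixes two
chambers fixes every geodesic between them (`conjB_inf_le`). Together with saturation and counting,
this gives the factorizations of `U`, the description of the root subgroups by half-spaces, and the
triviality of `Q ∩ P'`. The commutator relations enter through `commutator_le`, which makes `U_J`
normal in `P_J`; compatibility with Levi components is `levi_component_mem`. -/

namespace BNPair

variable {G : Type*} [Group G] (D : BNPair G)

/-! ### Words and lengths in the Weyl group. -/

theorem mul_self_of_mem {s : D.W} (hs : s ∈ D.S) : s * s = 1 := by
  have := pow_orderOf_eq_one s
  rwa [D.orderOf_S s hs, pow_two] at this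

theorem ne_one_of_mem {s : D.W} (hs : s ∈ D.S) : s ≠ 1 := by
  rintro rfl
  have := D.orderOf_S 1 hs
  simp at this

theorem inv_eq_of_mem {s : D.W} (hs : s ∈ D.S) : s⁻¹ = s :=
  inv_eq_of_mul_eq_one_left (D.mul_self_of_mem hs)

theorem mul_mul_cancel_of_mem {s : D.W} (hs : s ∈ D.S) (w : D.W) : s * (s * w) = w := by
  rw [← mul_assoc, D.mul_self_of_mem hs, one_mul]

theorem mul_mul_cancel_right_of_mem {s : D.W} (hs : s ∈ D.S) (w : D.W) : w * s * s = w := by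
  rw [mul_assoc, D.mul_self_of_mem hs, mul_one]

/-- Every element of `⟨J⟩` is a product of elements of `J ⊆ S`. -/
theorem exists_word_of_mem_closure {J : Set D.W} (hJ : J ⊆ D.S) {w : D.W}
    (hw : w ∈ Subgroup.closure J) : ∃ l : List D.W, (∀ s ∈ l, s ∈ J) ∧ l.prod = w := by
  induction hw using Subgroup.closure_induction with
  | mem x hx => exact ⟨[x], by simpa using hx, by simp⟩
  | one => exact ⟨[], by simp, rfl⟩
  | mul x y _ _ hx hy =>
    obtain ⟨l, hl, rfl⟩ := hx
    obtain ⟨k, hk, rfl⟩ := hy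
    exact ⟨l ++ k, fun s hs => (List.mem_append.1 hs).elim (hl s) (hk s), by simp⟩
  | inv x _ hx =>
    obtain ⟨l, hl, rfl⟩ := hx
    refine ⟨(l.map (·⁻¹)).reverse, fun s hs => ?_, by simp [List.prod_inv_reverse]⟩
    simp only [List.mem_reverse, List.mem_map] at hs
    obtain ⟨t, ht, rfl⟩ := hs
    rw [D.inv_eq_of_mem (hJ (hl t ht))]
    exact hl t ht

theorem exists_word (w : D.W) : ∃ l : List D.W, (∀ s ∈ l, s ∈ D.S) ∧ l.prod = w :=
  D.exists_word_of_mem_closure subset_rfl (by rw [D.closure_S]; trivial)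

theorem length_le_of_word {l : List D.W} (hl : ∀ s ∈ l, s ∈ D.S) : D.length l.prod ≤ l.length :=
  Nat.sInf_le ⟨l, hl, rfl, rfl⟩

theorem exists_reduced_word (w : D.W) :
    ∃ l : List D.W, (∀ s ∈ l, s ∈ D.S) ∧ l.length = D.length w ∧ l.prod = w := by
  obtain ⟨l, hl, hw⟩ := D.exists_word w
  exact Nat.sInf_mem (s := {k | ∃ l : List D.W, (∀ s ∈ l, s ∈ D.S) ∧ l.length = k ∧ l.prod = w})
    ⟨l.length, l, hl, rfl, hw⟩

@[simp]
theorem length_one : D.length 1 = 0 := by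
  simpa using D.length_le_of_word (l := []) (by simp)

theorem eq_one_of_length_eq_zero {w : D.W} (h : D.length w = 0) : w = 1 := by
  obtain ⟨l, -, hl, rfl⟩ := D.exists_reduced_word w
  rw [h, List.length_eq_zero_iff] at hl
  simp [hl]

theorem length_mul_le (v w : D.W) : D.length (v * w) ≤ D.length v + D.length w := by
  obtain ⟨l, hl, hlv, rfl⟩ := D.exists_reduced_word v
  obtain ⟨k, hk, hkw, rfl⟩ := D.exists_reduced_word w
  rw [← hlv, ← hkw, ← List.prod_append, ← List.length_append]
  refine D.length_le_of_word fun s hs => ?_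
  rcases List.mem_append.1 hs with h | h
  exacts [hl s h, hk s h]

theorem length_inv_le (w : D.W) : D.length w⁻¹ ≤ D.length w := by
  obtain ⟨l, hl, hlw, rfl⟩ := D.exists_reduced_word w
  rw [← hlw, List.prod_inv_reverse]
  refine (D.length_le_of_word fun s hs => ?_).trans_eq (by simp)
  simp only [List.mem_reverse, List.mem_map] at hs
  obtain ⟨t, ht, rfl⟩ := hs
  rw [D.inv_eq_of_mem (hl t ht)]
  exact hl t ht

@[simp]
theorem length_inv (w : D.W) : D.length w⁻¹ = D.length w :=
  (D.length_inv_le w).antisymm (by simpa using D.length_inv_le w⁻¹)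

theorem length_of_mem_le {s : D.W} (hs : s ∈ D.S) : D.length s ≤ 1 := by
  simpa using D.length_le_of_word (l := [s]) (by simpa using hs)

theorem length_of_mem {s : D.W} (hs : s ∈ D.S) : D.length s = 1 := by
  have := D.length_of_mem_le hs
  have h0 : D.length s ≠ 0 := fun h => D.ne_one_of_mem hs (D.eq_one_of_length_eq_zero h)
  omega

theorem length_mul_left_le {s : D.W} (hs : s ∈ D.S) (w : D.W) :
    D.length (s * w) ≤ D.length w + 1 := by
  have := D.length_mul_le s w
  have := D.length_of_mem_le hs
  omega

theorem length_le_mul_left {s : D.W} (hs : s ∈ D.S) (w : D.W) :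
    D.length w ≤ D.length (s * w) + 1 := by
  simpa [D.mul_mul_cancel_of_mem hs] using D.length_mul_left_le hs (s * w)

theorem length_mul_right_le {s : D.W} (hs : s ∈ D.S) (w : D.W) :
    D.length (w * s) ≤ D.length w + 1 := by
  have := D.length_mul_le w s
  have := D.length_of_mem_le hs
  omega

theorem length_le_mul_right {s : D.W} (hs : s ∈ D.S) (w : D.W) :
    D.length w ≤ D.length (w * s) + 1 := by
  simpa [D.mul_mul_cancel_right_of_mem hs] using D.length_mul_right_le hs (w * s)

theorem exists_left_descent {w : D.W} (hw : w ≠ 1) :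
    ∃ s ∈ D.S, ∃ v, w = s * v ∧ D.length w = D.length v + 1 := by
  obtain ⟨l, hl, hlw, rfl⟩ := D.exists_reduced_word w
  cases l with
  | nil => simp at hw
  | cons s l =>
    refine ⟨s, hl s (by simp), l.prod, by simp, ?_⟩
    have h1 := D.length_le_of_word (l := l) fun t ht => hl t (by simp [ht])
    have h2 := D.length_mul_left_le (hl s (by simp)) l.prod
    simp only [List.prod_cons, List.length_cons] at hlw h2 ⊢
    omega

theorem exists_right_descent {w : D.W} (hw : w ≠ 1) :
    ∃ s ∈ D.S, ∃ v, w = v * s ∧ D.length w = D.length v + 1 := by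
  obtain ⟨s, hs, v, hv, hl⟩ := D.exists_left_descent (inv_ne_one.2 hw)
  refine ⟨s, hs, v⁻¹, ?_, by simpa using hl⟩
  rw [← inv_inv w, hv, mul_inv_rev, D.inv_eq_of_mem hs]

/-- Induction on reduced expressions. -/
theorem reduced_induction {p : D.W → Prop} (one : p 1)
    (mul : ∀ s ∈ D.S, ∀ w, D.length (s * w) = D.length w + 1 → p w → p (s * w)) (w : D.W) :
    p w := by
  induction h : D.length w generalizing w with
  | zero => rw [D.eq_one_of_length_eq_zero h]; exact one
  | succ k ih =>
    obtain ⟨s, hs, v, rfl, hv⟩ := D.exists_left_descent (w := w) (by rintro rfl; simp at h)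
    exact mul s hs v hv (ih v (by omega))

/-! ### Bruhat cells -/

theorem exists_rep (w : D.W) : ∃ n : D.N, (n : D.W) = w := QuotientGroup.mk_surjective w

theorem coe_eq_coe_iff {n m : D.N} : (n : D.W) = m ↔ (n : G)⁻¹ * m ∈ D.B := by
  rw [QuotientGroup.eq, Subgroup.mem_subgroupOf, Subgroup.mem_inf]
  simp only [Subgroup.coe_mul, Subgroup.coe_inv]
  exact ⟨fun h => h.1, fun h => ⟨h, D.N.mul_mem (D.N.inv_mem n.2) m.2⟩⟩

theorem coe_eq_coe_iff' {n m : D.N} : (n : D.W) = m ↔ (n : G) * (m : G)⁻¹ ∈ D.B := by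
  rw [← inv_inj, ← QuotientGroup.mk_inv, ← QuotientGroup.mk_inv, coe_eq_coe_iff]
  simp

theorem coe_eq_one_iff {n : D.N} : (n : D.W) = 1 ↔ (n : G) ∈ D.B := by
  rw [eq_comm, ← QuotientGroup.mk_one, coe_eq_coe_iff]
  simp

/-- The double coset `B w B`. -/
def cell (w : D.W) : Set G :=
  {g | ∃ b ∈ D.B, ∃ n : D.N, (n : D.W) = w ∧ ∃ c ∈ D.B, g = b * n * c}

variable {D}

theorem coe_mem_cell (n : D.N) : (n : G) ∈ D.cell n :=
  ⟨1, D.B.one_mem, n, rfl, 1, D.B.one_mem, by simp⟩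

theorem mul_mem_cell {w : D.W} {b g : G} (hb : b ∈ D.B) (hg : g ∈ D.cell w) :
    b * g ∈ D.cell w := by
  obtain ⟨b', hb', n, hn, c, hc, rfl⟩ := hg
  exact ⟨b * b', D.B.mul_mem hb hb', n, hn, c, hc, by group⟩

theorem mem_cell_mul {w : D.W} {b g : G} (hg : g ∈ D.cell w) (hb : b ∈ D.B) :
    g * b ∈ D.cell w := by
  obtain ⟨b', hb', n, hn, c, hc, rfl⟩ := hg
  exact ⟨b', hb', n, hn, c * b, D.B.mul_mem hc hb, by group⟩

theorem inv_mem_cell {w : D.W} {g : G} (hg : g ∈ D.cell w) : g⁻¹ ∈ D.cell w⁻¹ := by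
  obtain ⟨b, hb, n, rfl, c, hc, rfl⟩ := hg
  exact ⟨c⁻¹, D.B.inv_mem hc, n⁻¹, by simp, b⁻¹, D.B.inv_mem hb, by simp [mul_assoc]⟩

theorem mem_cell_one {g : G} : g ∈ D.cell 1 ↔ g ∈ D.B := by
  constructor
  · rintro ⟨b, hb, n, hn, c, hc, rfl⟩
    exact D.B.mul_mem (D.B.mul_mem hb (D.coe_eq_one_iff.1 hn)) hc
  · intro hg
    exact ⟨g, hg, 1, by simp, 1, D.B.one_mem, by simp⟩

/-- Two representatives of an element of `W` differ by an element of `T ≤ B`, so one fixed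
representative describes the whole cell. -/
theorem mem_cell_coe {n : D.N} {g : G} :
    g ∈ D.cell n ↔ ∃ b ∈ D.B, ∃ c ∈ D.B, g = b * n * c := by
  constructor
  · rintro ⟨b, hb, m, hm, c, hc, rfl⟩
    rw [coe_eq_coe_iff'] at hm
    exact ⟨b * (m * (n : G)⁻¹), D.B.mul_mem hb hm, c, hc, by group⟩
  · rintro ⟨b, hb, c, hc, rfl⟩
    exact ⟨b, hb, n, rfl, c, hc, rfl⟩

theorem mem_doubleCoset_iff {n : D.N} {g : G} :
    g ∈ DoubleCoset.doubleCoset (n : G) D.B D.B ↔ g ∈ D.cell n := by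
  rw [DoubleCoset.mem_doubleCoset, mem_cell_coe]
  rfl

theorem mul_mem_cell_or {s w : D.W} (hs : s ∈ D.S) {g h : G} (hg : g ∈ D.cell s)
    (hh : h ∈ D.cell w) : g * h ∈ D.cell w ∨ g * h ∈ D.cell (s * w) := by
  obtain ⟨b, hb, n, rfl, c, hc, rfl⟩ := hg
  obtain ⟨b', hb', m, rfl, c', hc', rfl⟩ := hh
  have e : b * n * c * (b' * m * c') = b * (n * (c * b') * m) * c' := by group
  rw [e]
  rcases D.mul_cell n m hs (c * b') (D.B.mul_mem hc hb') with h | h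
  · exact .inl (mem_cell_mul (mul_mem_cell hb (mem_doubleCoset_iff.1 h)) hc')
  · exact .inr (mem_cell_mul (mul_mem_cell hb (mem_doubleCoset_iff (n := n * m).1 h)) hc')

/-- Inversion exchanges the two sides and fixes `s`. -/
theorem mul_mem_cell_or' {s w : D.W} (hs : s ∈ D.S) {g h : G} (hg : g ∈ D.cell s)
    (hh : h ∈ D.cell w) : h * g ∈ D.cell w ∨ h * g ∈ D.cell (w * s) := by
  have hg' := inv_mem_cell hg
  rw [D.inv_eq_of_mem hs] at hg'
  rcases mul_mem_cell_or hs hg' (inv_mem_cell hh) with h | h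
  · left; simpa using inv_mem_cell h
  · right; simpa [D.inv_eq_of_mem hs] using inv_mem_cell h

theorem exists_mem_cell_mul {v w : D.W} {g : G} (hg : g ∈ D.cell (v * w)) :
    ∃ x ∈ D.cell v, ∃ y ∈ D.cell w, g = x * y := by
  obtain ⟨n, rfl⟩ := D.exists_rep v
  obtain ⟨m, rfl⟩ := D.exists_rep w
  obtain ⟨b, hb, c, hc, rfl⟩ := mem_cell_coe (n := n * m).1 hg
  exact ⟨b * n, mul_mem_cell hb (coe_mem_cell n), m * c, mem_cell_mul (coe_mem_cell m) hc, by
    simp [mul_assoc]⟩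

/-- Distinct Bruhat cells are disjoint. -/
theorem cell_inj {v w : D.W} {g : G} (hv : g ∈ D.cell v) (hw : g ∈ D.cell w) : v = w := by
  -- The induction runs over the shorter of the two elements.
  suffices H : ∀ (v w : D.W) (g : G), D.length v ≤ D.length w → g ∈ D.cell v → g ∈ D.cell w →
      v = w by
    rcases le_total (D.length v) (D.length w) with h | h
    · exact H v w g h hv hw
    · exact (H w v g h hw hv).symm
  clear hv hw g v w
  intro v
  induction v using D.reduced_induction with
  | one =>
    intro w g _ hv hw
    obtain ⟨n, rfl⟩ := D.exists_rep w
    rw [mem_cell_one] at hv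
    obtain ⟨b, hb, c, hc, rfl⟩ := mem_cell_coe.1 hw
    rw [eq_comm, coe_eq_one_iff]
    have := D.B.mul_mem (D.B.mul_mem (D.B.inv_mem hb) hv) (D.B.inv_mem hc)
    simpa [mul_assoc] using this
  | mul s hs v hl ih =>
    intro w g h hv hw
    obtain ⟨x, hx, y, hy, rfl⟩ := exists_mem_cell_mul hv
    have hx' := inv_mem_cell hx
    rw [D.inv_eq_of_mem hs] at hx'
    have hl2 := D.length_le_mul_left hs w
    -- Here `y = x⁻¹(xy)` lies in `BwB` or in `BswB`. The first case would give `v = w`, against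
    -- `ℓ(v) < ℓ(sv) ≤ ℓ(w)`.
    rcases mul_mem_cell_or hs hx' hw with h' | h' <;> rw [inv_mul_cancel_left] at h'
    · have := ih w y (by omega) hy h'
      subst this
      omega
    · rw [ih _ y (by omega) hy h', D.mul_mul_cancel_of_mem hs]

/-- Induction on `ℓ(w)` with `w = vr`, `ℓ(v) < ℓ(w)`. If `gh` stayed in `BwB`, then moving `r` to
the right would also place it in `BsvB` or `BsvrB`. Disjointness of cells leaves `w = sv`, where `sw
= v` is too short, or `w = sw`. -/
theorem mul_mem_cell_of_length_le {s w : D.W} (hs : s ∈ D.S) (hl : D.length w ≤ D.length (s * w))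
    {g h : G} (hg : g ∈ D.cell s) (hh : h ∈ D.cell w) : g * h ∈ D.cell (s * w) := by
  induction hk : D.length w generalizing w g h with
  | zero =>
    rw [D.eq_one_of_length_eq_zero hk] at hh ⊢
    rw [mul_one]
    exact mem_cell_mul hg (mem_cell_one.1 hh)
  | succ k ih =>
    obtain ⟨r, hr, v, rfl, hv⟩ := D.exists_right_descent (w := w) (by rintro rfl; simp at hk)
    rcases mul_mem_cell_or hs hg hh with h1 | h1
    swap
    · exact h1
    exfalso
    obtain ⟨x, hx, y, hy, rfl⟩ := exists_mem_cell_mul hh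
    have h3 := D.length_mul_right_le hr (s * v)
    rw [← mul_assoc] at hl
    have h2 := ih (by omega) hg hx (by omega)
    rw [← mul_assoc] at h1
    rcases mul_mem_cell_or' hr hy h2 with h4 | h4
    · have h5 := cell_inj h1 h4
      rw [mul_assoc, h5, D.mul_mul_cancel_of_mem hs, ← h5] at hl
      omega
    · have := cell_inj h1 h4
      rw [mul_assoc s] at this
      exact D.ne_one_of_mem hs (right_eq_mul.1 this)

theorem mul_mem_cell_of_length_add {v w : D.W} (hl : D.length (v * w) = D.length v + D.length w)
    {g h : G} (hg : g ∈ D.cell v) (hh : h ∈ D.cell w) : g * h ∈ D.cell (v * w) := by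
  induction v using D.reduced_induction generalizing g with
  | one => rw [one_mul]; exact mul_mem_cell (mem_cell_one.1 hg) hh
  | mul s hs v hv ih =>
    obtain ⟨x, hx, y, hy, rfl⟩ := exists_mem_cell_mul hg
    rw [mul_assoc] at hl
    have h1 := D.length_mul_left_le hs (v * w)
    have h2 := D.length_mul_le v w
    rw [mul_assoc, mul_assoc]
    exact mul_mem_cell_of_length_le hs (by omega) hx (ih (by omega) hy)

/-- The axiom only gives `nBn⁻¹ ≠ B`. Since `n² ∈ B`, a containment `nBn⁻¹ ⊆ B` would already be an
equality. -/
theorem exists_conj_notMem {n : D.N} (hn : (n : D.W) ∈ D.S) :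
    ∃ b ∈ D.B, (n * b * (n : G)⁻¹) ∉ D.B := by
  by_contra! H
  refine D.conj_ne n hn (le_antisymm ?_ ?_)
  · rintro _ ⟨b, hb, rfl⟩
    exact H b hb
  · intro b hb
    have h2 : (n * n : G) ∈ D.B := by
      have := D.mul_self_of_mem hn
      rw [← QuotientGroup.mk_mul, coe_eq_one_iff] at this
      simpa using this
    refine ⟨(n : G)⁻¹ * b * n, ?_, by simp [mul_assoc]⟩
    have := H _ (D.B.mul_mem (D.B.mul_mem (D.B.inv_mem h2) hb) h2)
    simpa [mul_assoc] using this

/-- If `ℓ(sw) ≤ ℓ(w)` then `B s B w B` meets `B w B`. -/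
theorem exists_mul_mem_cell {s w : D.W} (hs : s ∈ D.S) (hl : D.length (s * w) ≤ D.length w) :
    ∃ g ∈ D.cell s, ∃ h ∈ D.cell w, g * h ∈ D.cell w := by
  obtain ⟨n, rfl⟩ := D.exists_rep s
  obtain ⟨v, rfl⟩ : ∃ v, w = n * v := ⟨n * w, by rw [D.mul_mul_cancel_of_mem hs]⟩
  rw [D.mul_mul_cancel_of_mem hs] at hl
  obtain ⟨b, hb, hbn⟩ := exists_conj_notMem hs
  have h1 : (n * b * (n : G)⁻¹ : G) ∈ D.cell n := by
    have hn := inv_mem_cell (coe_mem_cell n)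
    rw [D.inv_eq_of_mem hs] at hn
    rcases mul_mem_cell_or hs (mem_cell_mul (coe_mem_cell n) hb) hn with h | h
    · exact h
    · rw [D.mul_self_of_mem hs, mem_cell_one] at h
      exact absurd h hbn
  obtain ⟨m, rfl⟩ := D.exists_rep v
  have h2 : (n * n : G) ∈ D.B := by
    have := D.mul_self_of_mem hs
    rw [← QuotientGroup.mk_mul, coe_eq_one_iff] at this
    simpa using this
  refine ⟨n * b, mem_cell_mul (coe_mem_cell n) hb, n * m, coe_mem_cell (n * m), ?_⟩
  -- The factor `nbn⁻¹n²` lies in `BsB`, and `ℓ(v) ≤ ℓ(sv)` sends its product with `m` into `BsvB =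
  -- BwB`.
  have e : (n * b * (n * m) : G) = n * b * (n : G)⁻¹ * (n * n) * m := by group
  rw [e]
  exact mul_mem_cell_of_length_le hs hl (mem_cell_mul h1 h2) (coe_mem_cell m)

/-- The Bruhat decomposition. -/
theorem exists_mem_cell (g : G) : ∃ w, g ∈ D.cell w := by
  have key : ∀ w : D.W, ∀ x ∈ D.cell w, ∀ v, ∀ y ∈ D.cell v, ∃ u, x * y ∈ D.cell u := by
    intro w
    induction w using D.reduced_induction with
    | one => exact fun x hx v y hy => ⟨v, mul_mem_cell (mem_cell_one.1 hx) hy⟩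
    | mul s hs w _ ih =>
      intro x hx v y hy
      obtain ⟨a, ha, b, hb, rfl⟩ := exists_mem_cell_mul hx
      obtain ⟨u, hu⟩ := ih b hb v y hy
      rw [mul_assoc]
      rcases mul_mem_cell_or hs ha hu with h | h
      exacts [⟨_, h⟩, ⟨_, h⟩]
  have hg : g ∈ D.B ⊔ D.N := by rw [D.sup_eq_top]; trivial
  rw [Subgroup.sup_eq_closure] at hg
  induction hg using Subgroup.closure_induction with
  | mem x hx =>
    rcases hx with hx | hx
    · exact ⟨1, mem_cell_one.2 hx⟩
    · exact ⟨_, coe_mem_cell ⟨x, hx⟩⟩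
  | one => exact ⟨1, mem_cell_one.2 D.B.one_mem⟩
  | mul x y _ _ hx hy =>
    obtain ⟨w, hw⟩ := hx
    obtain ⟨v, hv⟩ := hy
    exact key w x hw v y hv
  | inv x _ hx =>
    obtain ⟨w, hw⟩ := hx
    exact ⟨_, inv_mem_cell hw⟩

/-! ### Lengths and half-spaces -/

/-- Equal lengths would allow a product from `BsB · BwB` to lie both in `BwB` and in `BswB`. -/
theorem length_mul_left_ne {s : D.W} (hs : s ∈ D.S) (w : D.W) :
    D.length (s * w) ≠ D.length w := by
  intro h
  obtain ⟨x, hx, y, hy, hxy⟩ := exists_mul_mem_cell hs h.le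
  exact D.ne_one_of_mem hs (right_eq_mul.1 (cell_inj hxy (mul_mem_cell_of_length_le hs h.ge hx hy)))

theorem length_mul_left_of_lt {s : D.W} (hs : s ∈ D.S) {w : D.W}
    (h : D.length w < D.length (s * w)) : D.length (s * w) = D.length w + 1 := by
  have := D.length_mul_left_le hs w
  omega

theorem length_mul_left_of_not_lt {s : D.W} (hs : s ∈ D.S) {w : D.W}
    (h : ¬ D.length w < D.length (s * w)) : D.length w = D.length (s * w) + 1 := by
  have := D.length_le_mul_left hs w
  have := length_mul_left_ne hs w
  omega

/-- The folding condition. -/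
theorem mul_eq_mul_of_length {s r x : D.W} (hs : s ∈ D.S) (hr : r ∈ D.S)
    (h1 : D.length x < D.length (s * x)) (h2 : ¬ D.length (x * r) < D.length (s * (x * r))) :
    s * x = x * r := by
  have h3 := length_mul_left_of_lt hs h1
  have h4 := length_mul_left_of_not_lt hs h2
  have h5 := D.length_mul_right_le hr x
  have h6 := D.length_le_mul_right hr (s * x)
  rw [mul_assoc] at h6
  obtain ⟨g, hg, h, hh, hgh⟩ := exists_mul_mem_cell hs (w := x * r) (by omega)
  obtain ⟨a, ha, b, hb, rfl⟩ := exists_mem_cell_mul hh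
  rw [← mul_assoc] at hgh
  -- The product lies in `BxrB`. As `ga ∈ BsxB`, it also lies in `BsxB` or `BsxrB`, and the latter
  -- is disjoint from `BxrB`.
  rcases mul_mem_cell_or' hr hb (mul_mem_cell_of_length_le hs h1.le hg ha) with h | h
  · exact cell_inj h hgh
  · have := cell_inj h hgh
    rw [mul_assoc] at this
    exact absurd (mul_eq_right.1 this) (D.ne_one_of_mem hs)

theorem mem_root_iff {w s v : D.W} :
    v ∈ D.root w s ↔ D.length (w⁻¹ * v) < D.length (s * (w⁻¹ * v)) := Iff.rfl

theorem mem_root_self {w s : D.W} (hs : s ∈ D.S) : w ∈ D.root w s := by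
  simp [mem_root_iff, D.length_of_mem hs]

theorem mul_notMem_root {w s : D.W} (hs : s ∈ D.S) : w * s ∉ D.root w s := by
  simp [mem_root_iff, D.mul_self_of_mem hs]

theorem mem_root_mul_iff {w s v : D.W} (hs : s ∈ D.S) :
    v ∈ D.root (w * s) s ↔ v ∉ D.root w s := by
  simp only [mem_root_iff, mul_inv_rev, D.inv_eq_of_mem hs, mul_assoc, D.mul_mul_cancel_of_mem hs]
  have := length_mul_left_ne hs (w⁻¹ * v)
  omega

/-- The reflection of a root interchanges the two half-spaces. -/
theorem reflection_mem_root_iff {w s v : D.W} (hs : s ∈ D.S) :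
    w * s * w⁻¹ * v ∈ D.root w s ↔ v ∉ D.root w s := by
  simp only [mem_root_iff, mul_assoc, inv_mul_cancel_left, D.mul_mul_cancel_of_mem hs]
  have := length_mul_left_ne hs (w⁻¹ * v)
  omega

/-- A root is crossed at most at one wall by an edge of the Coxeter complex. -/
theorem reflection_eq_of_crossing {w s v r : D.W} (hs : s ∈ D.S) (hr : r ∈ D.S)
    (hv : v ∈ D.root w s) (hvr : v * r ∉ D.root w s) : w * s * w⁻¹ = v * r * v⁻¹ := by
  rw [mem_root_iff] at hv hvr
  rw [← mul_assoc] at hvr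
  have := mul_eq_mul_of_length hs hr hv hvr
  rw [eq_mul_inv_iff_mul_eq]
  calc w * s * w⁻¹ * v = w * (s * (w⁻¹ * v)) := by group
    _ = v * r := by rw [this]; group

/-- A gallery that leaves a half-space crosses its wall. -/
theorem exists_crossing (α : Set D.W) (l : List D.W) (v : D.W) (hv : v ∈ α)
    (hl : v * l.prod ∉ α) : ∃ l₁ r l₂, l = l₁ ++ r :: l₂ ∧ v * l₁.prod ∈ α ∧
      v * l₁.prod * r ∉ α := by
  induction l generalizing v with
  | nil => simp [hv] at hl
  | cons a l ih =>
    by_cases h : v * a ∈ α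
    · rw [List.prod_cons, ← mul_assoc] at hl
      obtain ⟨l₁, r, l₂, rfl, h1, h2⟩ := ih (v * a) h hl
      exact ⟨a :: l₁, r, l₂, rfl, by simpa [mul_assoc] using h1, by simpa [mul_assoc] using h2⟩
    · exact ⟨[], a, l, rfl, by simpa using hv, by simpa using h⟩

/-- Deletion argument: a reduced word of the reflected element is a gallery from `1` that crosses
the wall. Omitting the letter at the crossing leaves a word for `v`. -/
theorem length_lt_reflection {w s v : D.W} (hs : s ∈ D.S) (h1 : 1 ∈ D.root w s)
    (hv : v ∈ D.root w s) : D.length v < D.length (w * s * w⁻¹ * v) := by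
  obtain ⟨l, hl, hlen, hprod⟩ := D.exists_reduced_word (w * s * w⁻¹ * v)
  have hv' : 1 * l.prod ∉ D.root w s := by
    rw [hprod, one_mul, reflection_mem_root_iff hs]
    exact not_not.2 hv
  obtain ⟨l₁, r, l₂, rfl, h2, h3⟩ := exists_crossing _ l 1 h1 hv'
  have hr : r ∈ D.S := hl r (by simp)
  have h4 := reflection_eq_of_crossing hs hr h2 h3
  have h5 : v = (l₁ ++ l₂).prod := by
    have h6 : (w * s * w⁻¹) * (w * s * w⁻¹) = 1 := by
      simp [mul_assoc, D.mul_mul_cancel_of_mem hs]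
    calc v = (w * s * w⁻¹) * ((w * s * w⁻¹) * v) := by rw [← mul_assoc, h6, one_mul]
      _ = _ := by
        rw [← hprod, h4]
        simp [mul_assoc, D.mul_mul_cancel_of_mem hr]
  have h7 := D.length_le_of_word (l := l₁ ++ l₂) (fun t ht => hl t (by
    simp only [List.mem_append, List.mem_cons] at ht ⊢; tauto))
  rw [← hlen, h5]
  refine h7.trans_lt ?_
  simp

theorem one_mem_root_iff {w s : D.W} :
    1 ∈ D.root w s ↔ D.length w < D.length (w * s⁻¹) := by
  rw [mem_root_iff, mul_one, D.length_inv, ← D.length_inv (s * w⁻¹)]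
  simp

/-- The half-space of a root is determined by an edge that crosses its wall. -/
theorem root_eq_of_crossing {w s v r : D.W} (hs : s ∈ D.S) (hr : r ∈ D.S)
    (hv : v ∈ D.root w s) (hvr : v * r ∉ D.root w s) : D.root w s = D.root v r := by
  have key : ∀ {w s v r u : D.W}, s ∈ D.S → r ∈ D.S → v ∈ D.root w s → v * r ∉ D.root w s →
      u ∈ D.root v r → u ∈ D.root w s := by
    clear hv hvr hs hr w s v r
    intro w s v r u hs hr hv hvr hu
    by_contra hu'
    obtain ⟨l, hl, hlen, hprod⟩ := D.exists_reduced_word (v⁻¹ * u)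
    obtain ⟨l₁, t, l₂, rfl, h2, h3⟩ := exists_crossing (D.root w s) l v hv (by
      rw [hprod]; simpa using hu')
    have ht : t ∈ D.S := hl t (by simp)
    have h4 := reflection_eq_of_crossing hs ht h2 h3
    rw [reflection_eq_of_crossing hs hr hv hvr] at h4
    -- Both crossings have the same reflection, so deleting the letter `t` gives a word for
    -- `r(v⁻¹u)` that is shorter than `v⁻¹u`. This contradicts `u ∈ D.root v r`.
    have h5 : r * (v⁻¹ * u) = (l₁ ++ l₂).prod := by
      calc r * (v⁻¹ * u) = v⁻¹ * (v * r * v⁻¹) * v * (v⁻¹ * u) := by group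
        _ = _ := by
          rw [← hprod, h4]
          simp [mul_assoc, D.mul_mul_cancel_of_mem ht]
    have h7 := D.length_le_of_word (l := l₁ ++ l₂) (fun t ht => hl t (by
      simp only [List.mem_append, List.mem_cons] at ht ⊢; tauto))
    rw [mem_root_iff, ← hlen, h5] at hu
    simp at hu h7
    omega
  refine Set.Subset.antisymm (fun u hu => ?_) (fun u hu => key hs hr hv hvr hu)
  by_contra hu'
  rw [← mem_root_mul_iff hr] at hu'
  -- The reverse inclusion is the inclusion `key` for the two opposite roots.
  have := key (w := w * s) (s := s) hs hr (v := v * r) (r := r) (u := u)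
    ((mem_root_mul_iff hs).2 hvr) (by
      rw [mem_root_mul_iff hs, D.mul_mul_cancel_right_of_mem hr]; exact not_not.2 hv) hu'
  exact (mem_root_mul_iff hs).1 this hu

end BNPair

/-! ### Minimal coset representatives and longest elements of parabolic subgroups of `W`. -/

namespace BNPair

variable {G : Type*} [Group G] {D : BNPair G}

theorem length_mul_self_right {w s : D.W} (hs : s ∈ D.S) :
    (1 ∈ D.root w s ∧ D.length (w * s) = D.length w + 1) ∨
      (1 ∉ D.root w s ∧ D.length w = D.length (w * s) + 1) := by
  have h : (1 ∈ D.root w s) ↔ D.length w < D.length (w * s) := by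
    rw [one_mem_root_iff, D.inv_eq_of_mem hs]
  have h1 := D.length_mul_right_le hs w
  have h2 := D.length_le_mul_right hs w
  have h3 := length_mul_left_ne hs w⁻¹
  rw [D.length_inv, ← D.length_inv (s * w⁻¹), mul_inv_rev, inv_inv, D.inv_eq_of_mem hs] at h3
  rw [h]
  omega

theorem mem_root_cases {w s : D.W} (hs : s ∈ D.S) (v : D.W) :
    (v ∈ D.root w s ∧ D.length (s * (w⁻¹ * v)) = D.length (w⁻¹ * v) + 1) ∨
      (v ∉ D.root w s ∧ D.length (w⁻¹ * v) = D.length (s * (w⁻¹ * v)) + 1) := by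
  by_cases h : v ∈ D.root w s
  · exact .inl ⟨h, length_mul_left_of_lt hs h⟩
  · exact .inr ⟨h, length_mul_left_of_not_lt hs h⟩

/-- Induction on elements of `W_J` by right multiplication with elements of `J`. -/
theorem closure_induction_mul_right {J : Set D.W} (hJ : J ⊆ D.S) {p : D.W → Prop} (one : p 1)
    (mul : ∀ w ∈ Subgroup.closure J, ∀ s ∈ J, p w → p (w * s)) {w : D.W}
    (hw : w ∈ Subgroup.closure J) : p w := by
  obtain ⟨l, hl, rfl⟩ := D.exists_word_of_mem_closure hJ hw
  clear hw
  induction l using List.reverseRecOn with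
  | nil => simpa using one
  | append_singleton l s ih =>
    rw [List.prod_append, List.prod_singleton]
    refine mul _ (Subgroup.list_prod_mem _ fun t ht => Subgroup.subset_closure (hl t ?_)) s
      (hl s (by simp)) (ih fun t ht => hl t ?_) <;> simp [ht]

/-- If `m` lies in every positive half-space of a root in `Φ_J`, lengths add in `W_J × {m}`. -/
theorem length_mul_of_mem_roots {J : Set D.W} (hJ : J ⊆ D.S) {m : D.W}
    (hm : ∀ v ∈ Subgroup.closure J, ∀ s ∈ J, 1 ∈ D.root v s → m ∈ D.root v s) {x : D.W}
    (hx : x ∈ Subgroup.closure J) : D.length (x⁻¹ * m) = D.length x + D.length m := by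
  refine closure_induction_mul_right (p := fun x => D.length (x⁻¹ * m) = D.length x + D.length m)
    hJ (by simp) (fun w hw s hs ih => ?_) hx
  · rw [mul_inv_rev, D.inv_eq_of_mem (hJ hs), mul_assoc]
    rcases length_mul_self_right (w := w) (hJ hs) with ⟨h, h'⟩ | ⟨h, h'⟩
    · rcases mem_root_cases (w := w) (hJ hs) m with h2 | h2
      · omega
      · exact absurd (hm w hw s hs h) h2.1
    · rcases mem_root_cases (w := w) (hJ hs) m with h2 | h2
      · have := hm (w * s) (mul_mem hw (Subgroup.subset_closure hs)) s hs
          ((mem_root_mul_iff (hJ hs)).2 h)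
        exact absurd h2.1 ((mem_root_mul_iff (hJ hs)).1 this)
      · omega

/-- If `m` lies in no positive half-space of a root in `Φ_J`, it is opposite to `1` with respect
to `W_J`. -/
theorem length_mul_of_notMem_roots {J : Set D.W} (hJ : J ⊆ D.S) {m : D.W}
    (hm : ∀ v ∈ Subgroup.closure J, ∀ s ∈ J, 1 ∈ D.root v s → m ∉ D.root v s) {x : D.W}
    (hx : x ∈ Subgroup.closure J) : D.length m = D.length x + D.length (x⁻¹ * m) := by
  refine closure_induction_mul_right (p := fun x => D.length m = D.length x + D.length (x⁻¹ * m))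
    hJ (by simp) (fun w hw s hs ih => ?_) hx
  · rw [mul_inv_rev, D.inv_eq_of_mem (hJ hs), mul_assoc]
    rcases length_mul_self_right (w := w) (hJ hs) with ⟨h, h'⟩ | ⟨h, h'⟩
    · rcases mem_root_cases (w := w) (hJ hs) m with h2 | h2
      · exact absurd h2.1 (hm w hw s hs h)
      · omega
    · rcases mem_root_cases (w := w) (hJ hs) m with h2 | h2
      · omega
      · have := hm (w * s) (mul_mem hw (Subgroup.subset_closure hs)) s hs
          ((mem_root_mul_iff (hJ hs)).2 h)
        exact absurd ((mem_root_mul_iff (hJ hs)).2 h2.1) this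

theorem reflection_mem_closure {J : Set D.W} {v s : D.W} (hv : v ∈ Subgroup.closure J)
    (hs : s ∈ J) : v * s * v⁻¹ ∈ Subgroup.closure J :=
  mul_mem (mul_mem hv (Subgroup.subset_closure hs)) (inv_mem hv)

/-- Every coset `W_J w` has an element `m` with `ℓ(xm) = ℓ(x) + ℓ(m)` for all `x ∈ W_J`. -/
theorem exists_minimal {J : Set D.W} (hJ : J ⊆ D.S) (w : D.W) :
    ∃ x ∈ Subgroup.closure J, ∀ y ∈ Subgroup.closure J,
      D.length (y * (x * w)) = D.length y + D.length (x * w) := by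
  obtain ⟨⟨x, hx⟩, hmin⟩ : ∃ x : Subgroup.closure J, ∀ y : Subgroup.closure J,
      D.length (x * w) ≤ D.length (y * w) :=
    ⟨_, fun y => Function.argmin_le (fun x : Subgroup.closure J => D.length (x * w)) y⟩
  refine ⟨x, hx, fun y hy => ?_⟩
  have := length_mul_of_mem_roots (m := x * w) hJ ?_ (inv_mem hy)
  · simpa using this
  -- If the shortest element of the coset were on the negative side of a positive root of `Φ_J`, the
  -- reflection would produce a shorter one in the same coset.
  intro v hv s hs h1
  by_contra h2
  rw [← reflection_mem_root_iff (hJ hs)] at h2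
  have h3 := length_lt_reflection (hJ hs) h1 h2
  have h4 : ∀ u, v * s * v⁻¹ * (v * s * v⁻¹ * u) = u := fun u => by
    simp [mul_assoc, D.mul_mul_cancel_of_mem (hJ hs)]
  rw [h4] at h3
  have h5 := hmin ⟨v * s * v⁻¹ * x, mul_mem (reflection_mem_closure hv hs) hx⟩
  simp only [mul_assoc] at h5 h3
  omega

/-- `z` is the longest element of `W_J`. -/
structure IsLongestIn (J : Set D.W) (z : D.W) : Prop where
  mem : z ∈ Subgroup.closure J
  length_eq : ∀ x ∈ Subgroup.closure J, D.length z = D.length x + D.length (x⁻¹ * z)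

/-- An element of maximal length is on the negative side of every positive root of `Φ_J`, as
otherwise the reflection would lengthen it. -/
theorem isLongestIn_of_length_le {J : Set D.W} (hJ : J ⊆ D.S) {z : D.W}
    (hz : z ∈ Subgroup.closure J) (h : ∀ x ∈ Subgroup.closure J, D.length x ≤ D.length z) :
    IsLongestIn J z := by
  refine ⟨hz, fun x hx => length_mul_of_notMem_roots hJ (fun v hv s hs h1 h2 => ?_) hx⟩
  have h3 := length_lt_reflection (hJ hs) h1 h2
  have := h _ (mul_mem (reflection_mem_closure hv hs) hz)
  omega

theorem exists_isLongestIn [Finite G] {J : Set D.W} (hJ : J ⊆ D.S) : ∃ z, IsLongestIn J z := by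
  obtain ⟨⟨z, hz⟩, hmax⟩ := Finite.exists_max (fun x : Subgroup.closure J => D.length (x : D.W))
  exact ⟨z, isLongestIn_of_length_le hJ hz fun x hx => hmax ⟨x, hx⟩⟩

namespace IsLongestIn

variable {J : Set D.W} {z : D.W}

theorem length_inv_mul (h : IsLongestIn J z) {x : D.W} (hx : x ∈ Subgroup.closure J) :
    D.length (x⁻¹ * z) = D.length z - D.length x := by
  have := h.length_eq x hx
  omega

theorem length_mul (h : IsLongestIn J z) {x : D.W} (hx : x ∈ Subgroup.closure J) :
    D.length (x * z) = D.length z - D.length x := by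
  simpa using h.length_inv_mul (inv_mem hx)

theorem length_le (h : IsLongestIn J z) {x : D.W} (hx : x ∈ Subgroup.closure J) :
    D.length x ≤ D.length z := by
  have := h.length_eq x hx
  omega

theorem eq (h : IsLongestIn J z) {y : D.W} (hy : y ∈ Subgroup.closure J)
    (h' : D.length z ≤ D.length y) : y = z := by
  have h1 := h.length_eq y hy
  have h3 : y⁻¹ * z = 1 := D.eq_one_of_length_eq_zero (by omega)
  exact inv_mul_eq_one.1 h3

theorem inv (h : IsLongestIn J z) : z⁻¹ = z :=
  h.eq (inv_mem h.mem) (by rw [D.length_inv])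

theorem mul_self (h : IsLongestIn J z) : z * z = 1 := by
  rw [mul_eq_one_iff_eq_inv, h.inv]

theorem length_mul_right (h : IsLongestIn J z) {x : D.W} (hx : x ∈ Subgroup.closure J) :
    D.length (z * x) = D.length z - D.length x := by
  have := h.length_mul (inv_mem hx)
  rw [← D.length_inv, mul_inv_rev, inv_inv, h.inv] at this
  simpa using this

theorem length_conj (h : IsLongestIn J z) {x : D.W} (hx : x ∈ Subgroup.closure J) :
    D.length (z * x * z) = D.length x := by
  rw [mul_assoc, h.length_mul_right (mul_mem hx h.mem), h.length_mul hx]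
  have := h.length_le hx
  omega

/-- The longest element of `W_J` maps every root of `Φ_J` to a root of opposite sign. -/
theorem mul_mem_root_iff (h : IsLongestIn J z) (hJ : J ⊆ D.S) {u r v : D.W}
    (hu : u ∈ Subgroup.closure J) (hr : r ∈ J) (hv : v ∈ Subgroup.closure J) :
    v * z ∈ D.root u r ↔ v ∉ D.root u r := by
  have h1 : u⁻¹ * v ∈ Subgroup.closure J := mul_mem (inv_mem hu) hv
  have h2 : r * (u⁻¹ * v) ∈ Subgroup.closure J := mul_mem (Subgroup.subset_closure hr) h1
  have h3 := h.length_mul h1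
  have h4 := h.length_mul h2
  have h5 := h.length_le h1
  have h6 := h.length_le h2
  have h7 := length_mul_left_ne (hJ hr) (u⁻¹ * v)
  rw [mem_root_iff, mem_root_iff]
  rw [mul_assoc] at h3
  rw [mul_assoc, mul_assoc] at h4
  omega

/-- A root that separates two elements of `W_J` belongs to `Φ_J`. -/
theorem _root_.BNPair.exists_root_eq_of_separates (hJ : J ⊆ D.S) {w s v v' : D.W} (hs : s ∈ D.S)
    (hv : v ∈ Subgroup.closure J) (hv' : v' ∈ Subgroup.closure J) (h : v ∈ D.root w s)
    (h' : v' ∉ D.root w s) : ∃ u ∈ Subgroup.closure J, ∃ r ∈ J, D.root w s = D.root u r := by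
  obtain ⟨l, hl, hprod⟩ := D.exists_word_of_mem_closure hJ (mul_mem (inv_mem hv) hv')
  obtain ⟨l₁, r, l₂, rfl, h2, h3⟩ := exists_crossing (D.root w s) l v h (by
    rw [hprod]; simpa using h')
  exact ⟨v * l₁.prod, mul_mem hv (Subgroup.list_prod_mem _ fun t ht =>
      Subgroup.subset_closure (hl t (by simp [ht]))), r, hl r (by simp),
    root_eq_of_crossing hs (hJ (hl r (by simp))) h2 h3⟩

/-- The sum of a positive root outside `Φ_J` and a positive root in `Φ_J` is outside `Φ_J`. -/
theorem mem_of_strictlyBetween (h : IsLongestIn J z) (hJ : J ⊆ D.S) {w s v r : D.W} {γ : Set D.W}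
    (hs : s ∈ D.S) (h1 : 1 ∈ D.root w s) (hz : z ∈ D.root w s) (hv : v ∈ Subgroup.closure J)
    (hr : r ∈ J) (h1' : 1 ∈ D.root v r)
    (hγ : D.StrictlyBetween (D.root w s) (D.root v r) γ) : 1 ∈ γ ∧ z ∈ γ := by
  obtain ⟨⟨a, t, ht, rfl⟩, -, hne, hsub, hsub'⟩ := hγ
  have h1γ : 1 ∈ D.root a t := hsub ⟨h1, h1'⟩
  refine ⟨h1γ, ?_⟩
  by_contra hzγ
  -- A root that is positive at `1` but not on all of `W_J` lies in `Φ_J`, hence is negative at `z`.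
  have hα : ∀ x ∈ Subgroup.closure J, x ∈ D.root w s := by
    intro x hx
    by_contra hx'
    obtain ⟨u, hu, q, hq, e⟩ := exists_root_eq_of_separates hJ hs (one_mem _) hx h1 hx'
    rw [e] at h1 hz
    exact (h.mul_mem_root_iff hJ hu hq (one_mem _)).1 (by simpa using hz) h1
  -- If `γ` separates `1` from `z`, it lies in `Φ_J`. On `W_J` it contains `D.root v r`. Right
  -- multiplication by `z` complements both half-spaces there, so they agree on `W_J`, and a common
  -- crossed edge makes the roots equal.
  obtain ⟨u, hu, q, hq, e⟩ := exists_root_eq_of_separates hJ ht (one_mem _) h.mem h1γ hzγ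
  rw [e] at hne hsub
  have hβγ : ∀ x ∈ Subgroup.closure J, x ∈ D.root v r → x ∈ D.root u q :=
    fun x hx hxβ => hsub ⟨hα x hx, hxβ⟩
  have hγβ : ∀ x ∈ Subgroup.closure J, x ∈ D.root u q → x ∈ D.root v r := by
    intro x hx hxγ
    by_contra hxβ
    have h2 := (h.mul_mem_root_iff hJ hv hr hx).2 hxβ
    exact (h.mul_mem_root_iff hJ hu hq hx).1 (hβγ _ (mul_mem hx h.mem) h2) hxγ
  refine hne (root_eq_of_crossing (hJ hr) (hJ hq) (hγβ u hu (mem_root_self (hJ hq))) ?_).symm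
  exact fun hx => mul_notMem_root (hJ hq)
    (hβγ _ (mul_mem hu (Subgroup.subset_closure hq)) hx)

end IsLongestIn

theorem mem_of_length_eq_one {w : D.W} (h : D.length w = 1) : w ∈ D.S := by
  obtain ⟨s, hs, v, rfl, hv⟩ := D.exists_left_descent (w := w) (by rintro rfl; simp at h)
  rw [D.eq_one_of_length_eq_zero (w := v) (by omega), mul_one]
  exact hs

theorem mem_closure_S (w : D.W) : w ∈ Subgroup.closure D.S := by rw [D.closure_S]; trivial

/-- Conjugation by the longest element permutes `S`. -/
theorem IsLongestIn.conj_mem {z s : D.W} (h : IsLongestIn D.S z) (hs : s ∈ D.S) :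
    z * s * z ∈ D.S :=
  mem_of_length_eq_one (by rw [h.length_conj (mem_closure_S s), D.length_of_mem hs])

theorem isLongest_iff {z : D.W} (h : IsLongestIn D.S z) {n : D.N} : D.IsLongest n ↔ (n : D.W) = z := by
  refine ⟨fun hn => h.eq (mem_closure_S _) (hn z), ?_⟩
  rintro rfl w
  exact h.length_le (mem_closure_S w)

end BNPair

/-! ### Counting in products of two subgroups. -/

namespace Subgroup

variable {G : Type*} [Group G]

/-- After one factorization `x = hk` is chosen for each `x ∈ HK`, the others are `(hc, c⁻¹k)` with
`c ∈ H ∩ K`. -/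
theorem card_mul_card_eq_card_mul_card_inf (H K : Subgroup G) :
    Nat.card H * Nat.card K =
      Nat.card {x : G | ∃ h ∈ H, ∃ k ∈ K, x = h * k} * Nat.card (H ⊓ K : Subgroup G) := by
  have hc : ∀ x : {x : G | ∃ h ∈ H, ∃ k ∈ K, x = h * k}, ∃ h ∈ H, ∃ k ∈ K, x = h * k :=
    fun x => x.2
  choose h hh k hk e using hc
  rw [← Nat.card_prod, ← Nat.card_prod, eq_comm]
  refine Nat.card_congr (Equiv.ofBijective (fun p => (⟨h p.1 * p.2, H.mul_mem (hh _) p.2.2.1⟩,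
    ⟨(p.2 : G)⁻¹ * k p.1, K.mul_mem (K.inv_mem p.2.2.2) (hk _)⟩)) ⟨?_, ?_⟩)
  · rintro ⟨x, c⟩ ⟨y, d⟩ hxy
    simp only [Prod.mk.injEq, Subtype.mk.injEq] at hxy
    obtain ⟨h1, h2⟩ := hxy
    have hx : x = y := by
      apply Subtype.ext
      rw [e x, e y]
      calc h x * k x = (h x * c) * ((c : G)⁻¹ * k x) := by group
        _ = _ := by rw [h1, h2]; group
    subst hx
    rw [Subtype.ext (mul_left_cancel h1)]
  · rintro ⟨⟨a, ha⟩, ⟨b, hb⟩⟩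
    let x : {x : G | ∃ h ∈ H, ∃ k ∈ K, x = h * k} := ⟨a * b, a, ha, b, hb, rfl⟩
    have hx : a * b = h x * k x := e x
    have h1 : (h x)⁻¹ * a = k x * b⁻¹ := by
      rw [inv_mul_eq_iff_eq_mul, ← mul_assoc, ← hx]; group
    refine ⟨(x, ⟨(h x)⁻¹ * a, H.mul_mem (H.inv_mem (hh x)) ha, ?_⟩), ?_⟩
    · change (h x)⁻¹ * a ∈ K
      rw [h1]
      exact K.mul_mem (hk x) (K.inv_mem hb)
    · simp only [Prod.mk.injEq, Subtype.mk.injEq]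
      refine ⟨by group, ?_⟩
      rw [h1]; group

theorem eq_mul_of_card_mul_card_eq [Finite G] {H K L : Subgroup G} (hH : H ≤ L) (hK : K ≤ L)
    (h : Nat.card H * Nat.card K = Nat.card L * Nat.card (H ⊓ K : Subgroup G)) {x : G}
    (hx : x ∈ L) : ∃ h ∈ H, ∃ k ∈ K, x = h * k := by
  rw [card_mul_card_eq_card_mul_card_inf] at h
  have h1 := Nat.eq_of_mul_eq_mul_right Nat.card_pos h
  have h2 : {x : G | ∃ h ∈ H, ∃ k ∈ K, x = h * k} = (L : Set G) := by
    apply Set.eq_of_subset_of_ncard_le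
    · rintro _ ⟨a, ha, b, hb, rfl⟩
      exact L.mul_mem (hH ha) (hK hb)
    · exact h1.symm.le
    · exact Set.toFinite _
  have h3 : x ∈ (L : Set G) := hx
  rwa [← h2] at h3

theorem card_mul_card_eq_of_forall {H K L : Subgroup G} (hH : H ≤ L) (hK : K ≤ L)
    (h : ∀ x ∈ L, ∃ h ∈ H, ∃ k ∈ K, x = h * k) :
    Nat.card H * Nat.card K = Nat.card L * Nat.card (H ⊓ K : Subgroup G) := by
  rw [card_mul_card_eq_card_mul_card_inf]
  have h2 : {x : G | ∃ h ∈ H, ∃ k ∈ K, x = h * k} = (L : Set G) := by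
    ext x
    refine ⟨?_, h x⟩
    rintro ⟨a, ha, b, hb, rfl⟩
    exact L.mul_mem (hH ha) (hK hb)
  rw [h2]
  rfl

theorem mem_map_conj_iff {H : Subgroup G} {g x : G} :
    x ∈ H.map (MulAut.conj g).toMonoidHom ↔ g⁻¹ * x * g ∈ H := by
  constructor
  · rintro ⟨y, hy, rfl⟩
    simpa [mul_assoc] using hy
  · intro h
    exact ⟨_, h, by simp [mul_assoc]⟩

theorem card_map_conj (H : Subgroup G) (g : G) :
    Nat.card (H.map (MulAut.conj g).toMonoidHom) = Nat.card H :=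
  Subgroup.card_map_of_injective (MulAut.conj g).injective

end Subgroup

open Subgroup (mem_map_conj_iff)

/-! ### Conjugates of `B` and `U` as stabilizers of chambers. -/

namespace SplitBNPair

variable {p : ℕ} {G : Type*} [Group G] (D : SplitBNPair p G)

theorem T_le_B : D.T ≤ D.B := inf_le_left

theorem conj_mem_U {b u : G} (hb : b ∈ D.B) (hu : u ∈ D.U) : b * u * b⁻¹ ∈ D.U :=
  D.U_normal.conj_mem ⟨u, D.U_le hu⟩ hu ⟨b, hb⟩

theorem conj_mem_U_iff {b u : G} (hb : b ∈ D.B) : b * u * b⁻¹ ∈ D.U ↔ u ∈ D.U :=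
  ⟨fun h => by simpa [mul_assoc] using D.conj_mem_U (D.B.inv_mem hb) h, D.conj_mem_U hb⟩

theorem conj_mem_U_iff' {b u : G} (hb : b ∈ D.B) : b⁻¹ * u * b ∈ D.U ↔ u ∈ D.U := by
  simpa using D.conj_mem_U_iff (D.B.inv_mem hb) (u := u)

theorem exists_mul_of_mem_B {b : G} (hb : b ∈ D.B) : ∃ u ∈ D.U, ∃ t ∈ D.T, b = u * t := by
  have h : D.T ≤ Subgroup.normalizer (D.U : Set G) := by
    intro t ht
    rw [Subgroup.mem_normalizer_iff]
    intro u
    exact (D.conj_mem_U_iff (D.T_le_B ht)).symm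
  rw [← D.sup_T] at hb
  have h2 : b ∈ ((D.U ⊔ D.T : Subgroup G) : Set G) := hb
  rw [Subgroup.coe_mul_of_right_le_normalizer_left _ _ h] at h2
  obtain ⟨u, hu, t, ht, rfl⟩ := h2
  exact ⟨u, hu, t, ht, rfl⟩

theorem eq_one_of_mem_U_of_mem_T {x : G} (hu : x ∈ D.U) (ht : x ∈ D.T) : x = 1 := by
  have : x ∈ D.U ⊓ D.T := ⟨hu, ht⟩
  rwa [D.inf_T] at this

/-- The conjugate `wB`. -/
noncomputable def conjB (w : D.W) : Subgroup G := D.B.map (MulAut.conj (w.out : G)).toMonoidHom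

/-- The conjugate `wU`. -/
noncomputable def conjU (w : D.W) : Subgroup G := D.U.map (MulAut.conj (w.out : G)).toMonoidHom

variable {D}

/-- The chosen representative `out` may be replaced by any other, since both differ by an element of
`B`. -/
theorem mem_conjB_coe {n : D.N} {x : G} : x ∈ D.conjB n ↔ (n : G)⁻¹ * x * n ∈ D.B := by
  have h : ((n : D.W).out : D.W) = n := QuotientGroup.out_eq' _
  rw [BNPair.coe_eq_coe_iff] at h
  rw [conjB, mem_map_conj_iff]
  set m := (n : D.W).out
  have e : (n : G)⁻¹ * x * n = ((m : G)⁻¹ * n)⁻¹ * ((m : G)⁻¹ * x * m) * ((m : G)⁻¹ * n) := by group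
  rw [e, Subgroup.mul_mem_cancel_right _ h, Subgroup.mul_mem_cancel_left _ (D.B.inv_mem h)]

theorem mem_conjU_coe {n : D.N} {x : G} : x ∈ D.conjU n ↔ (n : G)⁻¹ * x * n ∈ D.U := by
  have h : ((n : D.W).out : D.W) = n := QuotientGroup.out_eq' _
  rw [BNPair.coe_eq_coe_iff] at h
  rw [conjU, mem_map_conj_iff]
  set m := (n : D.W).out
  have e : (n : G)⁻¹ * x * n = ((m : G)⁻¹ * n)⁻¹ * ((m : G)⁻¹ * x * m) * ((m : G)⁻¹ * n) := by group
  rw [e, D.conj_mem_U_iff' h]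

theorem map_conj_U (n : D.N) : D.U.map (MulAut.conj (n : G)).toMonoidHom = D.conjU n := by
  ext x; rw [mem_conjU_coe, mem_map_conj_iff]

theorem mem_conjB_mul {n : D.N} {w : D.W} {x : G} :
    x ∈ D.conjB (n * w) ↔ (n : G)⁻¹ * x * n ∈ D.conjB w := by
  obtain ⟨m, rfl⟩ := D.exists_rep w
  rw [← QuotientGroup.mk_mul, mem_conjB_coe, mem_conjB_coe]
  simp [mul_assoc]

theorem mem_conjU_mul {n : D.N} {w : D.W} {x : G} :
    x ∈ D.conjU (n * w) ↔ (n : G)⁻¹ * x * n ∈ D.conjU w := by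
  obtain ⟨m, rfl⟩ := D.exists_rep w
  rw [← QuotientGroup.mk_mul, mem_conjU_coe, mem_conjU_coe]
  simp [mul_assoc]

theorem conjB_one : D.conjB 1 = D.B := by
  ext x; simpa using mem_conjB_coe (D := D) (n := 1) (x := x)

theorem conjU_one : D.conjU 1 = D.U := by
  ext x; simpa using mem_conjU_coe (D := D) (n := 1) (x := x)

theorem conjU_le_conjB (w : D.W) : D.conjU w ≤ D.conjB w := Subgroup.map_mono D.U_le

theorem T_conj_mem {n t : G} (hn : n ∈ D.N) (ht : t ∈ D.T) : n * t * n⁻¹ ∈ D.T := by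
  have := D.normal_T.conj_mem ⟨t, ht.2⟩ ht ⟨n, hn⟩
  exact this

theorem T_conj_mem' {n t : G} (hn : n ∈ D.N) (ht : t ∈ D.T) : n⁻¹ * t * n ∈ D.T := by
  simpa using T_conj_mem (D.N.inv_mem hn) ht

theorem T_le_conjB (w : D.W) : D.T ≤ D.conjB w := by
  intro t ht
  obtain ⟨n, rfl⟩ := D.exists_rep w
  rw [mem_conjB_coe]
  exact D.T_le_B (T_conj_mem' n.2 ht)

theorem conj_mem_conjU_of_mem_T {w : D.W} {t x : G} (ht : t ∈ D.T) (hx : x ∈ D.conjU w) :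
    t * x * t⁻¹ ∈ D.conjU w := by
  obtain ⟨n, rfl⟩ := D.exists_rep w
  rw [mem_conjU_coe] at hx ⊢
  have := D.conj_mem_U (D.T_le_B (T_conj_mem' n.2 ht)) hx
  simpa [mul_assoc] using this

theorem conjU_isPGroup (w : D.W) : IsPGroup p (D.conjU w) := D.U_pGroup.map _

/-- `U` contains all `p`-elements of `B`. -/
theorem mem_U_of_isPGroup [Finite G] {H : Subgroup G} (hH : IsPGroup p H) {x : G} (hx : x ∈ H)
    (hB : x ∈ D.B) : x ∈ D.U := by
  obtain ⟨u, hu, t, ht, rfl⟩ := D.exists_mul_of_mem_B hB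
  obtain ⟨k, hk⟩ := hH ⟨_, hx⟩
  replace hk : (u * t) ^ p ^ k = 1 := by simpa [Subtype.ext_iff] using hk
  -- Modulo `U` the powers of `ut` are those of `t`. So `t` has `p`-power order, and `t = 1` because
  -- `|T|` is prime to `p`.
  have key : ∀ j : ℕ, ∃ v ∈ D.U, (u * t) ^ j = v * t ^ j := by
    intro j
    induction j with
    | zero => exact ⟨1, D.U.one_mem, by simp⟩
    | succ j ih =>
      obtain ⟨v, hv, e⟩ := ih
      refine ⟨v * (t ^ j * u * (t ^ j)⁻¹), D.U.mul_mem hv (D.conj_mem_U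
        (D.B.pow_mem (D.T_le_B ht) j) hu), ?_⟩
      rw [pow_succ, e, pow_succ]
      group
  obtain ⟨v, hv, e⟩ := key (p ^ k)
  rw [hk] at e
  have h1 : t ^ p ^ k = 1 := by
    refine D.eq_one_of_mem_U_of_mem_T ?_ (D.T.pow_mem ht _)
    rw [eq_comm, mul_eq_one_iff_inv_eq] at e
    rw [← e]
    exact D.U.inv_mem hv
  have h2 : t ^ Nat.card D.T = 1 := by
    exact congrArg Subtype.val (pow_card_eq_one' (x := (⟨t, ht⟩ : D.T)))
  have h3 : t = 1 := by
    rw [← orderOf_eq_one_iff]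
    have h4 : orderOf t ∣ Nat.gcd (Nat.card D.T) (p ^ k) :=
      Nat.dvd_gcd (orderOf_dvd_of_pow_eq_one h2) (orderOf_dvd_of_pow_eq_one h1)
    rw [Nat.Coprime.gcd_eq_one (D.T_card.pow_right k)] at h4
    exact Nat.dvd_one.1 h4
  rw [h3, mul_one]
  exact hu

/-- This upgrades membership in `wB` to membership in `wU` for elements of `p`-subgroups. -/
theorem mem_conjU_of_isPGroup [Finite G] {H : Subgroup G} (hH : IsPGroup p H) {x : G} (hx : x ∈ H)
    {w : D.W} (hB : x ∈ D.conjB w) : x ∈ D.conjU w := by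
  obtain ⟨n, rfl⟩ := D.exists_rep w
  rw [mem_conjB_coe] at hB
  rw [mem_conjU_coe]
  refine mem_U_of_isPGroup (hH.map (MulAut.conj (n : G)⁻¹).toMonoidHom) ?_ hB
  rw [mem_map_conj_iff]
  simpa [mul_assoc] using hx

/-! ### Geodesics -/

/-- Let `n`, `m` represent `s`, `v`. If `n⁻¹xn` were in `BsB`, then `n⁻¹xnm` would lie in `BsvB`. It
lies in `mB`, because `x` fixes the chamber `sv`. -/
theorem mem_conjB_of_length_add_one {s v : D.W} (hs : s ∈ D.S)
    (hl : D.length (s * v) = D.length v + 1) {x : G} (h1 : x ∈ D.B) (h2 : x ∈ D.conjB (s * v)) :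
    x ∈ D.conjB s := by
  obtain ⟨n, rfl⟩ := D.exists_rep s
  obtain ⟨m, rfl⟩ := D.exists_rep v
  rw [← QuotientGroup.mk_mul, mem_conjB_coe] at h2
  rw [mem_conjB_coe]
  have hn := BNPair.inv_mem_cell (BNPair.coe_mem_cell n)
  rw [D.inv_eq_of_mem hs] at hn
  rcases BNPair.mul_mem_cell_or hs (BNPair.mem_cell_mul hn h1) (BNPair.coe_mem_cell n) with h | h
  · have h3 := BNPair.mul_mem_cell_of_length_le hs (by omega) h (BNPair.coe_mem_cell m)
    have h4 := BNPair.mem_cell_mul (BNPair.coe_mem_cell m) h2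
    have e : (m : G) * (((n * m : D.N) : G)⁻¹ * x * (n * m : D.N)) = (n : G)⁻¹ * x * n * m := by
      simp [mul_assoc]
    rw [e] at h4
    have := BNPair.cell_inj h3 h4
    exact absurd (mul_eq_right.1 this) (D.ne_one_of_mem hs)
  · rwa [D.mul_self_of_mem hs, BNPair.mem_cell_one] at h

theorem mem_conjB_of_length_add {v x : D.W} (hl : D.length (v * x) = D.length v + D.length x)
    {g : G} (h1 : g ∈ D.B) (h2 : g ∈ D.conjB (v * x)) : g ∈ D.conjB v := by
  induction v using D.reduced_induction generalizing g with
  | one => rwa [conjB_one]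
  | mul s hs v hv ih =>
    have h3 := D.length_mul_left_le hs (v * x)
    have h4 := D.length_mul_le v x
    rw [mul_assoc] at hl h2
    have h5 := mem_conjB_of_length_add_one hs (by omega) h1 h2
    obtain ⟨n, rfl⟩ := D.exists_rep s
    rw [mem_conjB_coe] at h5
    rw [mem_conjB_mul] at h2 ⊢
    exact ih (by omega) h5 h2

/-- An element that fixes two chambers fixes every geodesic between them. -/
theorem conjB_inf_le {a b c : D.W}
    (hl : D.length (a⁻¹ * c) = D.length (a⁻¹ * b) + D.length (b⁻¹ * c)) :
    D.conjB a ⊓ D.conjB c ≤ D.conjB b := by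
  intro g hg
  have h1 : g ∈ D.conjB a := hg.1
  have h2 : g ∈ D.conjB c := hg.2
  obtain ⟨n, rfl⟩ := D.exists_rep a
  have h3 : b = n * ((n : D.W)⁻¹ * b) := by group
  have h4 : c = n * (((n : D.W)⁻¹ * b) * (b⁻¹ * c)) := by group
  rw [h4, mem_conjB_mul] at h2
  rw [h3, mem_conjB_mul]
  rw [mem_conjB_coe] at h1
  refine mem_conjB_of_length_add ?_ h1 h2
  rw [← hl]
  group

theorem conjU_inf_le [Finite G] {a b c : D.W}
    (hl : D.length (a⁻¹ * c) = D.length (a⁻¹ * b) + D.length (b⁻¹ * c)) :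
    D.conjU a ⊓ D.conjU c ≤ D.conjU b := fun _ hg =>
  mem_conjU_of_isPGroup (conjU_isPGroup a) hg.1
    (conjB_inf_le hl ⟨conjU_le_conjB _ hg.1, conjU_le_conjB _ hg.2⟩)

/-- Opposite chambers are stabilized by `T` only. -/
theorem mem_T_of_isLongestIn {z : D.W} (hz : BNPair.IsLongestIn D.S z) {w : D.W} {g : G}
    (h1 : g ∈ D.conjB w) (h2 : g ∈ D.conjB (w * z)) : g ∈ D.T := by
  -- Every chamber lies on a geodesic between the opposite chambers `w` and `wz`, so `g` fixes all
  -- chambers.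
  rw [← D.saturated, Subgroup.mem_iInf]
  intro n
  rw [mem_map_conj_iff, ← mem_conjB_coe]
  refine conjB_inf_le (a := w) (c := w * z) ?_ ⟨h1, h2⟩
  rw [inv_mul_cancel_left, hz.length_eq (w⁻¹ * n) (BNPair.mem_closure_S _)]
  simp [mul_assoc]

theorem conjU_inf_eq_bot {z : D.W} (hz : BNPair.IsLongestIn D.S z) (w : D.W) :
    D.conjU w ⊓ D.conjB (w * z) = ⊥ := by
  rw [eq_bot_iff]
  intro g hg
  have h1 : g ∈ D.conjU w := hg.1
  have h2 : g ∈ D.conjB (w * z) := hg.2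
  have h3 := mem_T_of_isLongestIn hz (conjU_le_conjB w h1) h2
  obtain ⟨n, rfl⟩ := D.exists_rep w
  rw [mem_conjU_coe] at h1
  have := D.eq_one_of_mem_U_of_mem_T h1 (T_conj_mem' n.2 h3)
  rw [Subgroup.mem_bot]
  simpa [mul_assoc, inv_mul_eq_one] using this

end SplitBNPair

/-! ### Factorizations of `U` and orders of the groups `U ∩ wU`. -/

namespace SplitBNPair

variable {p : ℕ} {G : Type*} [Group G] {D : SplitBNPair p G}

theorem exists_mul_of_mem_B_of_mem_conjB [Finite G] {w : D.W} {b : G} (h1 : b ∈ D.B)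
    (h2 : b ∈ D.conjB w) : ∃ u ∈ D.U ⊓ D.conjU w, ∃ t ∈ D.T, b = u * t := by
  obtain ⟨u, hu, t, ht, rfl⟩ := D.exists_mul_of_mem_B h1
  refine ⟨u, ⟨hu, mem_conjU_of_isPGroup D.U_pGroup hu ?_⟩, t, ht, rfl⟩
  rwa [Subgroup.mul_mem_cancel_right _ (T_le_conjB w ht)] at h2

/-- For representatives `n`, `m` of `s`, `v`, multiplication of cells puts `n⁻¹um` into `Bn⁻¹mB`, so
`u` is a product of elements of `sB` and `vB`. Disjointness of cells forces both factors into `B`,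
and their `T`-parts cancel. -/
theorem exists_mul_of_length_add_one [Finite G] {s v : D.W} (hs : s ∈ D.S)
    (hl : D.length (s * v) = D.length v + 1) {u : G} (hu : u ∈ D.U) :
    ∃ x ∈ D.U ⊓ D.conjU s, ∃ y ∈ D.U ⊓ D.conjU v, u = x * y := by
  obtain ⟨n, rfl⟩ := D.exists_rep s
  obtain ⟨m, rfl⟩ := D.exists_rep v
  have hn := BNPair.inv_mem_cell (BNPair.coe_mem_cell n)
  have h1 := BNPair.mul_mem_cell_of_length_le (w := (m : D.W)) hs (by omega)
    (BNPair.mem_cell_mul (D.inv_eq_of_mem hs ▸ hn) (D.U_le hu)) (BNPair.coe_mem_cell m)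
  have e1 : ((n : D.W) * m) = ((n⁻¹ * m : D.N) : D.W) := by
    rw [QuotientGroup.mk_mul, QuotientGroup.mk_inv, D.inv_eq_of_mem hs]
  rw [e1, BNPair.mem_cell_coe] at h1
  obtain ⟨b, hb, c, hc, h2⟩ := h1
  have h3 : u = (n * b * (n : G)⁻¹) * (m * c * (m : G)⁻¹) := by
    calc u = n * ((n : G)⁻¹ * u * m) * (m : G)⁻¹ := by group
      _ = _ := by rw [h2]; simp [mul_assoc]
  set x := n * b * (n : G)⁻¹ with hx
  have hxs : x ∈ D.conjB n := by rw [mem_conjB_coe, hx]; simpa [mul_assoc] using hb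
  set y := m * c * (m : G)⁻¹ with hy
  have hyv : y ∈ D.conjB m := by rw [mem_conjB_coe, hy]; simpa [mul_assoc] using hc
  have hxB : x ∈ D.B := by
    rcases BNPair.mul_mem_cell_or hs (BNPair.mem_cell_mul (BNPair.coe_mem_cell n) hb)
      (D.inv_eq_of_mem hs ▸ hn) with h | h
    · exfalso
      have h4 : y ∈ D.cell n := by
        have h5 := BNPair.mem_cell_mul (BNPair.inv_mem_cell h) (D.U_le hu)
        rw [D.inv_eq_of_mem hs] at h5
        have : x⁻¹ * u = y := by rw [h3]; group
        rwa [← hx, this] at h5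
      have h5 := BNPair.mul_mem_cell_of_length_le (w := (m : D.W)) hs (by omega) h4
        (BNPair.coe_mem_cell m)
      have h6 := BNPair.mem_cell_mul (BNPair.coe_mem_cell m) hc
      have e : y * m = m * c := by rw [hy]; group
      rw [e] at h5
      exact D.ne_one_of_mem hs (mul_eq_right.1 (BNPair.cell_inj h5 h6))
    · rwa [D.mul_self_of_mem hs, BNPair.mem_cell_one] at h
  have hyB : y ∈ D.B := by
    have : y = x⁻¹ * u := by rw [h3]; group
    rw [this]
    exact D.B.mul_mem (D.B.inv_mem hxB) (D.U_le hu)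
  obtain ⟨x', hx', t, ht, ex⟩ := exists_mul_of_mem_B_of_mem_conjB hxB hxs
  obtain ⟨y', hy', t', ht', ey⟩ := exists_mul_of_mem_B_of_mem_conjB hyB hyv
  have hy2 : t * y' * t⁻¹ ∈ D.U ⊓ D.conjU m :=
    ⟨D.conj_mem_U (D.T_le_B ht) hy'.1, conj_mem_conjU_of_mem_T ht hy'.2⟩
  refine ⟨x', hx', _, hy2, ?_⟩
  have h7 : u = x' * (t * y' * t⁻¹) * (t * t') := by rw [h3, ex, ey]; group
  have h8 : t * t' = 1 := by
    refine D.eq_one_of_mem_U_of_mem_T ?_ (D.T.mul_mem ht ht')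
    have : t * t' = (x' * (t * y' * t⁻¹))⁻¹ * u := by rw [h7]; group
    rw [this]
    exact D.U.mul_mem (D.U.inv_mem (D.U.mul_mem hx'.1 hy2.1)) hu
  rw [h7, h8, mul_one]

theorem map_conj_conjU (n : D.N) (w : D.W) :
    (D.conjU w).map (MulAut.conj (n : G)).toMonoidHom = D.conjU (n * w) := by
  ext x; rw [mem_conjU_mul, mem_map_conj_iff]

theorem map_conj_inf (H K : Subgroup G) (g : G) :
    (H ⊓ K).map (MulAut.conj g).toMonoidHom =
      H.map (MulAut.conj g).toMonoidHom ⊓ K.map (MulAut.conj g).toMonoidHom := by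
  ext x; simp only [Subgroup.mem_inf, mem_map_conj_iff]

theorem card_conjU_inf (w a b : D.W) : Nat.card (D.conjU (w * a) ⊓ D.conjU (w * b) : Subgroup G) =
    Nat.card (D.conjU a ⊓ D.conjU b : Subgroup G) := by
  obtain ⟨n, rfl⟩ := D.exists_rep w
  rw [← map_conj_conjU, ← map_conj_conjU, ← map_conj_inf, Subgroup.card_map_conj]

theorem card_U_inf_inv (w : D.W) : Nat.card (D.U ⊓ D.conjU w⁻¹ : Subgroup G) =
    Nat.card (D.U ⊓ D.conjU w : Subgroup G) := by
  have := card_conjU_inf w w⁻¹ 1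
  rw [mul_inv_cancel, mul_one, conjU_one, inf_comm (D.conjU w⁻¹)] at this
  exact this.symm

/-- In other words, the index `|U : U ∩ wU|` is multiplicative when lengths add. For `v = s` this is
the factorization of `U` above: conjugation by `s` turns `U ∩ sU ∩ vU` into `U ∩ sU ∩ svU`, which is
`U ∩ svU` as `s` lies on a geodesic from `1` to `sv`. -/
theorem card_mul_of_length_add [Finite G] {v w : D.W}
    (hl : D.length (v * w) = D.length v + D.length w) :
    Nat.card D.U * Nat.card (D.U ⊓ D.conjU (v * w) : Subgroup G) =
      Nat.card (D.U ⊓ D.conjU v : Subgroup G) * Nat.card (D.U ⊓ D.conjU w : Subgroup G) := by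
  have key : ∀ {s v : D.W}, s ∈ D.S → D.length (s * v) = D.length v + 1 →
    Nat.card D.U * Nat.card (D.U ⊓ D.conjU (s * v) : Subgroup G) =
      Nat.card (D.U ⊓ D.conjU s : Subgroup G) * Nat.card (D.U ⊓ D.conjU v : Subgroup G) := by
    intro s v hs hl
    rw [Subgroup.card_mul_card_eq_of_forall (inf_le_left : D.U ⊓ D.conjU s ≤ D.U)
      (inf_le_left : D.U ⊓ D.conjU v ≤ D.U) fun u hu => exists_mul_of_length_add_one hs hl hu]
    congr 1
    obtain ⟨n, rfl⟩ := D.exists_rep s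
    rw [← Subgroup.card_map_conj (D.U ⊓ D.conjU n ⊓ (D.U ⊓ D.conjU v)) (n : G)]
    simp only [map_conj_inf, map_conj_conjU, map_conj_U]
    rw [D.mul_self_of_mem hs, conjU_one]
    congr 2
    refine le_antisymm (le_inf ?_ ?_)
      (le_inf (inf_le_left.trans inf_le_right) (inf_le_right.trans inf_le_right))
    · have h2 : D.conjU 1 ⊓ D.conjU (n * v) ≤ D.conjU n := conjU_inf_le (by
        simp [D.length_of_mem hs, hl, add_comm])
      rw [conjU_one] at h2
      exact le_inf h2 inf_le_left
    · have h2 : D.conjU 1 ⊓ D.conjU (n * v) ≤ D.conjU n := conjU_inf_le (by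
        simp [D.length_of_mem hs, hl, add_comm])
      rw [conjU_one] at h2
      exact le_inf h2 inf_le_right
  induction v using D.reduced_induction with
  | one => rw [one_mul, conjU_one, inf_idem]
  | mul s hs v hv ih =>
    have h3 := D.length_mul_left_le hs (v * w)
    have h4 := D.length_mul_le v w
    rw [mul_assoc] at hl ⊢
    have h5 := ih (by omega)
    have h6 := key hs (v := v * w) (by omega)
    have h7 := key hs hv
    have hpos : 0 < Nat.card D.U := Nat.card_pos
    apply Nat.eq_of_mul_eq_mul_left hpos
    rw [h6, mul_left_comm, h5, ← mul_assoc, ← mul_assoc, h7]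

section Longest

variable [Finite G] {z : D.W} (hz : BNPair.IsLongestIn D.S z)
include hz

/-- Multiplicativity for `w · w⁻¹z = z` yields the formula with `w⁻¹z` in place of `wz`. As `U ∩ wU`
and `U ∩ wzU` meet trivially, their product set in `U` bounds `|U ∩ wzU|` by `|U ∩ zwU|`. The same
bound for `zwz` is the reverse inequality. -/
theorem card_mul_card_longest (w : D.W) : Nat.card (D.U ⊓ D.conjU w : Subgroup G) *
    Nat.card (D.U ⊓ D.conjU (w * z) : Subgroup G) = Nat.card D.U := by
  have h1 : Nat.card (D.U ⊓ D.conjU z : Subgroup G) = 1 := by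
    have := conjU_inf_eq_bot hz (1 : D.W)
    rw [one_mul, conjU_one] at this
    rw [Subgroup.card_eq_one, eq_bot_iff, ← this]
    exact inf_le_inf_left _ (conjU_le_conjB z)
  have h2 : ∀ w : D.W, Nat.card (D.U ⊓ D.conjU w : Subgroup G) *
      Nat.card (D.U ⊓ D.conjU (w⁻¹ * z) : Subgroup G) = Nat.card D.U := by
    intro w
    rw [← card_mul_of_length_add, mul_inv_cancel_left, h1, mul_one]
    rw [mul_inv_cancel_left]
    exact hz.length_eq w (BNPair.mem_closure_S w)
  have h3 : ∀ w : D.W, Nat.card (D.U ⊓ D.conjU (w * z) : Subgroup G) ≤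
      Nat.card (D.U ⊓ D.conjU (z * w) : Subgroup G) := by
    intro w
    have h4 := Subgroup.card_mul_card_eq_card_mul_card_inf (D.U ⊓ D.conjU w) (D.U ⊓ D.conjU (w * z))
    have h5 : (D.U ⊓ D.conjU w) ⊓ (D.U ⊓ D.conjU (w * z)) = ⊥ := by
      rw [eq_bot_iff, ← conjU_inf_eq_bot hz w]
      exact inf_le_inf inf_le_right (inf_le_right.trans (conjU_le_conjB _))
    rw [h5, Subgroup.card_bot, mul_one] at h4
    have h6 : Nat.card {x : G | ∃ h ∈ D.U ⊓ D.conjU w, ∃ k ∈ D.U ⊓ D.conjU (w * z), x = h * k} ≤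
        Nat.card D.U := by
      refine Nat.card_mono (Set.toFinite (D.U : Set G)) ?_
      rintro _ ⟨a, ha, b, hb, rfl⟩
      exact D.U.mul_mem ha.1 hb.1
    rw [← h4, ← h2 w] at h6
    have h7 := Nat.le_of_mul_le_mul_left h6 Nat.card_pos
    rwa [← card_U_inf_inv (w⁻¹ * z), mul_inv_rev, inv_inv, hz.inv] at h7
  have h4 : Nat.card (D.U ⊓ D.conjU (w * z) : Subgroup G) =
      Nat.card (D.U ⊓ D.conjU (z * w) : Subgroup G) := by
    refine (h3 w).antisymm ?_
    have := h3 (z * w * z)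
    rwa [mul_assoc, hz.mul_self, mul_one, mul_assoc, ← mul_assoc z z, hz.mul_self, one_mul] at this
  rw [h4, ← card_U_inf_inv (z * w), mul_inv_rev, hz.inv, h2]

/-- The decomposition `U = (U ∩ wU) (U ∩ w w₀ U)` and its conjugates. -/
theorem exists_mul_of_mem_conjU (a w : D.W) {u : G} (hu : u ∈ D.conjU a) :
    ∃ x ∈ D.conjU a ⊓ D.conjU (a * w), ∃ y ∈ D.conjU a ⊓ D.conjU (a * w * z), u = x * y := by
  refine Subgroup.eq_mul_of_card_mul_card_eq inf_le_left inf_le_left ?_ hu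
  have h5 : (D.conjU a ⊓ D.conjU (a * w)) ⊓ (D.conjU a ⊓ D.conjU (a * w * z)) = ⊥ := by
    rw [eq_bot_iff, ← conjU_inf_eq_bot hz (a * w)]
    exact inf_le_inf inf_le_right (inf_le_right.trans (conjU_le_conjB _))
  have h1 := card_conjU_inf a 1 w
  have h2 := card_conjU_inf a 1 (w * z)
  have h3 := card_conjU_inf a 1 1
  rw [mul_one, conjU_one] at h1 h2 h3
  rw [inf_idem, inf_idem] at h3
  rw [h5, Subgroup.card_bot, mul_one, mul_assoc, h1, h2, h3, card_mul_card_longest hz]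

end Longest

/-! ### Root subgroups -/

/-- The root subgroup of a half-space: the intersection of the `vU` with `v` in the half-space. -/
noncomputable def halfSpaceGroup (α : Set D.W) : Subgroup G := ⨅ v ∈ α, D.conjU v

theorem mem_halfSpaceGroup {α : Set D.W} {x : G} :
    x ∈ halfSpaceGroup α ↔ ∀ v ∈ α, x ∈ D.conjU v := by
  simp [halfSpaceGroup, Subgroup.mem_iInf]

theorem halfSpaceGroup_le {α : Set D.W} {v : D.W} (hv : v ∈ α) :
    halfSpaceGroup α ≤ D.conjU v := fun _ hx => mem_halfSpaceGroup.1 hx v hv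

section Longest

variable [Finite G] {z : D.W} (hz : BNPair.IsLongestIn D.S z)
include hz

omit [Finite G] in
theorem mul_longest_mem_root_iff {w s v : D.W} (hs : s ∈ D.S) :
    v * z ∈ D.root w s ↔ v ∉ D.root w s :=
  hz.mul_mem_root_iff subset_rfl (BNPair.mem_closure_S w) hs (BNPair.mem_closure_S v)

/-- Every chamber of the half-space lies on a geodesic from `w` to `wsz`. -/
theorem halfSpaceGroup_root {w s : D.W} (hs : s ∈ D.S) :
    halfSpaceGroup (D.root w s) = D.conjU w ⊓ D.conjU (w * s * z) := by
  refine le_antisymm (le_inf (halfSpaceGroup_le (BNPair.mem_root_self hs))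
    (halfSpaceGroup_le ((mul_longest_mem_root_iff hz hs).2 (BNPair.mul_notMem_root hs)))) ?_
  intro x hx
  rw [mem_halfSpaceGroup]
  intro v hv
  refine conjU_inf_le ?_ hx
  have h1 := hz.length_mul (BNPair.mem_closure_S (v⁻¹ * (w * s)))
  have h2 := hz.length_le (BNPair.mem_closure_S (v⁻¹ * (w * s)))
  have h3 := hz.length_mul (BNPair.mem_closure_S s)
  have h4 := BNPair.length_mul_left_of_lt hs hv
  have h5 : D.length (v⁻¹ * (w * s)) = D.length (s * (w⁻¹ * v)) := by
    rw [← D.length_inv]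
    simp [D.inv_eq_of_mem hs, mul_assoc]
  have h6 := D.length_of_mem hs
  have e1 : w⁻¹ * (w * s * z) = s * z := by group
  have e2 : v⁻¹ * (w * s * z) = v⁻¹ * (w * s) * z := by group
  rw [e1, e2]
  omega

omit [Finite G] in
theorem simpleRootSubgroup_eq {s : D.W} :
    D.simpleRootSubgroup D.U s = D.U ⊓ D.conjU (s * z) := by
  obtain ⟨m, rfl⟩ := D.exists_rep s
  obtain ⟨n, hn⟩ := D.exists_rep z
  rw [BNPair.simpleRootSubgroup]
  congr 1
  refine le_antisymm ?_ ?_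
  · refine (iInf₂_le m n).trans ((iInf₂_le rfl ((BNPair.isLongest_iff hz).2 hn)).trans ?_)
    rw [map_conj_U, QuotientGroup.mk_mul, hn]
  · refine le_iInf₂ fun m' n' => le_iInf₂ fun h1 h2 => ?_
    rw [map_conj_U, QuotientGroup.mk_mul, h1, (BNPair.isLongest_iff hz).1 h2]

/-- In particular the root subgroup depends only on the half-space and not on the pair that names
it. -/
theorem rootSubgroup_eq {n : D.N} {s : D.W} (hs : s ∈ D.S) :
    D.rootSubgroup D.U n s = halfSpaceGroup (D.root n s) := by
  rw [BNPair.rootSubgroup, simpleRootSubgroup_eq hz, halfSpaceGroup_root hz hs, map_conj_inf,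
    map_conj_U, map_conj_conjU, mul_assoc]

/-- `aU ∩ awU⁻` is generated by the root subgroups of the roots that separate `a` from `aw`. -/
theorem conjU_inf_le_iSup (w a : D.W) : D.conjU a ⊓ D.conjU (a * w * z) ≤
    ⨆ (α : Set D.W) (_ : D.IsRoot α) (_ : a ∈ α) (_ : a * w ∉ α), halfSpaceGroup α := by
  induction w using D.reduced_induction generalizing a with
  | one =>
    have := conjU_inf_eq_bot hz a
    rw [mul_one]
    exact ((inf_le_inf_left _ (conjU_le_conjB _)).trans this.le).trans bot_le
  | mul s hs w hl ih =>
    intro x hx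
    -- The factor `r` is in the root group of the wall between `a` and `as`. The factor `y` is in
    -- `asU ∩ aswzU`, so the induction applies to it at the chamber `as`.
    obtain ⟨y, hy, r, hr, rfl⟩ := exists_mul_of_mem_conjU hz a s hx.1
    rw [← halfSpaceGroup_root hz hs] at hr
    have h1 : a * (s * w) ∉ D.root a s := by
      rw [BNPair.mem_root_iff, inv_mul_cancel_left, D.mul_mul_cancel_of_mem hs]
      omega
    refine Subgroup.mul_mem _ ?_ ?_
    · have h2 : r ∈ D.conjU (a * (s * w) * z) :=
        halfSpaceGroup_le ((mul_longest_mem_root_iff hz hs).2 h1) hr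
      have h3 : y ∈ D.conjU (a * (s * w) * z) := (Subgroup.mul_mem_cancel_right _ h2).1 hx.2
      rw [← mul_assoc a] at h3
      refine (ih (a * s)).trans ?_ ⟨hy.2, h3⟩
      refine iSup_mono fun α => iSup_mono fun hα => iSup_le fun ha => iSup_le fun hw => ?_
      obtain ⟨b, t, ht, rfl⟩ := hα
      rw [mul_assoc] at hw
      refine le_iSup_of_le ?_ (le_iSup_of_le hw le_rfl)
      -- A root that contains `as` but not `a` is opposite to `D.root a s`, and then it also
      -- contains `asw`.
      by_contra ha'
      have h4 := BNPair.root_eq_of_crossing ht hs ha (by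
        rwa [D.mul_mul_cancel_right_of_mem hs])
      rw [h4, BNPair.mem_root_mul_iff hs] at hw
      exact hw h1
    · exact Subgroup.mem_iSup_of_mem _ (Subgroup.mem_iSup_of_mem ⟨a, s, hs, rfl⟩
        (Subgroup.mem_iSup_of_mem (BNPair.mem_root_self hs) (Subgroup.mem_iSup_of_mem h1 hr)))

end Longest

end SplitBNPair

/-! ### Standard parabolic subgroups and the normality of `U_J`. -/

namespace SplitBNPair

variable {p : ℕ} {G : Type*} [Group G] {D : SplitBNPair p G}

theorem coe_mem_NJ_iff {J : Set D.W} {n : D.N} :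
    (n : G) ∈ D.NJ J ↔ (n : D.W) ∈ Subgroup.closure J := by
  rw [BNPair.NJ, Subgroup.mem_map]
  constructor
  · rintro ⟨m, hm, h⟩
    rwa [← Subtype.ext h]
  · intro h
    exact ⟨n, h, rfl⟩

theorem mem_NJ_iff {J : Set D.W} {g : G} :
    g ∈ D.NJ J ↔ ∃ n : D.N, (n : D.W) ∈ Subgroup.closure J ∧ (n : G) = g := by
  rw [BNPair.NJ, Subgroup.mem_map]
  rfl

theorem mem_stdUnipotentRadical {J : Set D.W} {x : G} :
    x ∈ D.stdUnipotentRadical J ↔ ∀ v ∈ Subgroup.closure J, x ∈ D.conjU v := by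
  simp only [stdUnipotentRadical, Subgroup.mem_iInf, coe_mem_NJ_iff, map_conj_U]
  constructor
  · intro h v hv
    obtain ⟨n, rfl⟩ := D.exists_rep v
    exact h n hv
  · exact fun h n hn => h _ hn

theorem stdUnipotentRadical_le {J : Set D.W} {v : D.W} (hv : v ∈ Subgroup.closure J) :
    D.stdUnipotentRadical J ≤ D.conjU v := fun _ hx => mem_stdUnipotentRadical.1 hx v hv

theorem stdUnipotentRadical_le_U (J : Set D.W) : D.stdUnipotentRadical J ≤ D.U := by
  simpa [conjU_one] using stdUnipotentRadical_le (D := D) (one_mem (Subgroup.closure J))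

theorem conj_mem_stdUnipotentRadical_of_mem_NJ {J : Set D.W} {n : D.N}
    (hn : (n : D.W) ∈ Subgroup.closure J) {x : G} (hx : x ∈ D.stdUnipotentRadical J) :
    n * x * (n : G)⁻¹ ∈ D.stdUnipotentRadical J := by
  rw [mem_stdUnipotentRadical] at hx ⊢
  intro v hv
  have h := hx _ (mul_mem (inv_mem hn) hv)
  rw [← QuotientGroup.mk_inv, mem_conjU_mul] at h
  simpa [mul_assoc] using h

theorem B_le_stdParabolic (J : Set D.W) : D.B ≤ D.stdParabolic J := le_sup_left

theorem NJ_le_stdParabolic (J : Set D.W) : D.NJ J ≤ D.stdParabolic J := le_sup_right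

theorem conjU_le_stdParabolic {J : Set D.W} {v : D.W} (hv : v ∈ Subgroup.closure J) :
    D.conjU v ≤ D.stdParabolic J := by
  intro x hx
  obtain ⟨n, rfl⟩ := D.exists_rep v
  rw [mem_conjU_coe] at hx
  have h1 := NJ_le_stdParabolic J (coe_mem_NJ_iff.2 hv)
  have h2 := B_le_stdParabolic J (D.U_le hx)
  rwa [Subgroup.mul_mem_cancel_right _ h1, Subgroup.mul_mem_cancel_left _ (inv_mem h1)] at h2

theorem exists_mem_cell_of_mem_stdParabolic {J : Set D.W} (hJ : J ⊆ D.S) {g : G}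
    (hg : g ∈ D.stdParabolic J) : ∃ w ∈ Subgroup.closure J, g ∈ D.cell w := by
  have key : ∀ w ∈ Subgroup.closure J, ∀ x ∈ D.cell w, ∀ v ∈ Subgroup.closure J, ∀ y ∈ D.cell v,
      ∃ u ∈ Subgroup.closure J, x * y ∈ D.cell u := by
    intro w hw
    refine BNPair.closure_induction_mul_right (p := fun w => ∀ x ∈ D.cell w,
      ∀ v ∈ Subgroup.closure J, ∀ y ∈ D.cell v, ∃ u ∈ Subgroup.closure J, x * y ∈ D.cell u) hJ
      (fun x hx v hv y hy => ⟨v, hv, BNPair.mul_mem_cell (BNPair.mem_cell_one.1 hx) hy⟩)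
      (fun w _ s hs ih x hx v hv y hy => ?_) hw
    obtain ⟨a, ha, b, hb, rfl⟩ := BNPair.exists_mem_cell_mul hx
    rw [mul_assoc]
    rcases BNPair.mul_mem_cell_or (hJ hs) hb hy with h | h
    · exact ih a ha v hv _ h
    · exact ih a ha _ (mul_mem (Subgroup.subset_closure hs) hv) _ h
  rw [BNPair.stdParabolic, Subgroup.sup_eq_closure] at hg
  induction hg using Subgroup.closure_induction with
  | mem x hx =>
    rcases hx with hx | hx
    · exact ⟨1, one_mem _, BNPair.mem_cell_one.2 hx⟩
    · obtain ⟨n, hn, rfl⟩ := mem_NJ_iff.1 hx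
      exact ⟨_, hn, BNPair.coe_mem_cell n⟩
  | one => exact ⟨1, one_mem _, BNPair.mem_cell_one.2 D.B.one_mem⟩
  | mul x y _ _ hx hy =>
    obtain ⟨w, hw, hx⟩ := hx
    obtain ⟨v, hv, hy⟩ := hy
    exact key w hw x hx v hv y hy
  | inv x _ hx =>
    obtain ⟨w, hw, hx⟩ := hx
    exact ⟨_, inv_mem hw, BNPair.inv_mem_cell hx⟩

/-- The projection of the chamber `vm` to the residue of `P_J` is `v`. -/
theorem conjB_inf_stdParabolic_le {J : Set D.W} (hJ : J ⊆ D.S) {v m : D.W}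
    (hm : ∀ y ∈ Subgroup.closure J, D.length (y * m) = D.length y + D.length m)
    (hv : v ∈ Subgroup.closure J) : D.conjB (v * m) ⊓ D.stdParabolic J ≤ D.conjB v := by
  intro x hx
  have h1 : x ∈ D.conjB (v * m) := hx.1
  have h2 : x ∈ D.stdParabolic J := hx.2
  obtain ⟨n, rfl⟩ := D.exists_rep v
  obtain ⟨k, rfl⟩ := D.exists_rep m
  have hn := NJ_le_stdParabolic J (coe_mem_NJ_iff.2 hv)
  rw [mem_conjB_mul, mem_conjB_coe] at h1
  rw [mem_conjB_coe]
  set y := (n : G)⁻¹ * x * n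
  have hy : y ∈ D.stdParabolic J := mul_mem (mul_mem (inv_mem hn) h2) hn
  obtain ⟨u, hu, hyu⟩ := exists_mem_cell_of_mem_stdParabolic hJ hy
  -- With `y ∈ BuB`, `u ∈ W_J`, the element `yk` lies in `BumB`. As `y` fixes the chamber `m`, it
  -- also lies in `BmB`, so `u = 1`.
  have h3 := BNPair.mul_mem_cell_of_length_add (hm u hu) hyu (BNPair.coe_mem_cell k)
  have h4 := BNPair.mem_cell_mul (BNPair.coe_mem_cell k) h1
  have e : (k : G) * ((k : G)⁻¹ * y * k) = y * k := by group
  rw [e] at h4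
  rw [mul_eq_right.1 (BNPair.cell_inj h3 h4)] at hyu
  exact BNPair.mem_cell_one.1 hyu

section Longest

variable [Finite G] {z : D.W} (hz : BNPair.IsLongestIn D.S z) {J : Set D.W} (hJ : J ⊆ D.S)
  {zJ : D.W} (hzJ : BNPair.IsLongestIn J zJ)

include hzJ in
-- Every chamber in `W_J` lies on a geodesic from `1` to `zJ`.
theorem stdUnipotentRadical_eq : D.stdUnipotentRadical J = D.U ⊓ D.conjU zJ := by
  refine le_antisymm (le_inf (stdUnipotentRadical_le_U J) (stdUnipotentRadical_le hzJ.mem)) ?_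
  intro x hx
  rw [mem_stdUnipotentRadical]
  intro v hv
  rw [← conjU_one] at hx
  refine conjU_inf_le ?_ hx
  simpa using hzJ.length_eq v hv

include hz hzJ

omit [Finite G] in
-- This identifies `zJ * z` as the minimal element of the coset `W_J z`.
theorem length_mul_mul_longest {y : D.W} (hy : y ∈ Subgroup.closure J) :
    D.length (y * (zJ * z)) = D.length y + D.length (zJ * z) := by
  have h1 := hz.length_mul (BNPair.mem_closure_S (y * zJ))
  have h2 := hz.length_mul (BNPair.mem_closure_S zJ)
  have h3 := hz.length_le (BNPair.mem_closure_S zJ)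
  have h4 := hzJ.length_mul hy
  have h5 := hzJ.length_le hy
  rw [← mul_assoc]
  omega

include hJ

/-- The roots that separate `1` from `zJ` are positive roots of `Φ_J`, so `U ∩ zJ z U` is the
unipotent part of the Levi subgroup. -/
theorem unipotent_le_iSup : D.U ⊓ D.conjU (zJ * z) ≤
    ⨆ (v : D.W) (r : D.W) (_ : v ∈ Subgroup.closure J) (_ : r ∈ J) (_ : 1 ∈ D.root v r),
      halfSpaceGroup (D.root v r) := by
  have h := conjU_inf_le_iSup hz zJ 1
  rw [conjU_one, one_mul] at h
  refine h.trans (iSup_le fun α => iSup_le fun hα => iSup_le fun h1 => iSup_le fun h2 => ?_)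
  obtain ⟨w, s, hs, rfl⟩ := hα
  obtain ⟨u, hu, r, hr, e⟩ := BNPair.exists_root_eq_of_separates hJ hs (one_mem _) hzJ.mem h1 h2
  rw [e] at h1 ⊢
  exact le_iSup_of_le u (le_iSup_of_le r (le_iSup_of_le hu (le_iSup_of_le hr
    (le_iSup_of_le h1 le_rfl))))

omit hJ in
theorem unipotentRadical_le_iSup : D.stdUnipotentRadical J ≤
    ⨆ (w : D.W) (s : D.W) (_ : s ∈ D.S) (_ : 1 ∈ D.root w s) (_ : zJ ∈ D.root w s),
      halfSpaceGroup (D.root w s) := by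
  have h := conjU_inf_le_iSup hz (zJ * z) 1
  rw [conjU_one, one_mul, mul_assoc zJ, hz.mul_self, mul_one, ← stdUnipotentRadical_eq hzJ] at h
  refine h.trans (iSup_le fun α => iSup_le fun hα => iSup_le fun h1 => iSup_le fun h2 => ?_)
  obtain ⟨w, s, hs, rfl⟩ := hα
  rw [mul_longest_mem_root_iff hz hs, not_not] at h2
  exact le_iSup_of_le w (le_iSup_of_le s (le_iSup_of_le hs (le_iSup_of_le h1
    (le_iSup_of_le h2 le_rfl))))

/-- The commutator relations imply that positive root subgroups in `Φ_J` normalize `U_J`. -/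
theorem commutator_le {w s v r : D.W} (hs : s ∈ D.S) (h1 : 1 ∈ D.root w s) (h2 : zJ ∈ D.root w s)
    (hv : v ∈ Subgroup.closure J) (hr : r ∈ J) (h3 : 1 ∈ D.root v r) :
    ⁅halfSpaceGroup (D.root w s), halfSpaceGroup (D.root v r)⁆ ≤ D.stdUnipotentRadical J := by
  obtain ⟨n, rfl⟩ := D.exists_rep w
  obtain ⟨m, rfl⟩ := D.exists_rep v
  rw [← rootSubgroup_eq hz hs, ← rootSubgroup_eq hz (hJ hr)]
  have h4 : zJ ∉ D.root m r := fun h =>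
    (hzJ.mul_mem_root_iff hJ hv hr (one_mem _)).1 (by rwa [one_mul]) h3
  refine (D.commutator_rel n m s r hs (hJ hr) ?_ ?_).trans ?_
  · intro e
    rw [e] at h4
    exact h4 h2
  · intro e
    rw [e] at h3
    exact h3 h1
  · refine iSup_le fun k => iSup_le fun t => iSup_le fun ht => iSup_le fun hγ => ?_
    obtain ⟨h5, h6⟩ := hzJ.mem_of_strictlyBetween hJ hs h1 h2 hv hr h3 hγ
    rw [rootSubgroup_eq hz ht, stdUnipotentRadical_eq hzJ, ← conjU_one]
    exact le_inf (halfSpaceGroup_le h5) (halfSpaceGroup_le h6)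

/-- Both groups lie in the span of root groups, so it suffices to conjugate one root group by
another, where the commutator relations apply. -/
theorem conj_mem_stdUnipotentRadical_of_mem_unipotent {y x : G}
    (hy : y ∈ D.U ⊓ D.conjU (zJ * z)) (hx : x ∈ D.stdUnipotentRadical J) :
    y * x * y⁻¹ ∈ D.stdUnipotentRadical J := by
  have key : ∀ v r, v ∈ Subgroup.closure J → r ∈ J → 1 ∈ D.root v r →
      ∀ y ∈ halfSpaceGroup (D.root v r), ∀ x ∈ D.stdUnipotentRadical J,
        y * x * y⁻¹ ∈ D.stdUnipotentRadical J := by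
    intro v r hv hr h y hy x hx
    suffices D.stdUnipotentRadical J ≤
        (D.stdUnipotentRadical J).comap (MulAut.conj y).toMonoidHom from this hx
    refine (unipotentRadical_le_iSup hz hzJ).trans (iSup_le fun w => iSup_le fun s =>
      iSup_le fun hs => iSup_le fun h1 => iSup_le fun h2 => fun x hx => ?_)
    have h3 := commutator_le hz hJ hzJ hs h1 h2 hv hr h (Subgroup.commutator_mem_commutator hx hy)
    have hxQ : x ∈ D.stdUnipotentRadical J := by
      rw [stdUnipotentRadical_eq hzJ, ← conjU_one]
      exact ⟨halfSpaceGroup_le h1 hx, halfSpaceGroup_le h2 hx⟩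
    have h4 := inv_mem (mul_mem (inv_mem hxQ) h3)
    rw [commutatorElement_def] at h4
    change y * x * y⁻¹ ∈ D.stdUnipotentRadical J
    have e : y * x * y⁻¹ = (x⁻¹ * (x * y * x⁻¹ * y⁻¹))⁻¹ := by group
    rwa [e]
  suffices D.U ⊓ D.conjU (zJ * z) ≤ Subgroup.normalizer (D.stdUnipotentRadical J : Set G) by
    exact ((Subgroup.mem_normalizer_iff.1 (this hy)) x).1 hx
  refine (unipotent_le_iSup hz hJ hzJ).trans (iSup_le fun v => iSup_le fun r => iSup_le fun hv =>
    iSup_le fun hr => iSup_le fun h => fun y hy => ?_)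
  rw [Subgroup.mem_normalizer_iff]
  refine fun x => ⟨fun hx => key v r hv hr h y hy x hx, fun hx => ?_⟩
  have := key v r hv hr h y⁻¹ (inv_mem hy) _ hx
  simpa [mul_assoc] using this

omit hJ in
/-- The Levi decomposition of an element of `B`. -/
theorem exists_mul_mul_of_mem_B {b : G} (hb : b ∈ D.B) : ∃ q ∈ D.stdUnipotentRadical J,
    ∃ y ∈ D.U ⊓ D.conjU (zJ * z), ∃ t ∈ D.T, b = q * y * t := by
  obtain ⟨u, hu, t, ht, rfl⟩ := D.exists_mul_of_mem_B hb
  rw [← conjU_one] at hu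
  obtain ⟨q, hq, y, hy, rfl⟩ := exists_mul_of_mem_conjU hz 1 zJ hu
  rw [one_mul, conjU_one, ← stdUnipotentRadical_eq hzJ] at hq
  rw [one_mul, conjU_one] at hy
  exact ⟨q, hq, y, hy, t, ht, rfl⟩

omit hz hzJ hJ [Finite G] in
theorem conj_mem_stdUnipotentRadical_of_mem_T {t x : G} (ht : t ∈ D.T)
    (hx : x ∈ D.stdUnipotentRadical J) : t * x * t⁻¹ ∈ D.stdUnipotentRadical J := by
  rw [mem_stdUnipotentRadical] at hx ⊢
  exact fun v hv => conj_mem_conjU_of_mem_T ht (hx v hv)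

/-- `U_J` is normal in `P_J`. -/
theorem conj_mem_stdUnipotentRadical {g x : G} (hg : g ∈ D.stdParabolic J)
    (hx : x ∈ D.stdUnipotentRadical J) : g * x * g⁻¹ ∈ D.stdUnipotentRadical J := by
  suffices D.stdParabolic J ≤ Subgroup.normalizer (D.stdUnipotentRadical J : Set G) by
    exact ((Subgroup.mem_normalizer_iff.1 (this hg)) x).1 hx
  have h : ∀ {H : Subgroup G}, (∀ g ∈ H, ∀ x ∈ D.stdUnipotentRadical J,
      g * x * g⁻¹ ∈ D.stdUnipotentRadical J) →
      H ≤ Subgroup.normalizer (D.stdUnipotentRadical J : Set G) := by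
    intro H hH g hg
    rw [Subgroup.mem_normalizer_iff]
    refine fun x => ⟨hH g hg x, fun hx => ?_⟩
    simpa [mul_assoc] using hH g⁻¹ (inv_mem hg) _ hx
  refine sup_le (h fun b hb x hx => ?_) (h fun g hg x hx => ?_)
  · obtain ⟨q, hq, y, hy, t, ht, rfl⟩ := exists_mul_mul_of_mem_B hz hzJ hb
    have h1 := conj_mem_stdUnipotentRadical_of_mem_unipotent hz hJ hzJ hy
      (conj_mem_stdUnipotentRadical_of_mem_T ht hx)
    have h2 := mul_mem (mul_mem hq h1) (inv_mem hq)
    simpa [mul_assoc] using h2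
  · obtain ⟨n, hn, rfl⟩ := mem_NJ_iff.1 hg
    exact conj_mem_stdUnipotentRadical_of_mem_NJ hn hx

omit hzJ in
theorem halfSpaceGroup_le_stdLevi {v r : D.W} (hv : v ∈ Subgroup.closure J) (hr : r ∈ J) :
    halfSpaceGroup (D.root v r) ≤ D.stdLevi J := by
  obtain ⟨n, rfl⟩ := D.exists_rep v
  rw [← rootSubgroup_eq hz (hJ hr)]
  exact le_sup_of_le_right (le_iSup_of_le n (le_iSup_of_le r (le_iSup_of_le
    (coe_mem_NJ_iff.2 hv) (le_iSup_of_le hr le_rfl))))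

omit hzJ in
theorem stdLevi_le {H : Subgroup G} (hT : D.T ≤ H) (h : ∀ v ∈ Subgroup.closure J, ∀ r ∈ J,
    halfSpaceGroup (D.root v r) ≤ H) : D.stdLevi J ≤ H := by
  refine sup_le hT (iSup_le fun n => iSup_le fun s => iSup_le fun hn => iSup_le fun hs => ?_)
  rw [rootSubgroup_eq hz (hJ hs)]
  exact h _ (coe_mem_NJ_iff.1 hn) s hs

omit hzJ hJ hz [Finite G] in
theorem T_le_stdLevi : D.T ≤ D.stdLevi J := le_sup_left

theorem unipotent_le_stdLevi : D.U ⊓ D.conjU (zJ * z) ≤ D.stdLevi J :=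
  (unipotent_le_iSup hz hJ hzJ).trans (iSup_le fun _ => iSup_le fun _ => iSup_le fun hv =>
    iSup_le fun hr => iSup_le fun _ => halfSpaceGroup_le_stdLevi hz hJ hv hr)

omit hzJ in
theorem stdLevi_le_stdParabolic : D.stdLevi J ≤ D.stdParabolic J :=
  stdLevi_le hz hJ (D.T_le_B.trans (B_le_stdParabolic J)) fun _ hv _ hr =>
    (halfSpaceGroup_le (BNPair.mem_root_self (hJ hr))).trans (conjU_le_stdParabolic hv)

end Longest

end SplitBNPair

/-! ### Opposite parabolic subgroups and the Levi decomposition. -/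

namespace SplitBNPair

variable {p : ℕ} {G : Type*} [Group G] {D : SplitBNPair p G}

/-- The opposite type `w₀ J w₀` of `J ⊆ S`. -/
def oppositeType (z : D.W) (J : Set D.W) : Set D.W := MulAut.conj z '' J

section Longest

variable [Finite G] {z : D.W} (hz : BNPair.IsLongestIn D.S z) {J : Set D.W} (hJ : J ⊆ D.S)
  {zJ : D.W} (hzJ : BNPair.IsLongestIn J zJ)

include hz

omit [Finite G] in
theorem conj_eq (x : D.W) : MulAut.conj z x = z * x * z := by
  rw [MulAut.conj_apply, hz.inv]

omit [Finite G] in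
theorem conj_conj (x : D.W) : z * (z * x * z) * z = x := by
  have := hz.mul_self
  calc z * (z * x * z) * z = (z * z) * x * (z * z) := by group
    _ = x := by rw [this, one_mul, mul_one]

omit [Finite G] in
theorem oppositeType_subset (hJ : J ⊆ D.S) : oppositeType z J ⊆ D.S := by
  rintro _ ⟨s, hs, rfl⟩
  rw [conj_eq hz]
  exact hz.conj_mem (hJ hs)

omit [Finite G] in
theorem oppositeType_oppositeType : oppositeType z (oppositeType z J) = J := by
  rw [oppositeType, oppositeType, Set.image_image]
  simp only [conj_eq hz, conj_conj hz, Set.image_id']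

omit [Finite G] in
theorem conj_mem_closure_oppositeType {x : D.W} (hx : x ∈ Subgroup.closure J) :
    z * x * z ∈ Subgroup.closure (oppositeType z J) := by
  have h : Subgroup.closure (oppositeType z J) =
      (Subgroup.closure J).map (MulAut.conj z).toMonoidHom :=
    ((MulAut.conj z).toMonoidHom.map_closure J).symm
  rw [h, ← conj_eq hz]
  exact ⟨x, hx, rfl⟩

omit [Finite G] in
theorem conj_mem_closure_of_oppositeType {x : D.W}
    (hx : x ∈ Subgroup.closure (oppositeType z J)) : z * x * z ∈ Subgroup.closure J := by
  have := conj_mem_closure_oppositeType hz hx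
  rwa [oppositeType_oppositeType hz] at this

omit [Finite G] in
theorem isLongestIn_oppositeType (hzJ : BNPair.IsLongestIn J zJ) :
    BNPair.IsLongestIn (oppositeType z J) (z * zJ * z) := by
  refine ⟨conj_mem_closure_oppositeType hz hzJ.mem, fun x hx => ?_⟩
  have h1 := hzJ.length_eq _ (conj_mem_closure_of_oppositeType hz hx)
  rw [hz.length_conj (BNPair.mem_closure_S _), h1, hz.length_conj (BNPair.mem_closure_S _),
    ← hz.length_conj (BNPair.mem_closure_S ((z * x * z)⁻¹ * zJ))]
  congr 2
  have := hz.mul_self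
  rw [mul_inv_rev, mul_inv_rev, hz.inv]
  calc z * (z * (x⁻¹ * z) * zJ) * z = (z * z) * (x⁻¹ * z * zJ * z) := by group
    _ = _ := by rw [this]; group

omit [Finite G] in
include hJ hzJ in
/-- The unipotent radical of a parabolic subgroup meets the opposite parabolic subgroup
trivially. -/
theorem eq_one_of_mem_opposite {n : D.N} (hn : (n : D.W) = z) {x : G}
    (hx : x ∈ D.stdUnipotentRadical J)
    (hx' : (n : G)⁻¹ * x * n ∈ D.stdParabolic (oppositeType z J)) : x = 1 := by
  have hJ' := oppositeType_subset hz hJ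
  have hzJ' := isLongestIn_oppositeType hz hzJ
  have h1 : (n : G)⁻¹ * x * n ∈ D.conjB (z * zJ * z * (z * zJ * z * z)) := by
    have e : z * zJ * z * (z * zJ * z * z) = ((n⁻¹ : D.N) : D.W) := by
      rw [QuotientGroup.mk_inv, hn, hz.inv]
      calc z * zJ * z * (z * zJ * z * z) = z * zJ * (z * z) * zJ * (z * z) := by group
        _ = z * (zJ * zJ) := by rw [hz.mul_self]; group
        _ = z := by rw [hzJ.mul_self, mul_one]
    rw [e, mem_conjB_coe]
    have := D.U_le (stdUnipotentRadical_le_U J hx)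
    simpa [mul_assoc] using this
  -- In the residue of the opposite type, the chamber `z` projects to `z zJ z`. Thus `x` fixes `zJ
  -- z`, which is opposite to `zJ`, while `x` lies in `zJ U`.
  have h2 := conjB_inf_stdParabolic_le hJ' (fun y hy => length_mul_mul_longest hz hzJ' hy)
    hzJ'.mem ⟨h1, hx'⟩
  rw [← mem_conjB_mul, hn, mul_assoc z zJ, ← mul_assoc z z, hz.mul_self, one_mul] at h2
  have h3 : x ∈ D.conjU zJ ⊓ D.conjB (zJ * z) := ⟨stdUnipotentRadical_le hzJ.mem hx, h2⟩
  rw [conjU_inf_eq_bot hz] at h3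
  exact h3

include hJ in
theorem stdLevi_le_opposite {n : D.N} (hn : (n : D.W) = z) {x : G} (hx : x ∈ D.stdLevi J) :
    (n : G)⁻¹ * x * n ∈ D.stdParabolic (oppositeType z J) := by
  suffices h : D.stdLevi J ≤
      (D.stdParabolic (oppositeType z J)).map (MulAut.conj (n : G)).toMonoidHom from
    mem_map_conj_iff.1 (h hx)
  refine stdLevi_le hz hJ (fun t ht => ?_) fun v hv r hr => ?_
  · rw [mem_map_conj_iff]
    exact B_le_stdParabolic _ (D.T_le_B (T_conj_mem' n.2 ht))
  · intro x hx
    rw [halfSpaceGroup_root hz (hJ hr)] at hx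
    rw [mem_map_conj_iff]
    have h1 : x ∈ D.conjU (n * (z * (v * r) * z)) := by
      rw [hn]
      have e : z * (z * (v * r) * z) = v * r * z := by
        rw [← mul_assoc, ← mul_assoc, hz.mul_self, one_mul]
      rw [e]
      exact hx.2
    rw [mem_conjU_mul] at h1
    exact conjU_le_stdParabolic (conj_mem_closure_oppositeType hz
      (mul_mem hv (Subgroup.subset_closure hr))) h1

include hJ in
theorem conj_mem_stdLevi_of_mem_oppositeType {n : D.N} (hn : (n : D.W) = z) {x : G}
    (hx : x ∈ D.stdLevi (oppositeType z J)) : n * x * (n : G)⁻¹ ∈ D.stdLevi J := by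
  suffices h : D.stdLevi (oppositeType z J) ≤
      (D.stdLevi J).map (MulAut.conj (n : G)⁻¹).toMonoidHom by
    have := mem_map_conj_iff.1 (h hx)
    simpa using this
  refine stdLevi_le hz (oppositeType_subset hz hJ) (fun t ht => ?_) fun v hv r hr => ?_
  · rw [mem_map_conj_iff]
    exact T_le_stdLevi (T_conj_mem' (D.N.inv_mem n.2) ht)
  · intro x hx
    obtain ⟨s, hs, rfl⟩ := hr
    have hr' : z * s * z ∈ D.S := hz.conj_mem (hJ hs)
    rw [conj_eq hz, halfSpaceGroup_root hz hr'] at hx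
    rw [mem_map_conj_iff]
    have hy := conj_mem_closure_of_oppositeType hz hv
    -- Conjugation by `n` moves the two chambers that define the given root group to those of the
    -- root at `zvzs`, in exchanged order.
    refine halfSpaceGroup_le_stdLevi hz hJ (mul_mem hy (Subgroup.subset_closure hs)) hs ?_
    have h1 : z * v * z * s * s * z = (n : D.W) * v := by
      rw [hn, D.mul_mul_cancel_right_of_mem (hJ hs), mul_assoc,
        hz.mul_self, mul_one]
    have h2 : z * v * z * s = (n : D.W) * (v * (z * s * z) * z) := by
      rw [hn]
      calc z * v * z * s = z * v * z * s * 1 := by group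
        _ = _ := by rw [← hz.mul_self]; group
    rw [halfSpaceGroup_root hz (hJ hs), h1, h2]
    refine Subgroup.mem_inf.2 ⟨?_, ?_⟩
    · rw [mem_conjU_mul]
      simpa [mul_assoc] using hx.2
    · rw [mem_conjU_mul]
      simpa [mul_assoc] using hx.1

omit hz [Finite G] in
theorem isLongestIn_singleton {s : D.W} (hs : s ∈ D.S) : BNPair.IsLongestIn {s} s := by
  refine BNPair.isLongestIn_of_length_le (by simpa using hs)
    (Subgroup.subset_closure (Set.mem_singleton s)) fun x hx => ?_
  obtain ⟨k, rfl⟩ := Subgroup.mem_closure_singleton.1 hx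
  rcases Int.even_or_odd' k with ⟨j, rfl | rfl⟩
  · have : s ^ (2 : ℤ) = 1 := by rw [zpow_two, D.mul_self_of_mem hs]
    rw [zpow_mul, this, one_zpow, D.length_one]
    exact Nat.zero_le _
  · have : s ^ (2 : ℤ) = 1 := by rw [zpow_two, D.mul_self_of_mem hs]
    rw [zpow_add, zpow_mul, this, one_zpow, zpow_one, one_mul]

/-- A representative of `s ∈ J` lies in the subgroup generated by `T` and `X_{±α_s}`. -/
theorem mem_stdLevi_of_mem {m : D.N} (hm : (m : D.W) ∈ D.S) : (m : G) ∈ D.stdLevi {(m : D.W)} := by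
  have hJ : {(m : D.W)} ⊆ D.S := by simpa using hm
  have hsJ := Subgroup.subset_closure (Set.mem_singleton (m : D.W))
  have hz1 := isLongestIn_singleton hm
  have hL : D.U ⊓ D.conjU (m * z) ≤ D.stdLevi {(m : D.W)} := unipotent_le_stdLevi hz hJ hz1
  have hconj : ∀ u ∈ D.stdUnipotentRadical {(m : D.W)},
      m * u * (m : G)⁻¹ ∈ D.stdUnipotentRadical {(m : D.W)} := fun u hu =>
    conj_mem_stdUnipotentRadical_of_mem_NJ hsJ hu
  obtain ⟨b, hb, hbm⟩ := BNPair.exists_conj_notMem hm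
  obtain ⟨u, hu, y, hy, t, ht, rfl⟩ := exists_mul_mul_of_mem_B hz hz1 hb
  -- Conjugation by `m` keeps the factors `u` and `t` in `B`, so it is `y` that leaves `B`. Thus `x`
  -- is an element of the negative root group outside `B`.
  set x := m * y * (m : G)⁻¹ with hx
  have hxB : x ∉ D.B := by
    intro h
    refine hbm ?_
    have h1 := mul_mem (mul_mem (D.U_le (stdUnipotentRadical_le_U _ (hconj u hu))) h)
      (D.T_le_B (T_conj_mem m.2 ht))
    simpa [hx, mul_assoc] using h1
  have hxL : x ∈ D.stdLevi {(m : D.W)} := by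
    refine halfSpaceGroup_le_stdLevi hz hJ hsJ rfl ?_
    rw [halfSpaceGroup_root hz hm, mul_assoc]
    refine Subgroup.mem_inf.2 ⟨?_, ?_⟩
    · rw [mem_conjU_coe]
      simpa [hx, mul_assoc] using hy.1
    · rw [mem_conjU_mul]
      simpa [hx, mul_assoc] using hy.2
  have hxc : x ∈ D.cell m := by
    have hn := BNPair.inv_mem_cell (BNPair.coe_mem_cell m)
    rw [D.inv_eq_of_mem hm] at hn
    rcases BNPair.mul_mem_cell_or hm (BNPair.mem_cell_mul (BNPair.coe_mem_cell m) (D.U_le hy.1)) hn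
      with h | h
    · exact h
    · rw [D.mul_self_of_mem hm, BNPair.mem_cell_one] at h
      exact absurd h hxB
  obtain ⟨b, hb, c, hc, e⟩ := BNPair.mem_cell_coe.1 hxc
  obtain ⟨u₂, hu₂, y₂, hy₂, t₂, ht₂, rfl⟩ := exists_mul_mul_of_mem_B hz hz1 hc
  have hb' : b * (m * u₂ * (m : G)⁻¹) ∈ D.B :=
    mul_mem hb (D.U_le (stdUnipotentRadical_le_U _ (hconj u₂ hu₂)))
  obtain ⟨u₁, hu₁, y₁, hy₁, t₁, ht₁, e₁⟩ := exists_mul_mul_of_mem_B hz hz1 hb'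
  -- All factors from the unipotent radical, which `m` normalizes, are collected on the left. The
  -- rest lies in the opposite parabolic subgroup, as does `x`; so `u₁ = 1`, and `m` is expressed by
  -- elements of the Levi subgroup.
  have e2 : x = u₁ * (y₁ * t₁ * m * (y₂ * t₂)) := by
    calc x = (b * (m * u₂ * (m : G)⁻¹)) * m * (y₂ * t₂) := by rw [e]; group
      _ = _ := by rw [e₁]; group
  have hyt₁ : y₁ * t₁ ∈ D.stdLevi {(m : D.W)} := mul_mem (hL hy₁) (T_le_stdLevi ht₁)
  have hyt₂ : y₂ * t₂ ∈ D.stdLevi {(m : D.W)} := mul_mem (hL hy₂) (T_le_stdLevi ht₂)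
  have hu1 : u₁ = 1 := by
    obtain ⟨n, hn⟩ := D.exists_rep z
    refine eq_one_of_mem_opposite hz hJ hz1 hn hu₁ ?_
    have e3 : u₁ = x * (y₁ * t₁ * m * (y₂ * t₂))⁻¹ := by rw [e2]; group
    have key : ∀ a ∈ D.stdLevi {(m : D.W)}, a ∈ (D.stdParabolic (oppositeType z {(m : D.W)})).map
        (MulAut.conj (n : G)).toMonoidHom := fun a ha =>
      mem_map_conj_iff.2 (stdLevi_le_opposite hz hJ hn ha)
    have hm' : (m : G) ∈ (D.stdParabolic (oppositeType z {(m : D.W)})).map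
        (MulAut.conj (n : G)).toMonoidHom := by
      rw [mem_map_conj_iff]
      refine NJ_le_stdParabolic _ ((coe_mem_NJ_iff (n := n⁻¹ * m * n)).2 ?_)
      rw [QuotientGroup.mk_mul, QuotientGroup.mk_mul, QuotientGroup.mk_inv, hn, hz.inv]
      exact conj_mem_closure_oppositeType hz hsJ
    rw [← mem_map_conj_iff, e3]
    exact mul_mem (key x hxL) (inv_mem (mul_mem (mul_mem (key _ hyt₁) hm') (key _ hyt₂)))
  have e4 : (m : G) = (y₁ * t₁)⁻¹ * x * (y₂ * t₂)⁻¹ := by rw [e2, hu1]; group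
  rw [e4]
  exact mul_mem (mul_mem (inv_mem hyt₁) hxL) (inv_mem hyt₂)

include hJ in
theorem NJ_le_stdLevi : D.NJ J ≤ D.stdLevi J := by
  have key : ∀ w ∈ Subgroup.closure J, ∀ n : D.N, (n : D.W) = w → (n : G) ∈ D.stdLevi J := by
    intro w hw
    refine BNPair.closure_induction_mul_right (p := fun w => ∀ n : D.N, (n : D.W) = w →
      (n : G) ∈ D.stdLevi J) hJ (fun n hn => T_le_stdLevi ⟨D.coe_eq_one_iff.1 hn, n.2⟩)
      (fun w _ s hs ih n hn => ?_) hw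
    obtain ⟨m, rfl⟩ := D.exists_rep s
    have h1 := ih (n * m⁻¹) (by
      rw [QuotientGroup.mk_mul, hn, QuotientGroup.mk_inv, mul_inv_cancel_right])
    have h2 : (m : G) ∈ D.stdLevi J := by
      refine stdLevi_le hz (by simpa using hJ hs) T_le_stdLevi (fun v hv r hr => ?_)
        (mem_stdLevi_of_mem hz (hJ hs))
      exact halfSpaceGroup_le_stdLevi hz hJ
        (Subgroup.closure_mono (Set.singleton_subset_iff.2 hs) hv) (by rwa [Set.mem_singleton_iff.1 hr])
    have h3 := mul_mem h1 h2
    simpa using h3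
  intro g hg
  obtain ⟨n, hn, rfl⟩ := mem_NJ_iff.1 hg
  exact key _ hn n rfl

include hJ in
/-- The Levi decomposition `P_J = U_J L_J`. -/
theorem exists_mul_of_mem_stdParabolic {g : G} (hg : g ∈ D.stdParabolic J) :
    ∃ q ∈ D.stdUnipotentRadical J, ∃ l ∈ D.stdLevi J, g = q * l := by
  obtain ⟨zJ, hzJ⟩ := BNPair.exists_isLongestIn hJ
  have hL : D.stdLevi J ≤ Subgroup.normalizer (D.stdUnipotentRadical J : Set G) := by
    intro l hl
    have hl' := stdLevi_le_stdParabolic hz hJ hl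
    rw [Subgroup.mem_normalizer_iff]
    refine fun x => ⟨conj_mem_stdUnipotentRadical hz hJ hzJ hl', fun hx => ?_⟩
    simpa [mul_assoc] using conj_mem_stdUnipotentRadical hz hJ hzJ (inv_mem hl') hx
  have h : D.stdParabolic J ≤ D.stdUnipotentRadical J ⊔ D.stdLevi J := by
    refine sup_le (fun b hb => ?_) ((NJ_le_stdLevi hz hJ).trans le_sup_right)
    obtain ⟨q, hq, y, hy, t, ht, rfl⟩ := exists_mul_mul_of_mem_B hz hzJ hb
    rw [mul_assoc]
    exact Subgroup.mul_mem_sup hq (mul_mem (unipotent_le_stdLevi hz hJ hzJ hy) (T_le_stdLevi ht))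
  have h2 : g ∈ ((D.stdUnipotentRadical J ⊔ D.stdLevi J : Subgroup G) : Set G) := h hg
  rw [Subgroup.coe_mul_of_right_le_normalizer_left _ _ hL] at h2
  obtain ⟨q, hq, l, hl, rfl⟩ := h2
  exact ⟨q, hq, l, hl, rfl⟩

include hJ in
/-- The Levi decomposition of an element of `P_J ∩ wU` takes place in `wU`. -/
theorem levi_component_mem {a : D.W} {q l : G} (hq : q ∈ D.stdUnipotentRadical J)
    (hl : l ∈ D.stdLevi J) (h : q * l ∈ D.conjU a) : l ∈ D.conjU a := by
  obtain ⟨zJ, hzJ⟩ := BNPair.exists_isLongestIn hJ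
  -- With `m` minimal in `W_J a`, the chamber `x⁻¹` is the projection of `a = x⁻¹m` to `W_J`. So
  -- `ql` fixes `x⁻¹`, and conjugation by a representative `n` of `x⁻¹` reduces to an element `q₁y`
  -- of `U`.
  obtain ⟨x, hx, hmin⟩ := BNPair.exists_minimal hJ a
  set m := x * a with hm
  have ea : a = x⁻¹ * m := by rw [hm]; group
  have hP : q * l ∈ D.stdParabolic J := mul_mem
    (B_le_stdParabolic J (D.U_le (stdUnipotentRadical_le_U J hq))) (stdLevi_le_stdParabolic hz hJ hl)
  rw [ea] at h ⊢
  have h1 := mem_conjU_of_isPGroup (conjU_isPGroup _) h (conjB_inf_stdParabolic_le hJ hmin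
    (inv_mem hx) ⟨conjU_le_conjB _ h, hP⟩)
  obtain ⟨n, hn⟩ := D.exists_rep x⁻¹
  have hnJ : (n : D.W) ∈ Subgroup.closure J := hn ▸ inv_mem hx
  rw [← hn] at h h1 ⊢
  rw [mem_conjU_mul] at h ⊢
  rw [mem_conjU_coe, ← conjU_one] at h1
  obtain ⟨q₁, hq₁, y, hy, e⟩ := exists_mul_of_mem_conjU hz 1 zJ h1
  rw [one_mul, conjU_one, ← stdUnipotentRadical_eq hzJ] at hq₁
  rw [one_mul, conjU_one] at hy
  -- The minimal element `m` lies on a geodesic from `1` to `zJ z`.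
  have hym : y ∈ D.conjU m := by
    rw [← conjU_one] at hy
    refine conjU_inf_le ?_ hy
    have h2 := hz.length_mul (BNPair.mem_closure_S zJ)
    have h3 := hz.length_mul (BNPair.mem_closure_S (m⁻¹ * zJ))
    have h4 := hz.length_le (BNPair.mem_closure_S (m⁻¹ * zJ))
    have h5 := hmin zJ hzJ.mem
    have h6 : D.length (m⁻¹ * zJ) = D.length (zJ * m) := by
      rw [← D.length_inv, mul_inv_rev, inv_inv, hzJ.inv]
    rw [mul_assoc] at h3
    simp only [inv_one, one_mul]
    omega
  have e1 : q * l = (n * q₁ * (n : G)⁻¹) * (n * y * (n : G)⁻¹) := by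
    calc q * l = n * ((n : G)⁻¹ * (q * l) * n) * (n : G)⁻¹ := by group
      _ = _ := by rw [e]; group
  have hq₂ := conj_mem_stdUnipotentRadical_of_mem_NJ hnJ hq₁
  have hnL := NJ_le_stdLevi hz hJ (coe_mem_NJ_iff.2 hnJ)
  have hl₂ := mul_mem (mul_mem hnL (unipotent_le_stdLevi hz hJ hzJ hy)) (inv_mem hnL)
  -- Uniqueness of the Levi decomposition identifies `l` with the conjugate of `y`.
  have e2 : q⁻¹ * (n * q₁ * (n : G)⁻¹) = l * (n * y * (n : G)⁻¹)⁻¹ := by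
    rw [inv_mul_eq_iff_eq_mul, ← mul_assoc, e1]; group
  obtain ⟨k, hk⟩ := D.exists_rep z
  have h7 : q⁻¹ * (n * q₁ * (n : G)⁻¹) = 1 :=
    eq_one_of_mem_opposite hz hJ hzJ hk (mul_mem (inv_mem hq) hq₂)
      (stdLevi_le_opposite hz hJ hk (e2 ▸ mul_mem hl (inv_mem hl₂)))
  have h8 : l = n * y * (n : G)⁻¹ := by rw [← mul_inv_eq_one, ← e2, h7]
  rw [h8]
  simpa [mul_assoc] using hym

end Longest

end SplitBNPair

/-! ### Abstract pairs of opposite parabolic subgroups. -/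

/-- A pair of subgroups `P = QL` and `P' = Q'L` that behave like opposite parabolic subgroups with a
common Levi complement `L`. -/
structure IsOppositePair {G : Type*} [Group G] (P Q L P' Q' : Subgroup G) : Prop where
  exists_mul : ∀ x ∈ P, ∃ q ∈ Q, ∃ l ∈ L, x = q * l
  exists_mul' : ∀ x ∈ P', ∃ q ∈ Q', ∃ l ∈ L, x = q * l
  Q_le : Q ≤ P
  Q_le' : Q' ≤ P'
  L_le : L ≤ P
  L_le' : L ≤ P'
  conj_mem : ∀ x ∈ P, ∀ q ∈ Q, x * q * x⁻¹ ∈ Q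
  conj_mem' : ∀ x ∈ P', ∀ q ∈ Q', x * q * x⁻¹ ∈ Q'
  inf_eq_bot : Q ⊓ P' = ⊥
  inf_eq_bot' : Q' ⊓ P = ⊥
  card_eq : Nat.card P = Nat.card P'
  /-- The double cosets `QgP` have representatives `r` such that intersections with `r⁻¹Qr` are
  compatible with the Levi decomposition. -/
  exists_rep : ∀ g : G, ∃ q ∈ Q, ∃ r, ∃ x ∈ P, g = q * r * x ∧
    ∀ q₁ ∈ Q, ∀ l ∈ L, r * (q₁ * l) * r⁻¹ ∈ Q → r * l * r⁻¹ ∈ Q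

namespace IsOppositePair

variable {G : Type*} [Group G] {P Q L P' Q' : Subgroup G}

theorem map_conj (h : IsOppositePair P Q L P' Q') (g : G) :
    IsOppositePair (P.map (MulAut.conj g).toMonoidHom) (Q.map (MulAut.conj g).toMonoidHom)
      (L.map (MulAut.conj g).toMonoidHom) (P'.map (MulAut.conj g).toMonoidHom)
      (Q'.map (MulAut.conj g).toMonoidHom) where
  exists_mul := by
    rintro _ ⟨x, hx, rfl⟩
    obtain ⟨q, hq, l, hl, rfl⟩ := h.exists_mul x hx
    exact ⟨_, Subgroup.mem_map_of_mem _ hq, _, Subgroup.mem_map_of_mem _ hl, map_mul _ _ _⟩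
  exists_mul' := by
    rintro _ ⟨x, hx, rfl⟩
    obtain ⟨q, hq, l, hl, rfl⟩ := h.exists_mul' x hx
    exact ⟨_, Subgroup.mem_map_of_mem _ hq, _, Subgroup.mem_map_of_mem _ hl, map_mul _ _ _⟩
  Q_le := Subgroup.map_mono h.Q_le
  Q_le' := Subgroup.map_mono h.Q_le'
  L_le := Subgroup.map_mono h.L_le
  L_le' := Subgroup.map_mono h.L_le'
  conj_mem := by
    rintro _ ⟨x, hx, rfl⟩ _ ⟨q, hq, rfl⟩
    rw [← map_mul, ← map_inv, ← map_mul]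
    exact Subgroup.mem_map_of_mem _ (h.conj_mem x hx q hq)
  conj_mem' := by
    rintro _ ⟨x, hx, rfl⟩ _ ⟨q, hq, rfl⟩
    rw [← map_mul, ← map_inv, ← map_mul]
    exact Subgroup.mem_map_of_mem _ (h.conj_mem' x hx q hq)
  inf_eq_bot := by
    rw [← SplitBNPair.map_conj_inf, h.inf_eq_bot, Subgroup.map_bot]
  inf_eq_bot' := by
    rw [← SplitBNPair.map_conj_inf, h.inf_eq_bot', Subgroup.map_bot]
  card_eq := by rw [Subgroup.card_map_conj, Subgroup.card_map_conj, h.card_eq]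
  exists_rep := by
    intro y
    obtain ⟨q, hq, r, x, hx, e, H⟩ := h.exists_rep (g⁻¹ * y * g)
    refine ⟨MulAut.conj g q, Subgroup.mem_map_of_mem _ hq, MulAut.conj g r, MulAut.conj g x,
      Subgroup.mem_map_of_mem _ hx, ?_, ?_⟩
    · rw [← map_mul, ← map_mul, ← e, MulAut.conj_apply]
      group
    · rintro _ ⟨q₁, hq₁, rfl⟩ _ ⟨l, hl, rfl⟩ h1
      have h2 : MulAut.conj g (r * (q₁ * l) * r⁻¹) ∈ Q.map (MulAut.conj g).toMonoidHom := by
        rw [map_mul, map_mul, map_mul, map_inv]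
        exact h1
      have h3 : r * (q₁ * l) * r⁻¹ ∈ Q := (Subgroup.mem_map_iff_mem (MulAut.conj g).injective).1 h2
      have h4 : MulAut.conj g (r * l * r⁻¹) ∈ Q.map (MulAut.conj g).toMonoidHom :=
        Subgroup.mem_map_of_mem _ (H q₁ hq₁ l hl h3)
      rw [map_mul, map_mul, map_inv] at h4
      exact h4

end IsOppositePair

namespace SplitBNPair

variable {p : ℕ} {G : Type*} [Group G] [Finite G] {D : SplitBNPair p G}

theorem isOppositePair_std {z : D.W} (hz : BNPair.IsLongestIn D.S z) {J : Set D.W} (hJ : J ⊆ D.S)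
    {n : D.N} (hn : (n : D.W) = z) :
    IsOppositePair (D.stdParabolic J) (D.stdUnipotentRadical J) (D.stdLevi J)
      ((D.stdParabolic (oppositeType z J)).map (MulAut.conj (n : G)).toMonoidHom)
      ((D.stdUnipotentRadical (oppositeType z J)).map (MulAut.conj (n : G)).toMonoidHom) := by
  obtain ⟨zJ, hzJ⟩ := BNPair.exists_isLongestIn hJ
  have hJ' := oppositeType_subset hz hJ
  have hzJ' := isLongestIn_oppositeType hz hzJ
  have hQle : ∀ J : Set D.W, D.stdUnipotentRadical J ≤ D.stdParabolic J := fun J =>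
    (stdUnipotentRadical_le_U J).trans (D.U_le.trans (B_le_stdParabolic J))
  have hL' : D.stdLevi J ≤
      (D.stdParabolic (oppositeType z J)).map (MulAut.conj (n : G)).toMonoidHom := fun l hl =>
    mem_map_conj_iff.2 (stdLevi_le_opposite hz hJ hn hl)
  have hQP : D.stdUnipotentRadical J ⊓
      (D.stdParabolic (oppositeType z J)).map (MulAut.conj (n : G)).toMonoidHom = ⊥ := by
    rw [eq_bot_iff]
    intro x hx
    exact eq_one_of_mem_opposite hz hJ hzJ hn hx.1 (mem_map_conj_iff.1 hx.2)
  have hQP' : (D.stdUnipotentRadical (oppositeType z J)).map (MulAut.conj (n : G)).toMonoidHom ⊓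
      D.stdParabolic J = ⊥ := by
    rw [eq_bot_iff]
    intro x hx
    have h1 := mem_map_conj_iff.1 hx.1
    have h2 := eq_one_of_mem_opposite (n := n⁻¹) hz hJ' hzJ' (by
      rw [QuotientGroup.mk_inv, hn, hz.inv]) h1 (by
        rw [oppositeType_oppositeType hz]
        simpa [mul_assoc] using hx.2)
    rw [Subgroup.mem_bot]
    simpa [mul_assoc, inv_mul_eq_one] using h2
  have hmul : ∀ x ∈ D.stdParabolic J, ∃ q ∈ D.stdUnipotentRadical J, ∃ l ∈ D.stdLevi J,
      x = q * l := fun x hx => exists_mul_of_mem_stdParabolic hz hJ hx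
  have hmul' : ∀ x ∈ (D.stdParabolic (oppositeType z J)).map (MulAut.conj (n : G)).toMonoidHom,
      ∃ q ∈ (D.stdUnipotentRadical (oppositeType z J)).map (MulAut.conj (n : G)).toMonoidHom,
      ∃ l ∈ D.stdLevi J, x = q * l := by
    rintro _ ⟨x, hx, rfl⟩
    obtain ⟨q, hq, l, hl, rfl⟩ := exists_mul_of_mem_stdParabolic hz hJ' hx
    exact ⟨_, Subgroup.mem_map_of_mem _ hq, n * l * (n : G)⁻¹,
      conj_mem_stdLevi_of_mem_oppositeType hz hJ hn hl, map_mul _ _ _⟩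
  have hLP := stdLevi_le_stdParabolic hz hJ
  refine ⟨hmul, hmul', hQle J, Subgroup.map_mono (hQle _), hLP, hL',
    fun x hx q hq => conj_mem_stdUnipotentRadical hz hJ hzJ hx hq, ?_, hQP, hQP', ?_, ?_⟩
  · rintro _ ⟨x, hx, rfl⟩ _ ⟨q, hq, rfl⟩
    rw [← map_mul, ← map_inv, ← map_mul]
    exact Subgroup.mem_map_of_mem _ (conj_mem_stdUnipotentRadical hz hJ' hzJ' hx hq)
  · have h1 := Subgroup.card_mul_card_eq_of_forall (hQle J) hLP hmul
    have h2 := Subgroup.card_mul_card_eq_of_forall (Subgroup.map_mono (hQle (oppositeType z J)))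
      hL' hmul'
    have h3 : D.stdUnipotentRadical J ⊓ D.stdLevi J = ⊥ := by
      rw [eq_bot_iff, ← hQP]
      exact inf_le_inf_left _ hL'
    have h4 : (D.stdUnipotentRadical (oppositeType z J)).map (MulAut.conj (n : G)).toMonoidHom ⊓
        D.stdLevi J = ⊥ := by
      rw [eq_bot_iff, ← hQP']
      exact inf_le_inf_left _ hLP
    rw [h3, Subgroup.card_bot, mul_one] at h1
    rw [h4, Subgroup.card_bot, mul_one, Subgroup.card_map_conj] at h2
    -- The orders of `U_J` and of its opposite-type analogue have the same cofactor `|U ∩ zJ z U|`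
    -- in `|U|`.
    have h5 := card_mul_card_longest hz zJ
    have h6 := card_mul_card_longest hz (z * zJ * z)
    rw [mul_assoc (z * zJ), hz.mul_self, mul_one, ← stdUnipotentRadical_eq hzJ',
      ← card_U_inf_inv (z * zJ), mul_inv_rev, hzJ.inv, hz.inv, ← h5,
      ← stdUnipotentRadical_eq hzJ] at h6
    rw [← h1, ← h2, Nat.eq_of_mul_eq_mul_right Nat.card_pos h6]
  · intro g
    obtain ⟨w, hw⟩ := BNPair.exists_mem_cell (D := D.toBNPair) g
    obtain ⟨k, rfl⟩ := D.exists_rep w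
    obtain ⟨b, hb, c, hc, rfl⟩ := BNPair.mem_cell_coe.1 hw
    obtain ⟨q, hq, l, hl, rfl⟩ := hmul b (B_le_stdParabolic J hb)
    -- In `g = bkc` the Levi component `l` of `b` is absorbed into the representative `r = lk`. As
    -- `l` normalizes `Q`, the group `r⁻¹Qr` is an intersection of conjugates `aU`, each of which
    -- admits Levi components.
    refine ⟨q, hq, l * k, c, B_le_stdParabolic J hc, by group, fun q₁ hq₁ m hm h => ?_⟩
    have key : ∀ x, l * k * x * (l * k)⁻¹ ∈ D.stdUnipotentRadical J ↔
        ∀ v ∈ Subgroup.closure J, x ∈ D.conjU ((k⁻¹ : D.N) * v) := by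
      intro x
      have h1 : l * k * x * (l * k)⁻¹ ∈ D.stdUnipotentRadical J ↔
          k * x * (k : G)⁻¹ ∈ D.stdUnipotentRadical J := by
        constructor
        · intro h
          have := conj_mem_stdUnipotentRadical hz hJ hzJ (inv_mem (hLP hl)) h
          simpa [mul_assoc] using this
        · intro h
          have := conj_mem_stdUnipotentRadical hz hJ hzJ (hLP hl) h
          simpa [mul_assoc] using this
      rw [h1, mem_stdUnipotentRadical]
      refine forall₂_congr fun v _ => ?_
      rw [mem_conjU_mul]
      simp
    rw [key] at h ⊢
    exact fun v hv => levi_component_mem hz hJ hq₁ hm (h v hv)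

theorem IsParabolic.exists_isOppositePair {P Q L : Subgroup G} (h : D.IsParabolic P Q L) :
    ∃ P' Q', IsOppositePair P Q L P' Q' := by
  obtain ⟨n, J, hJ, rfl, rfl, rfl⟩ := h
  obtain ⟨z, hz⟩ := BNPair.exists_isLongestIn (D := D.toBNPair) subset_rfl
  obtain ⟨m, hm⟩ := D.exists_rep z
  exact ⟨_, _, (isOppositePair_std hz hJ hm).map_conj n⟩

end SplitBNPair

/-! ### Induced representations in terms of an embedding and a retraction. -/

namespace Representation

variable {K G M M' Y : Type*} [Field K] [Group G] [AddCommGroup M] [Module K M]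
  [AddCommGroup M'] [Module K M'] [AddCommGroup Y] [Module K Y]

/-- `ρ` is induced from the representation `σ` of `P` on `Y`: there is an equivariant embedding
`ι : Y → M` whose translates span, with an equivariant retraction `π` that vanishes on the
translates other than `ι Y`. -/
structure IsInducedFrom (ρ : Representation K G M) (P : Subgroup G) (σ : Representation K P Y)
    (ι : Y →ₗ[K] M) (π : M →ₗ[K] Y) : Prop where
  map_apply : ∀ (x : P) y, ι (σ x y) = ρ x (ι y)
  proj_apply : ∀ y, π (ι y) = y
  proj_eq_zero : ∀ g ∉ P, ∀ y, π (ρ g (ι y)) = 0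
  iSup_eq_top : ⨆ g, (LinearMap.range ι).map (ρ g) = ⊤

theorem mul_apply (ρ : Representation K G M) (g h : G) (m : M) : ρ (g * h) m = ρ g (ρ h m) := by
  rw [map_mul]; rfl

theorem one_apply (ρ : Representation K G M) (m : M) : ρ 1 m = m := by
  rw [map_one]; rfl

theorem inv_apply_apply (ρ : Representation K G M) (g : G) (m : M) : ρ g⁻¹ (ρ g m) = m := by
  rw [← mul_apply, inv_mul_cancel, one_apply]

theorem linearMap_ext_of_iSup_eq_top {ρ : Representation K G M} {ι : Y →ₗ[K] M}
    (h : ⨆ g, (LinearMap.range ι).map (ρ g) = ⊤) {N : Type*} [AddCommGroup N] [Module K N]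
    {f f' : M →ₗ[K] N} (hf : ∀ g y, f (ρ g (ι y)) = f' (ρ g (ι y))) : f = f' := by
  rw [← LinearMap.eqLocus_eq_top, eq_top_iff, ← h]
  refine iSup_le fun g => ?_
  rintro _ ⟨_, ⟨y, rfl⟩, rfl⟩
  exact hf g y

section Transversal

variable {P : Subgroup G} [Fintype (G ⧸ P)]

/-- The map `⨁_{c ∈ G/P} Y → M` belonging to a transversal `s` and `ι : Y → M`. -/
def sumMap (ρ : Representation K G M) (ι : Y →ₗ[K] M) (s : G ⧸ P → G) : (G ⧸ P → Y) →ₗ[K] M :=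
  ∑ c, ρ (s c) ∘ₗ ι ∘ₗ LinearMap.proj c

theorem sumMap_apply (ρ : Representation K G M) (ι : Y →ₗ[K] M) (s : G ⧸ P → G) (f : G ⧸ P → Y) :
    sumMap ρ ι s f = ∑ c, ρ (s c) (ι (f c)) := by
  simp [sumMap]

/-- The coordinates with respect to a transversal. -/
def coordMap (ρ : Representation K G M) (π : M →ₗ[K] Y) (s : G ⧸ P → G) : M →ₗ[K] (G ⧸ P → Y) :=
  LinearMap.pi fun c => π ∘ₗ ρ (s c)⁻¹

omit [Fintype (G ⧸ P)] in
theorem coordMap_apply (ρ : Representation K G M) (π : M →ₗ[K] Y) (s : G ⧸ P → G) (m : M)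
    (c : G ⧸ P) : coordMap ρ π s m c = π (ρ (s c)⁻¹ m) := rfl

end Transversal

namespace IsInducedFrom

variable {ρ : Representation K G M} {P : Subgroup G} {σ : Representation K P Y}
  {ι : Y →ₗ[K] M} {π : M →ₗ[K] Y}

theorem map_apply' (h : IsInducedFrom ρ P σ ι π) {g : G} (hg : g ∈ P) (y : Y) :
    ρ g (ι y) = ι (σ ⟨g, hg⟩ y) := (h.map_apply ⟨g, hg⟩ y).symm

theorem proj_map_apply (h : IsInducedFrom ρ P σ ι π) (x : P) (m : M) :
    π (ρ x m) = σ x (π m) := by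
  suffices π ∘ₗ ρ x = σ x ∘ₗ π from LinearMap.congr_fun this m
  refine linearMap_ext_of_iSup_eq_top h.iSup_eq_top fun g y => ?_
  simp only [LinearMap.comp_apply, ← mul_apply]
  by_cases hg : g ∈ P
  · rw [h.map_apply' hg, h.map_apply' (mul_mem x.2 hg), h.proj_apply, h.proj_apply, ← mul_apply]
    rfl
  · rw [h.proj_eq_zero g hg, map_zero, h.proj_eq_zero _ (fun hx => hg
      ((Subgroup.mul_mem_cancel_left P x.2).1 hx))]

section Transversal

variable [Fintype (G ⧸ P)] {s : G ⧸ P → G} (hs : ∀ c, (s c : G ⧸ P) = c)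
include hs

theorem coordMap_sumMap (h : IsInducedFrom ρ P σ ι π) (f : G ⧸ P → Y) :
    coordMap ρ π s (sumMap ρ ι s f) = f := by
  classical
  ext c
  rw [coordMap_apply, sumMap_apply, map_sum, map_sum, Finset.sum_eq_single c]
  · rw [inv_apply_apply, h.proj_apply]
  · intro d _ hd
    rw [← mul_apply, h.proj_eq_zero]
    intro hP
    rw [← QuotientGroup.eq, hs, hs] at hP
    exact hd hP.symm
  · simp

theorem sumMap_coordMap (h : IsInducedFrom ρ P σ ι π) (m : M) :
    sumMap ρ ι s (coordMap ρ π s m) = m := by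
  classical
  suffices sumMap ρ ι s ∘ₗ coordMap ρ π s = LinearMap.id from LinearMap.congr_fun this m
  refine linearMap_ext_of_iSup_eq_top h.iSup_eq_top fun g y => ?_
  have hg : (s g)⁻¹ * g ∈ P := by rw [← QuotientGroup.eq, hs]
  rw [LinearMap.comp_apply, sumMap_apply, Finset.sum_eq_single (g : G ⧸ P), coordMap_apply,
    ← mul_apply, h.map_apply' hg, h.proj_apply, ← h.map_apply' hg, ← mul_apply]
  · simp
  · intro c _ hc
    rw [coordMap_apply, ← mul_apply, h.proj_eq_zero, map_zero, map_zero]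
    intro hP
    rw [← QuotientGroup.eq, hs] at hP
    exact hc hP
  · simp

/-- The coordinates with respect to a transversal, as an equivalence. -/
def coordEquiv (h : IsInducedFrom ρ P σ ι π) : M ≃ₗ[K] (G ⧸ P → Y) :=
  LinearEquiv.ofLinearMap (coordMap ρ π s) (sumMap ρ ι s)
    (LinearMap.ext (h.coordMap_sumMap hs)) (LinearMap.ext (h.sumMap_coordMap hs))

theorem coordEquiv_apply (h : IsInducedFrom ρ P σ ι π) (m : M) (c : G ⧸ P) :
    h.coordEquiv hs m c = π (ρ (s c)⁻¹ m) := rfl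

theorem coordEquiv_symm_apply (h : IsInducedFrom ρ P σ ι π) (f : G ⧸ P → Y) :
    (h.coordEquiv hs).symm f = ∑ c, ρ (s c) (ι (f c)) := sumMap_apply ρ ι s f

end Transversal

theorem out_eq (c : G ⧸ P) : ((c.out : G) : G ⧸ P) = c := QuotientGroup.out_eq' c

theorem finrank_eq [Finite G] [FiniteDimensional K Y] (h : IsInducedFrom ρ P σ ι π) :
    Module.finrank K M = P.index * Module.finrank K Y := by
  have := Fintype.ofFinite (G ⧸ P)
  rw [(h.coordEquiv out_eq).finrank_eq, Module.finrank_pi_fintype, Finset.sum_const,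
    Finset.card_univ, smul_eq_mul, Subgroup.index, Nat.card_eq_fintype_card]

theorem injective (h : IsInducedFrom ρ P σ ι π) : Function.Injective ι :=
  Function.LeftInverse.injective h.proj_apply

/-- Two representations induced from the same representation are equivalent. -/
theorem nonempty_equiv [Finite G] {ρ' : Representation K G M'} {ι' : Y →ₗ[K] M'} {π' : M' →ₗ[K] Y}
    (h : IsInducedFrom ρ P σ ι π) (h' : IsInducedFrom ρ' P σ ι' π') : Nonempty (ρ.Equiv ρ') := by
  classical
  have := Fintype.ofFinite (G ⧸ P)
  let e := (h.coordEquiv out_eq).trans (h'.coordEquiv out_eq).symm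
  have he : ∀ g y, e (ρ g (ι y)) = ρ' g (ι' y) := by
    intro g y
    have hg : ((g : G ⧸ P).out)⁻¹ * g ∈ P := by rw [← QuotientGroup.eq, out_eq]
    rw [LinearEquiv.trans_apply, coordEquiv_symm_apply, Finset.sum_eq_single (g : G ⧸ P),
      coordEquiv_apply, ← mul_apply, h.map_apply' hg, h.proj_apply, ← h'.map_apply' hg,
      ← mul_apply, mul_inv_cancel_left]
    · intro c _ hc
      rw [coordEquiv_apply, ← mul_apply, h.proj_eq_zero, map_zero, map_zero]
      intro hP
      rw [← QuotientGroup.eq, out_eq] at hP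
      exact hc hP
    · simp
  refine ⟨Equiv.mk e fun g => linearMap_ext_of_iSup_eq_top h.iSup_eq_top fun k y => ?_⟩
  simp only [LinearMap.comp_apply, LinearEquiv.coe_coe]
  rw [← mul_apply, he, he, mul_apply]

theorem of_equiv {ρ' : Representation K G M'} (h : IsInducedFrom ρ P σ ι π) (e : M ≃ₗ[K] M')
    (he : ∀ g m, e (ρ g m) = ρ' g (e m)) :
    IsInducedFrom ρ' P σ (e.toLinearMap ∘ₗ ι) (π ∘ₗ e.symm.toLinearMap) where
  map_apply x y := by
    simp only [LinearMap.comp_apply, h.map_apply]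
    exact he x (ι y)
  proj_apply y := by simp [h.proj_apply]
  proj_eq_zero g hg y := by
    simp only [LinearMap.comp_apply, LinearEquiv.coe_coe]
    rw [← he, LinearEquiv.symm_apply_apply, h.proj_eq_zero g hg]
  iSup_eq_top := by
    have h1 : (⊤ : Submodule K M).map e.toLinearMap = ⊤ := by
      rw [Submodule.map_top, LinearEquiv.range]
    rw [← h1, ← h.iSup_eq_top, Submodule.map_iSup]
    congr 1
    ext1 g
    rw [LinearMap.range_comp, ← Submodule.map_comp, ← Submodule.map_comp]
    congr 1
    ext m
    exact (he g m).symm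

/-- Spanning translates make the map from the sum of copies of `Y` over `G/P` surjective, and the
dimension makes it bijective. The retraction is a coordinate of the inverse. -/
theorem of_iSup_eq_top [Finite G] [FiniteDimensional K M] [FiniteDimensional K Y]
    (map_apply : ∀ (x : P) y, ι (σ x y) = ρ x (ι y))
    (iSup_eq_top : ⨆ g, (LinearMap.range ι).map (ρ g) = ⊤)
    (hfin : Module.finrank K M = P.index * Module.finrank K Y) :
    ∃ π, IsInducedFrom ρ P σ ι π := by
  classical
  have := Fintype.ofFinite (G ⧸ P)
  let s : G ⧸ P → G := fun c => c.out
  have hs : ∀ c, (s c : G ⧸ P) = c := out_eq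
  have key : ∀ (g : G) y, ∃ x : P, g = s g * x ∧
      ρ g (ι y) = sumMap ρ ι s (Pi.single (g : G ⧸ P) (σ x y)) := by
    intro g y
    have hg : (s g)⁻¹ * g ∈ P := by rw [← QuotientGroup.eq, hs]
    refine ⟨⟨_, hg⟩, by simp, ?_⟩
    rw [sumMap_apply, Finset.sum_eq_single (g : G ⧸ P)]
    · rw [Pi.single_eq_same, map_apply, ← mul_apply, mul_inv_cancel_left]
    · intro c _ hc
      rw [Pi.single_eq_of_ne hc, map_zero, map_zero]
    · simp
  have hsurj : Function.Surjective (sumMap ρ ι s) := by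
    rw [← LinearMap.range_eq_top, eq_top_iff, ← iSup_eq_top]
    refine iSup_le fun g => ?_
    rintro _ ⟨_, ⟨y, rfl⟩, rfl⟩
    obtain ⟨x, -, e⟩ := key g y
    exact ⟨_, e.symm⟩
  have hdim : Module.finrank K (G ⧸ P → Y) = Module.finrank K M := by
    rw [hfin, Module.finrank_pi_fintype, Finset.sum_const, Finset.card_univ, smul_eq_mul,
      Subgroup.index, Nat.card_eq_fintype_card]
  have hinj := (LinearMap.injective_iff_surjective_of_finrank_eq_finrank hdim).2 hsurj
  let e := LinearEquiv.ofBijective (sumMap ρ ι s) ⟨hinj, hsurj⟩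
  have hs1 : s (1 : G) ∈ P := by
    have := hs (1 : G)
    rw [eq_comm, QuotientGroup.eq] at this
    simpa using this
  have he : ∀ (g : G) y, ∃ x : P, g = s g * x ∧ e.symm (ρ g (ι y)) = Pi.single (g : G ⧸ P) (σ x y) := by
    intro g y
    obtain ⟨x, hx, h⟩ := key g y
    exact ⟨x, hx, by rw [h]; exact e.symm_apply_apply _⟩
  -- The transversal need not represent the trivial coset by `1`; the factor `σ (s 1)` corrects
  -- this.
  refine ⟨σ ⟨_, hs1⟩ ∘ₗ LinearMap.proj ((1 : G) : G ⧸ P) ∘ₗ e.symm.toLinearMap, map_apply, ?_, ?_,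
    iSup_eq_top⟩
  · intro y
    obtain ⟨x, hx, h⟩ := he 1 y
    rw [one_apply] at h
    simp only [LinearMap.comp_apply, LinearEquiv.coe_coe, h, LinearMap.proj_apply,
      Pi.single_eq_same]
    rw [← mul_apply]
    have : (⟨_, hs1⟩ * x : P) = 1 := Subtype.ext hx.symm
    rw [this, one_apply]
  · intro g hg y
    obtain ⟨x, hx, h⟩ := he g y
    simp only [LinearMap.comp_apply, LinearEquiv.coe_coe, h, LinearMap.proj_apply]
    rw [Pi.single_eq_of_ne, map_zero]
    intro h1
    rw [QuotientGroup.eq] at h1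
    simp only [inv_one, one_mul] at h1
    exact hg h1

end IsInducedFrom

/-! ### Irreducible representations -/

theorem IsIrreducible.eq_top {ρ : Representation K G M} (hρ : ρ.IsIrreducible) {N : Submodule K M}
    (hN : ∀ g, ∀ m ∈ N, ρ g m ∈ N) (h : N ≠ ⊥) : N = ⊤ := by
  have h1 := hρ.eq_bot_or_eq_top (⟨N, hN⟩ : Subrepresentation ρ)
  rcases h1 with h1 | h1
  · exact absurd (congrArg Subrepresentation.toSubmodule h1) h
  · exact congrArg Subrepresentation.toSubmodule h1

theorem IsIrreducible.nontrivial_module {ρ : Representation K G M} (hρ : ρ.IsIrreducible) :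
    Nontrivial M := by
  by_contra h
  rw [not_nontrivial_iff_subsingleton] at h
  obtain ⟨a, b, hab⟩ := hρ.exists_pair_ne
  exact hab (Subrepresentation.toSubmodule_injective (Subsingleton.elim _ _))

theorem IsIrreducible.finiteDimensional [Finite G] {ρ : Representation K G M}
    (hρ : ρ.IsIrreducible) : FiniteDimensional K M := by
  obtain ⟨m, hm⟩ := @exists_ne _ hρ.nontrivial_module (0 : M)
  have h : Submodule.span K (Set.range fun g => ρ g m) = ⊤ := by
    refine hρ.eq_top (fun g x hx => ?_) ?_
    · induction hx using Submodule.span_induction with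
      | mem x hx =>
        obtain ⟨k, rfl⟩ := hx
        exact Submodule.subset_span ⟨g * k, mul_apply ρ g k m⟩
      | zero => rw [map_zero]; exact zero_mem _
      | add x y _ _ hx hy => rw [map_add]; exact add_mem hx hy
      | smul a x _ hx => rw [map_smul]; exact Submodule.smul_mem _ _ hx
    · intro h
      have h1 : m ∈ Submodule.span K (Set.range fun g => ρ g m) :=
        Submodule.subset_span ⟨1, one_apply ρ m⟩
      rw [h, Submodule.mem_bot] at h1
      exact hm h1
  have : Module.Finite K (⊤ : Submodule K M) := by
    rw [← h]
    exact Module.Finite.span_of_finite K (Set.finite_range _)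
  exact Module.Finite.of_surjective (⊤ : Submodule K M).subtype fun x => ⟨⟨x, Submodule.mem_top⟩, rfl⟩

theorem IsIrreducible.iSup_map_eq_top {ρ : Representation K G M} (hρ : ρ.IsIrreducible)
    {N : Submodule K M} (h : N ≠ ⊥) : ⨆ g, N.map (ρ g) = ⊤ := by
  refine hρ.eq_top (fun g m hm => ?_) fun h1 => h ?_
  · have h1 : (⨆ k, N.map (ρ k)).map (ρ g) ≤ ⨆ k, N.map (ρ k) := by
      rw [Submodule.map_iSup]
      refine iSup_le fun k => ?_
      rw [← Submodule.map_comp]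
      refine le_iSup_of_le (g * k) ?_
      rw [map_mul]
      rfl
    exact h1 ⟨m, hm, rfl⟩
  · rw [eq_bot_iff, ← h1]
    refine le_iSup_of_le 1 ?_
    rw [map_one]
    exact (Submodule.map_id N).ge

/-- For `P = Q ⋊ L`, the inflation to `P` of a representation of `L`. -/
theorem exists_inflation {P Q L : Subgroup G} (exists_mul : ∀ x ∈ P, ∃ q ∈ Q, ∃ l ∈ L, x = q * l)
    (L_le : L ≤ P) (conj_mem : ∀ x ∈ P, ∀ q ∈ Q, x * q * x⁻¹ ∈ Q)
    (hQL : Q ⊓ L = ⊥) (τ : Representation K L Y) : ∃ σ : Representation K P Y,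
      (∀ (x : P) (hx : (x : G) ∈ L), σ x = τ ⟨x, hx⟩) ∧ ∀ x : P, (x : G) ∈ Q → σ x = 1 := by
  have huniq : ∀ {q q' l l'}, q ∈ Q → q' ∈ Q → l ∈ L → l' ∈ L → q * l = q' * l' → l = l' := by
    intro q q' l l' hq hq' hl hl' h
    have h1 : q'⁻¹ * q = l' * l⁻¹ := by
      rw [inv_mul_eq_iff_eq_mul, ← mul_assoc, ← h]; group
    have h2 : l' * l⁻¹ ∈ Q ⊓ L :=
      Subgroup.mem_inf.2 ⟨h1 ▸ mul_mem (inv_mem hq') hq, mul_mem hl' (inv_mem hl)⟩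
    rw [hQL, Subgroup.mem_bot, mul_inv_eq_one] at h2
    exact h2.symm
  choose! q hq l hl e using exists_mul
  let θ : P →* L :=
    { toFun := fun x => ⟨l x, hl x x.2⟩
      map_one' := Subtype.ext (huniq (hq 1 P.one_mem) Q.one_mem (hl 1 P.one_mem) L.one_mem
        (by change q 1 * l 1 = 1 * 1; rw [← e 1 P.one_mem, one_mul]))
      map_mul' := fun x y => Subtype.ext (by
        refine huniq (hq _ (x * y).2) (mul_mem (hq x x.2)
          (conj_mem _ (L_le (hl x x.2)) _ (hq y y.2))) (hl _ (x * y).2)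
          (mul_mem (hl x x.2) (hl y y.2)) ?_
        change q (x * y) * l (x * y) = q x * (l x * q y * (l x)⁻¹) * (l x * l y)
        rw [← e _ (mul_mem x.2 y.2)]
        calc (x * y : G) = q x * l x * (q y * l y) := by rw [← e x x.2, ← e y y.2]
          _ = _ := by group) }
  refine ⟨τ.comp θ, fun x hx => ?_, fun x hx => ?_⟩
  · have : θ x = ⟨x, hx⟩ := Subtype.ext (huniq (hq x x.2) Q.one_mem (hl x x.2) hx
      (by change q x * l x = 1 * x; rw [← e x x.2, one_mul]))
    rw [MonoidHom.comp_apply, this]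
  · have : θ x = 1 := Subtype.ext (huniq (hq x x.2) hx (hl x x.2) L.one_mem
      (by change q x * l x = x * 1; rw [← e x x.2, mul_one]))
    rw [MonoidHom.comp_apply, this, map_one]

/-- An irreducible representation that is induced from `P` is also Harish-Chandra induced from an
opposite `P' = Q'L`. -/
theorem IsInducedFrom.opposite [Finite G] {ρ : Representation K G M} (hρ : ρ.IsIrreducible)
    {P L P' Q' : Subgroup G} {σ : Representation K P Y} {ι : Y →ₗ[K] M} {π : M →ₗ[K] Y}
    (h : IsInducedFrom ρ P σ ι π)
    (exists_mul : ∀ x ∈ P', ∃ q ∈ Q', ∃ l ∈ L, x = q * l) (Q_le : Q' ≤ P') (L_le : L ≤ P)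
    (L_le' : L ≤ P') (conj_mem : ∀ x ∈ P', ∀ q ∈ Q', x * q * x⁻¹ ∈ Q') (hQP : Q' ⊓ P = ⊥)
    (card_eq : Nat.card P = Nat.card P') {σ' : Representation K P' Y}
    (hL : ∀ l (hl : l ∈ L), σ' ⟨l, L_le' hl⟩ = σ ⟨l, L_le hl⟩)
    (hQ : ∀ x : P', (x : G) ∈ Q' → σ' x = 1) :
    ∃ ι' π', IsInducedFrom ρ P' σ' ι' π' := by
  classical
  have := Fintype.ofFinite Q'
  have := hρ.finiteDimensional
  have : FiniteDimensional K Y := Module.Finite.of_injective ι h.injective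
  let ι' : Y →ₗ[K] M := ∑ q : Q', ρ q ∘ₗ ι
  have hι' : ∀ y, ι' y = ∑ q : Q', ρ q (ι y) := fun y => by simp [ι']
  have hinv : ∀ q ∈ Q', ∀ y, ρ q (ι' y) = ι' y := by
    intro q hq y
    rw [hι', map_sum]
    refine Fintype.sum_equiv (Equiv.mulLeft ⟨q, hq⟩) _ _ fun k => ?_
    rw [← mul_apply]
    rfl
  have hlin : ∀ l (hl : l ∈ L) y, ρ l (ι' y) = ι' (σ ⟨l, L_le hl⟩ y) := by
    intro l hl y
    rw [hι', hι', map_sum]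
    let e : Q' ≃ Q' :=
      { toFun := fun q => ⟨l * q * l⁻¹, conj_mem l (L_le' hl) q q.2⟩
        invFun := fun q => ⟨l⁻¹ * q * l, by simpa using conj_mem _ (inv_mem (L_le' hl)) q q.2⟩
        left_inv := fun q => Subtype.ext (by simp [mul_assoc])
        right_inv := fun q => Subtype.ext (by simp [mul_assoc]) }
    refine Fintype.sum_equiv e _ _ fun q => ?_
    change _ = ρ (l * q * l⁻¹) _
    rw [← h.map_apply' (L_le hl), ← mul_apply, ← mul_apply]
    simp
  have hproj : ∀ y, π (ι' y) = y := by
    intro y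
    -- The retraction kills `ρ q (ι y)` for `q ∉ P`, and `Q' ∩ P = 1`, so only the term of `q = 1`
    -- survives.
    rw [hι', map_sum, Finset.sum_eq_single 1]
    · rw [Subgroup.coe_one, one_apply, h.proj_apply]
    · intro q _ hq
      refine h.proj_eq_zero _ (fun hqP => hq ?_) y
      have : (q : G) ∈ Q' ⊓ P := ⟨q.2, hqP⟩
      rw [hQP, Subgroup.mem_bot] at this
      exact Subtype.ext this
    · simp
  have hY : LinearMap.range ι' ≠ ⊥ := by
    intro h0
    rw [LinearMap.range_eq_bot] at h0
    have h1 : ∀ y : Y, y = 0 := fun y => by rw [← hproj y, h0]; simp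
    have h2 := h.iSup_eq_top
    have h3 : LinearMap.range ι = ⊥ := by
      rw [LinearMap.range_eq_bot]
      ext y
      rw [h1 y, map_zero, map_zero]
    have := hρ.nontrivial_module
    simp [h3] at h2
  refine ⟨ι', of_iSup_eq_top ?_ (hρ.iSup_map_eq_top hY) ?_⟩
  · rintro ⟨x, hx⟩ y
    obtain ⟨q, hq, l, hl, rfl⟩ := exists_mul x hx
    have e : (⟨q * l, hx⟩ : P') = ⟨q, Q_le hq⟩ * ⟨l, L_le' hl⟩ := rfl
    rw [e, mul_apply, hQ _ hq, hL l hl]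
    change ι' (σ _ y) = ρ (q * l) (ι' y)
    rw [mul_apply, hlin l hl, hinv q hq]
  · rw [h.finrank_eq]
    congr 1
    have h1 := P.card_mul_index
    have h2 := P'.card_mul_index
    rw [← h2, card_eq] at h1
    exact Nat.eq_of_mul_eq_mul_left Nat.card_pos h1

end Representation

/-! ### Transversals adapted to the double cosets of `Q` and `P`. -/

namespace IsOppositePair

variable {G : Type*} [Group G] {P Q L P' Q' : Subgroup G}

/-- A transversal of `G/P` of the form `q r` with `q ∈ Q` and `r` depending only on the double
coset `QrP` and compatible with the Levi decomposition. -/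
theorem exists_transversal (h : IsOppositePair P Q L P' Q') : ∃ q r : G ⧸ P → G,
    (∀ c, q c ∈ Q) ∧ (∀ c, ((q c * r c : G) : G ⧸ P) = c) ∧ (∀ c, ∀ u ∈ Q, r (u • c) = r c) ∧
    ∀ c, ∀ q₁ ∈ Q, ∀ l ∈ L, r c * (q₁ * l) * (r c)⁻¹ ∈ Q → r c * l * (r c)⁻¹ ∈ Q := by
  choose a ha b x hx e H using h.exists_rep
  -- A fixed representative of the `Q`-orbit of a coset makes `r` constant on orbits.
  let o : G ⧸ P → G := fun c =>
    (Quotient.out (Quotient.mk (MulAction.orbitRel Q (G ⧸ P)) c) : G ⧸ P).out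
  have ho : ∀ c, ∃ u ∈ Q, ((u * o c : G) : G ⧸ P) = c := by
    intro c
    obtain ⟨u, hu⟩ : (MulAction.orbitRel Q (G ⧸ P)) c
        (Quotient.out (Quotient.mk (MulAction.orbitRel Q (G ⧸ P)) c)) :=
      (MulAction.orbitRel Q (G ⧸ P)).symm (Quotient.mk_out (s := MulAction.orbitRel Q (G ⧸ P)) c)
    refine ⟨u, u.2, ?_⟩
    have h1 : ((o c : G) : G ⧸ P) =
        Quotient.out (Quotient.mk (MulAction.orbitRel Q (G ⧸ P)) c) := QuotientGroup.out_eq' _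
    change (u : G) • ((o c : G) : G ⧸ P) = c
    rw [h1]
    exact hu
  choose u hu hc using ho
  refine ⟨fun c => u c * a (o c), fun c => b (o c), fun c => mul_mem (hu c) (ha _), fun c => ?_,
    fun c v hv => ?_, fun c => H (o c)⟩
  · nth_rw 3 [← hc c]
    rw [QuotientGroup.eq]
    have : (u c * a (o c) * b (o c))⁻¹ * (u c * o c) = x (o c) := by
      rw [inv_mul_eq_iff_eq_mul, mul_assoc (u c), mul_assoc (u c), ← e (o c)]
    rw [this]
    exact hx _
  · have : o (v • c) = o c := by
      have h1 : Quotient.mk (MulAction.orbitRel Q (G ⧸ P)) (v • c) =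
          Quotient.mk (MulAction.orbitRel Q (G ⧸ P)) c :=
        Quotient.sound ⟨⟨v, hv⟩, rfl⟩
      simp only [o, h1]
    simp only [this]

end IsOppositePair

/-! ### Comparison of the inducing representations, and block systems. -/

namespace Representation

variable {K G M Y : Type*} [Field K] [Group G] [AddCommGroup M] [Module K M]
  [AddCommGroup Y] [Module K Y]

/-- If a representation is induced from two representations of `P` with the same restriction to
the Levi complement `L` and `Q` acts trivially for one of them, it does so for the other. -/
theorem IsInducedFrom.eq_one_of_mem [Finite G] [FiniteDimensional K M]
    {ρ : Representation K G M} {P Q L P' Q' : Subgroup G} (hP : IsOppositePair P Q L P' Q')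
    {σ τ : Representation K P Y} {ι κ : Y →ₗ[K] M} {π θ : M →ₗ[K] Y}
    (h : IsInducedFrom ρ P σ ι π) (h' : IsInducedFrom ρ P τ κ θ)
    (hL : ∀ l : P, (l : G) ∈ L → τ l = σ l) (hQ : ∀ u : P, (u : G) ∈ Q → τ u = 1)
    (u : P) (hu : (u : G) ∈ Q) : σ u = 1 := by
  have := Fintype.ofFinite (G ⧸ P)
  obtain ⟨q, r, hq, hs, hr, hlevi⟩ := hP.exists_transversal
  set s : G ⧸ P → G := fun c => q c * r c with hsdef
  let I : Submodule K M :=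
    { carrier := {m | ∀ u ∈ Q, ρ u m = m}
      add_mem' := fun {a b} ha hb u hu => by rw [map_add, ha u hu, hb u hu]
      zero_mem' := fun u _ => map_zero _
      smul_mem' := fun k m hm u hu => by rw [map_smul, hm u hu] }
  -- `Ψ` carries the coordinates for `σ` over to `τ`. It is only linear, but it preserves the space
  -- `I` of `Q`-fixed vectors.
  let Ψ : M ≃ₗ[K] M := (h.coordEquiv hs).trans (h'.coordEquiv hs).symm
  have hΨ : ∀ m, Ψ m = ∑ c, ρ (s c) (κ (π (ρ (s c)⁻¹ m))) := fun m =>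
    h'.coordEquiv_symm_apply hs _
  have hI : I.map Ψ.toLinearMap ≤ I := by
    rintro _ ⟨m, hm, rfl⟩ u hu
    rw [LinearEquiv.coe_coe, hΨ, map_sum]
    refine Fintype.sum_equiv (MulAction.toPerm u) _ _ fun c => ?_
    rw [MulAction.toPerm_apply, ← mul_apply]
    -- For a `Q`-fixed vector the coordinate depends only on the double coset.
    have hy : ∀ d, π (ρ (s d)⁻¹ m) = π (ρ (r d)⁻¹ m) := fun d => by
      rw [hsdef, mul_inv_rev, mul_apply, hm _ (inv_mem (hq d))]
    rw [hy, hy, hr c u hu]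
    set y := π (ρ (r c)⁻¹ m) with hydef
    have hsc : s (u • c) = q (u • c) * r c := by rw [hsdef]; simp only [hr c u hu]
    have hx : (u * s c)⁻¹ * s (u • c) ∈ P := by
      rw [← QuotientGroup.eq, hs]
      change u • ((s c : G) : G ⧸ P) = u • c
      rw [hs]
    obtain ⟨q₁, hq₁, l, hl, e⟩ := hP.exists_mul _ hx
    -- The elements `us(c)` and `s(uc)` differ by `x = q₁l ∈ P ∩ r⁻¹Qr`. Then `l ∈ r⁻¹Qr` as well,
    -- so `σ l` fixes `y`; and `τ x` acts on `y` as `σ l`.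
    have hrQ : r c * (q₁ * l) * (r c)⁻¹ ∈ Q := by
      have : r c * (q₁ * l) * (r c)⁻¹ = (q c)⁻¹ * u⁻¹ * q (u • c) := by
        rw [← e, hsc, hsdef]
        group
      rw [this]
      exact mul_mem (mul_mem (inv_mem (hq c)) (inv_mem hu)) (hq _)
    have hly : σ ⟨l, hP.L_le hl⟩ y = y := by
      rw [hydef, ← h.proj_map_apply, ← mul_apply]
      have e2 : l * (r c)⁻¹ = (r c)⁻¹ * (r c * l * (r c)⁻¹) := by group
      rw [e2, mul_apply, hm _ (hlevi c q₁ hq₁ l hl hrQ)]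
    have hxy : τ ⟨_, hx⟩ y = y := by
      have e3 : (⟨_, hx⟩ : P) = ⟨q₁, hP.Q_le hq₁⟩ * ⟨l, hP.L_le hl⟩ := Subtype.ext e
      rw [e3, mul_apply, hQ _ hq₁, hL _ hl, hly]
      rfl
    have e4 : s (u • c) = u * s c * ((u * s c)⁻¹ * s (u • c)) := by group
    rw [e4, mul_apply ρ (u * s c), h'.map_apply' hx, hxy]
  have hIeq : I.map Ψ.toLinearMap = I :=
    Submodule.eq_of_le_of_finrank_eq hI (LinearEquiv.finrank_map_eq Ψ I)
  have hs1 : s (1 : G) ∈ P := by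
    have := hs (1 : G)
    rw [eq_comm, QuotientGroup.eq] at this
    simpa using this
  -- Since `Q` acts trivially under `τ`, every `y` is the coordinate at the trivial coset of a
  -- `Q`-fixed vector for `τ`. By `hIeq` it is also one for `σ`, where equivariance of `π` makes it
  -- fixed by `σ u`.
  have key : ∀ y, σ u y = y := by
    intro y
    have hκ : κ (τ ⟨_, hs1⟩ y) ∈ I := by
      intro v hv
      rw [h'.map_apply' (hP.Q_le hv), hQ _ hv]
      rfl
    rw [← hIeq] at hκ
    obtain ⟨m, hm, hmy⟩ := hκ
    have h1 : h.coordEquiv hs m = h'.coordEquiv hs (κ (τ ⟨_, hs1⟩ y)) := by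
      rw [← hmy]
      exact ((h'.coordEquiv hs).apply_symm_apply _).symm
    have h2 := congrFun h1 ((1 : G) : G ⧸ P)
    rw [IsInducedFrom.coordEquiv_apply, IsInducedFrom.coordEquiv_apply, h'.map_apply,
      inv_apply_apply, h'.proj_apply] at h2
    rw [← h2, ← h.proj_map_apply, ← mul_apply]
    have e : (u : G) * (s (1 : G))⁻¹ = (s (1 : G))⁻¹ * (s (1 : G) * u * (s (1 : G))⁻¹) := by group
    rw [e, mul_apply, hm _ (hP.conj_mem _ hs1 _ hu)]
  exact LinearMap.ext key

/-- If an irreducible representation is induced from a parabolic subgroup, the unipotent radical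
acts trivially on the inducing representation. -/
theorem IsInducedFrom.eq_one_of_isIrreducible [Finite G] {ρ : Representation K G M}
    (hρ : ρ.IsIrreducible) {P Q L P' Q' : Subgroup G} (hP : IsOppositePair P Q L P' Q')
    {σ : Representation K P Y} {ι : Y →ₗ[K] M} {π : M →ₗ[K] Y} (h : IsInducedFrom ρ P σ ι π)
    (u : P) (hu : (u : G) ∈ Q) : σ u = 1 := by
  have := hρ.finiteDimensional
  have hQL : Q ⊓ L = ⊥ := by
    rw [eq_bot_iff, ← hP.inf_eq_bot]
    exact inf_le_inf_left _ hP.L_le'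
  have hQL' : Q' ⊓ L = ⊥ := by
    rw [eq_bot_iff, ← hP.inf_eq_bot']
    exact inf_le_inf_left _ hP.L_le
  let σL : Representation K L Y := σ.comp (Subgroup.inclusion hP.L_le)
  obtain ⟨σ', hL', hQ'⟩ := exists_inflation hP.exists_mul' hP.L_le' hP.conj_mem' hQL' σL
  obtain ⟨τ, hL, hQ⟩ := exists_inflation hP.exists_mul hP.L_le hP.conj_mem hQL σL
  -- The passage to the opposite parabolic subgroup and back replaces `σ` by the inflation of its
  -- restriction to `L`.
  obtain ⟨ι', π', h'⟩ := h.opposite hρ hP.exists_mul' hP.Q_le' hP.L_le hP.L_le' hP.conj_mem'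
    hP.inf_eq_bot' hP.card_eq (fun l hl => hL' _ hl) hQ'
  obtain ⟨κ, θ, h''⟩ := h'.opposite hρ hP.exists_mul hP.Q_le hP.L_le' hP.L_le hP.conj_mem
    hP.inf_eq_bot hP.card_eq.symm (σ' := τ) (fun l hl => by rw [hL _ hl, hL' _ hl]) hQ
  exact h.eq_one_of_mem hP h'' (fun l hl => hL l hl) hQ u hu

/-- The action of the stabilizer on a block. -/
def IsBlockSystem.blockRep {ρ : Representation K G M} {H : Subgroup G}
    {V : Fin H.index → Submodule K M} {i₀ : Fin H.index} (h : ρ.IsBlockSystem H V i₀) :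
    Representation K H (V i₀) where
  toFun x := (ρ x).restrict fun v hv => by
    rw [← (h.stabilizer x).1 x.2]
    exact ⟨v, hv, rfl⟩
  map_one' := by ext; simp
  map_mul' x y := by ext; simp

theorem IsBlockSystem.coe_blockRep_apply {ρ : Representation K G M} {H : Subgroup G}
    {V : Fin H.index → Submodule K M} {i₀ : Fin H.index} (h : ρ.IsBlockSystem H V i₀) (x : H)
    (v : V i₀) : (h.blockRep x v : M) = ρ x v := rfl

/-- The retraction is the projection to the block along the sum of the other blocks, into which
elements outside the stabilizer move it. -/
theorem IsBlockSystem.exists_isInducedFrom {ρ : Representation K G M} {H : Subgroup G}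
    {V : Fin H.index → Submodule K M} {i₀ : Fin H.index} (h : ρ.IsBlockSystem H V i₀) :
    ∃ π, IsInducedFrom ρ H h.blockRep (V i₀).subtype π := by
  have hc : IsCompl (V i₀) (⨆ (j) (_ : j ≠ i₀), V j) := by
    refine ⟨h.isInternal.submodule_iSupIndep i₀, codisjoint_iff_le_sup.2 ?_⟩
    rw [← h.isInternal.submodule_iSup_eq_top]
    refine iSup_le fun j => ?_
    by_cases hj : j = i₀
    · rw [hj]; exact le_sup_left
    · exact le_sup_of_le_right (le_iSup₂_of_le j hj le_rfl)
  refine ⟨(V i₀).projectionOnto _ hc, fun x y => h.coe_blockRep_apply x y,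
    fun y => Submodule.projectionOnto_apply_left hc y, fun g hg y => ?_, ?_⟩
  · rw [Submodule.projectionOnto_apply_eq_zero_iff]
    obtain ⟨j, hj⟩ := h.permutes g i₀
    have hne : j ≠ i₀ := by
      rintro rfl
      exact hg ((h.stabilizer g).2 hj)
    have h1 : ρ g y ∈ V j := by rw [← hj]; exact ⟨y, y.2, rfl⟩
    exact le_iSup₂_of_le (f := fun j (_ : j ≠ i₀) => V j) j hne le_rfl h1
  · rw [eq_top_iff, ← h.isInternal.submodule_iSup_eq_top]
    refine iSup_le fun j => ?_
    obtain ⟨g, hg⟩ := h.transitive i₀ j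
    refine le_iSup_of_le g ?_
    rw [Submodule.range_subtype, hg]

open scoped _root_.TensorProduct in
/-- Mathlib's induced representation is induced in the sense of `IsInducedFrom`. -/
theorem exists_isInducedFrom_ind {P : Subgroup G} (σ : Representation K P Y) :
    ∃ π, IsInducedFrom (ind P.subtype σ) P σ (IndV.mk P.subtype σ 1) π := by
  classical
  -- The coinvariants identify `(xg, σ x y)` with `(g, y)` for `x ∈ P`. Thus for `g ∈ P` the class
  -- of `(g, y)` is that of `(1, σ g⁻¹ y)`, and the classes with `g ∉ P` are sent to `0`.
  let f : G → Y →ₗ[K] Y := fun g => if hg : g ∈ P then σ ⟨g, hg⟩⁻¹ else 0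
  have hf : ∀ (x : P) g y, f (x * g) (σ x y) = f g y := by
    intro x g y
    simp only [f, Subgroup.mul_mem_cancel_left P x.2]
    split_ifs with hg
    · rw [← mul_apply]
      congr 2
      exact Subtype.ext (by simp)
    · rfl
  let π : IndV P.subtype σ →ₗ[K] Y := Coinvariants.lift _
    (TensorProduct.lift ((Finsupp.lift _ _ _ f) ∘ₗ
      (MonoidAlgebra.coeffLinearEquiv K).toLinearMap)) fun x => by
        ext h y
        simpa using hf x h y
  have hπ : ∀ g y, π (IndV.mk P.subtype σ g y) = f g y := by
    intro g y
    simp [π]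
  have hmk : ∀ (x : P) g y, IndV.mk P.subtype σ (x * g) (σ x y) = IndV.mk P.subtype σ g y := by
    intro x g y
    have := Coinvariants.mk_self_apply
      (tprod ((leftRegular K G).comp P.subtype) σ) x (MonoidAlgebra.single g 1 ⊗ₜ[K] y)
    simpa using this
  refine ⟨π, fun x y => ?_, fun y => ?_, fun g hg y => ?_, ?_⟩
  · rw [ind_mk, one_mul, ← hmk x (x : G)⁻¹, mul_inv_cancel]
  · have h1 : (⟨1, one_mem P⟩ : P)⁻¹ = 1 := inv_one
    rw [hπ]
    simp only [f, one_mem, dif_pos]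
    rw [h1, one_apply]
  · rw [ind_mk, hπ, one_mul]
    simp [f, hg]
  · rw [← Submodule.ker_mkQ (⨆ g, _), LinearMap.ker_eq_top]
    refine IndV.hom_ext _ _ fun g => LinearMap.ext fun y => ?_
    refine (Submodule.Quotient.mk_eq_zero _).2 (Submodule.mem_iSup_of_mem g⁻¹ ?_)
    refine ⟨_, ⟨y, rfl⟩, ?_⟩
    rw [ind_mk, one_mul, inv_inv]

end Representation

theorem proposition7p1 {p : ℕ} (hp : p.Prime) {G : Type*} [Group G] [Finite G]
    (D : SplitBNPair p G) {K : Type*} [Field K] (hK : ringChar K ≠ p)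
    {M : Type*} [AddCommGroup M] [Module K M] (ρ : Representation K G M) (hρ : ρ.IsIrreducible)
    (P Q L : Subgroup G) (hP : D.IsParabolic P Q L) (hM : ρ.IsImprimitive P) :
    (∃ (X : Submodule K M) (τ : Representation K L X), ρ.IsHarishChandraInduced P Q L τ) ∧
    (∀ (V : Fin P.index → Submodule K M) (i₀ : Fin P.index), ρ.IsBlockSystem P V i₀ →
      ∀ u ∈ Q, ∀ v ∈ V i₀, ρ u v = v) ∧
    (∀ {Y : Type*} [AddCommGroup Y] [Module K Y] (σ : Representation K P Y),
      Nonempty (ρ.Equiv (Representation.ind P.subtype σ)) →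
      ∀ u : P, (u : G) ∈ Q → σ u = 1) := by
  obtain ⟨P', Q', hPQ⟩ := hP.exists_isOppositePair
  have hblock : ∀ (V : Fin P.index → Submodule K M) (i₀ : Fin P.index)
      (h : ρ.IsBlockSystem P V i₀) (u : P), (u : G) ∈ Q → h.blockRep u = 1 := by
    intro V i₀ h u hu
    obtain ⟨π, hπ⟩ := h.exists_isInducedFrom
    exact hπ.eq_one_of_isIrreducible hρ hPQ u hu
  refine ⟨?_, fun V i₀ h u hu v hv => ?_, fun {Y} _ _ σ ⟨e⟩ u hu => ?_⟩
  · obtain ⟨V, i₀, h⟩ := hM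
    -- As `Q` acts trivially on the block, the action of `P` on it is the inflation of its
    -- restriction to `L`.
    refine ⟨V i₀, h.blockRep.comp (Subgroup.inclusion hPQ.L_le), h.blockRep, fun x hx => rfl,
      hblock V i₀ h, ?_⟩
    obtain ⟨π, hπ⟩ := h.exists_isInducedFrom
    obtain ⟨π', hπ'⟩ := Representation.exists_isInducedFrom_ind h.blockRep
    exact hπ.nonempty_equiv hπ'
  · have h1 := LinearMap.congr_fun (hblock V i₀ h ⟨u, hPQ.Q_le hu⟩ hu) ⟨v, hv⟩
    exact congrArg Subtype.val h1
  · obtain ⟨π, hπ⟩ := Representation.exists_isInducedFrom_ind σ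
    exact (hπ.of_equiv e.toLinearEquiv.symm fun g m =>
      Representation.IntertwiningMap.isIntertwining _ _ e.symm.toIntertwiningMap g m).eq_one_of_isIrreducible hρ hPQ u hu
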